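/- Consider on $\mathbb R_t\times\mathbb R^2_x$ the wave equation with $q=2$, $$\partial_t^2u-\Delta u+u\,(1+u^2)^{\frac{q-2}{2}}e^{4\pi((1+u^2)^{q/2}-1)}=0,\qquad\text{i.e.}\qquad \partial_t^2u-\Delta u+u\,e^{4\pi u^2}=0, \tag{E}$$ with $u$ real valued. The energy of data $(\varphi,\psi)$ is $E(\varphi,\psi)=\|\nabla\varphi\|_{L^2}^2+\|\psi\|_{L^2}^2+\frac1{4\pi}\int_{\mathbb R^2}(e^{4\pi\varphi^2}-1)\,dx$; data of finite energy are pairs $\varphi,\psi\in L^2(\mathbb R^2)$ with $E(\varphi,\psi)<\infty$. A weak solution of (E) on $[0,T)$ with initial data $(\varphi,\psi)$ of finite energy is a function $u$ such that $u$ and $\partial_tu$ are weakly continuous from $[0,T)$ to $L^2(\mathbb R^2)$, $(u,\partial_tu)(0)=(\varphi,\psi)$, $u\,e^{4\pi u^2}\in L^1_{loc}((0,T)\times\mathbb R^2)$, (E) holds in the sense of distributions on $(0,T)\times\mathbb R^2$, and $E(u(t),\partial_tu(t))\le E(\varphi,\psi)$ for all $t\in[0,T)$. Let $\|f\|_{L^{2,\infty}}=\sup_{\sigma>0}\sigma\,|\{|f|>\sigma\}|^{1/2}$,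 and let $\mathcal W=\{u\in L^2:\nabla u\in L^{2,\infty}\}$ with $\|u\|_{\mathcal W}=\|u\|_{L^2}+\|\nabla u\|_{L^{2,\infty}}$. Let $\chi\in\mathcal S(\mathbb R^2)$ be any function with $\chi(\xi)=1$ for $|\xi|\le1$ and $\chi(\xi)=0$ for $|\xi|>2$, let $\Delta_{-1}$ and $\Delta_j$ $(j\ge0)$ be the Fourier multipliers with symbols $\chi(\xi)$ and $\chi(2^{-j-1}\xi)-\chi(2^{-j}\xi)$, and let $\|u\|_{\mathcal B^\sigma_{2,\infty}}=\|\Delta_{-1}u\|_{L^2}+\sup_{j\ge0}2^{j\sigma}\|\Delta_ju\|_{L^2}$. Let $H^\sigma$ be the usual $L^2$-based Sobolev space of order $\sigma\in\mathbb R$. Theorem. Let $(X_0,X_1)$ be one of the pairs 1) $(\mathcal W,\;L^{2,\infty})$; 2) $(\mathcal B^1_{2,\infty},\;\mathcal B^0_{2,\infty})$; 3) $(H^s,\;H^{s-1})$, where $s<1$ is any real number. (a) There are a sequence $(\varphi_k)$ in $X_0$, with $(\varphi_k,0)$ of finite energy, and a sequence $(t_k)$ in $(0,1)$ such that $$\|\varphi_k\|_{X_0}\to0,\qquad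 t_k\to0,$$ and such that any weak solutions $u_k$ of (E) with initial data $(\varphi_k,0)$, defined on intervals $[0,T_k)$ with $T_k>t_k$ (for all large $k$), satisfy $$\lim_{k\to\infty}\|\partial_tu_k(t_k)\|_{X_1}=\infty .$$ (b) In particular the flow of (E) fails to be continuous at $0$ in the $X_0\times X_1$ topology: for no $T>0$ and $r>0$ is there a map that sends all data of finite energy with $\|\varphi\|_{X_0}+\|\psi\|_{X_1}<r$ to a weak solution $u$ on $[0,T)$ with these data and for which $(\varphi,\psi)\mapsto(u,\partial_tu)$ is continuous at $0$ from the norm of $X_0\times X_1$ to the norm $\sup_{0\le t<T}\big(\|u(t)\|_{X_0}+\|\partial_tu(t)\|_{X_1}\big)$. -/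

import Mathlib

namespace ExpWave

open MeasureTheory Set Filter Topology
open scoped ENNReal NNReal SchwartzMap ContDiff

noncomputable section

/-- The Euclidean plane. -/
abbrev Plane := EuclideanSpace ℝ (Fin 2)

/-! ### Lorentz, Sobolev and Besov norms (all with values in `[0, ∞]`) -/

/-- The norm of `L^{2,∞}`: the supremum over `σ` of `σ * |{ |f| > σ }| ^ (1/2)`. -/
def weakL2Norm {F : Type*} [NormedAddCommGroup F] (f : Plane → F) : ℝ≥0∞ :=
  ⨆ σ : ℝ≥0, (σ : ℝ≥0∞) * volume {x : Plane | (σ : ℝ≥0∞) < ‖f x‖ₑ} ^ (1 / 2 : ℝ)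

/-- `G` is the distributional gradient of `f`. -/
def IsWeakGradient (f : Plane → ℝ) (G : Plane → Plane) : Prop :=
  LocallyIntegrable f ∧ LocallyIntegrable G ∧
    ∀ ζ : Plane → ℝ, ContDiff ℝ ∞ ζ → HasCompactSupport ζ → ∀ e : Plane,
      ∫ x, f x * fderiv ℝ ζ x e = - ∫ x, inner ℝ (G x) e * ζ x

/-- The norm `‖f‖_{L²} + ‖∇f‖_{L^{2,∞}}` of the space `W`. It is infinite if the distributional
gradient of `f` is not a function; otherwise the infimum runs over the representatives of the
(almost everywhere unique) gradient, on which the norm does not depend. -/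
def wNorm (f : Plane → ℝ) : ℝ≥0∞ :=
  eLpNorm f 2 volume + ⨅ (G : Plane → Plane) (_ : IsWeakGradient f G), weakL2Norm G

/-- The `L²` norm of a tempered distribution, infinite if it is not an `L²` function. -/
def distL2Norm (T : 𝓢'(Plane, ℂ)) : ℝ≥0∞ :=
  ⨅ (g : Lp ℂ 2 (volume : Measure Plane)) (_ : (g : 𝓢'(Plane, ℂ)) = T), ‖g‖ₑ

/-- The norm of `H^s`: the `L²` norm of the Bessel potential of order `s`. -/
def distSobolevNorm (s : ℝ) (T : 𝓢'(Plane, ℂ)) : ℝ≥0∞ :=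
  distL2Norm (TemperedDistribution.besselPotential Plane ℂ s T)

/-- A Littlewood–Paley cutoff: `χ = 1` for `|ξ| ≤ 1` and `χ = 0` for `|ξ| > 2`. -/
def IsLPCutoff (χ : 𝓢(Plane, ℂ)) : Prop :=
  (∀ ξ, ‖ξ‖ ≤ 1 → χ ξ = 1) ∧ (∀ ξ, 2 < ‖ξ‖ → χ ξ = 0)

/-- The low frequency localization `Δ_{-1}`, the Fourier multiplier with symbol `χ`. Mathlib's
Fourier transform has the kernel `exp (-2πi x·ξ)`, whence the factor `2π`. -/
def lpLow (χ : 𝓢(Plane, ℂ)) (T : 𝓢'(Plane, ℂ)) : 𝓢'(Plane, ℂ) :=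
  TemperedDistribution.fourierMultiplierCLM ℂ (fun ξ => χ ((2 * Real.pi) • ξ)) T

/-- The dyadic localization `Δ_j`, `j ≥ 0`, the Fourier multiplier with symbol `ψ(2^{-j} ξ)`,
where `ψ(ξ) = χ(ξ/2) - χ(ξ)`. -/
def lpBlock (χ : 𝓢(Plane, ℂ)) (j : ℕ) (T : 𝓢'(Plane, ℂ)) : 𝓢'(Plane, ℂ) :=
  TemperedDistribution.fourierMultiplierCLM ℂ
    (fun ξ => χ (((2 : ℝ) ^ (-(j : ℝ) - 1) * (2 * Real.pi)) • ξ)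
      - χ (((2 : ℝ) ^ (-(j : ℝ)) * (2 * Real.pi)) • ξ)) T

/-- The norm of the inhomogeneous Besov space `B^s_{2,∞}`. -/
def distBesovNorm (χ : 𝓢(Plane, ℂ)) (s : ℝ) (T : 𝓢'(Plane, ℂ)) : ℝ≥0∞ :=
  distL2Norm (lpLow χ T) +
    ⨆ j : ℕ, ENNReal.ofReal ((2 : ℝ) ^ ((j : ℝ) * s)) * distL2Norm (lpBlock χ j T)

/-- `T` is the tempered distribution given by the real function `f`. -/
def Represents (T : 𝓢'(Plane, ℂ)) (f : Plane → ℝ) : Prop :=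
  ∀ g : 𝓢(Plane, ℂ), Integrable (fun x => g x * (f x : ℂ)) ∧ T g = ∫ x, g x * (f x : ℂ)

/-- The `H^s` norm of a function, infinite if the function is not a tempered distribution. -/
def sobolevNorm (s : ℝ) (f : Plane → ℝ) : ℝ≥0∞ :=
  ⨅ (T : 𝓢'(Plane, ℂ)) (_ : Represents T f), distSobolevNorm s T

/-- The `B^s_{2,∞}` norm of a function, infinite if it is not a tempered distribution. -/
def besovNorm (χ : 𝓢(Plane, ℂ)) (s : ℝ) (f : Plane → ℝ) : ℝ≥0∞ :=
  ⨅ (T : 𝓢'(Plane, ℂ)) (_ : Represents T f), distBesovNorm χ s T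

/-! ### The equation `∂_t² u - Δ u + F'(u) = 0` and its weak solutions -/

/-- The nonlinearity `F'(u) = u (1 + u²)^{(q-2)/2} exp (4π ((1 + u²)^{q/2} - 1))`. -/
def nonlin (q u : ℝ) : ℝ :=
  u * (1 + u ^ 2) ^ ((q - 2) / 2) * Real.exp (4 * Real.pi * ((1 + u ^ 2) ^ (q / 2) - 1))

/-- The even primitive `F` of the nonlinearity with `F(0) = 0`. -/
def potential (q u : ℝ) : ℝ :=
  (Real.exp (4 * Real.pi * ((1 + u ^ 2) ^ (q / 2) - 1)) - 1) / (4 * Real.pi * q)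

/-- The energy `‖∇φ‖² + ‖ψ‖² + ∫ 2 F(φ)` of the data `(φ, ψ)`. It is infinite if the distributional
gradient of `φ` is not a function; otherwise it does not depend on the representative of it. -/
def energy (q : ℝ) (φ ψ : Plane → ℝ) : ℝ≥0∞ :=
  (⨅ (G : Plane → Plane) (_ : IsWeakGradient φ G), ∫⁻ x, ‖G x‖ₑ ^ 2) + (∫⁻ x, ‖ψ x‖ₑ ^ 2)
    + ∫⁻ x, ENNReal.ofReal (2 * potential q (φ x))

/-- Data of finite energy. -/
def HasFiniteEnergy (q : ℝ) (φ ψ : Plane → ℝ) : Prop :=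
  MemLp φ 2 volume ∧ MemLp ψ 2 volume ∧ energy q φ ψ < ⊤

/-- The test functions on the open slab `(0,T) × ℝ²`. -/
def IsTestFunction (T : ℝ) (η : ℝ × Plane → ℝ) : Prop :=
  ContDiff ℝ ∞ η ∧ HasCompactSupport η ∧ tsupport η ⊆ Ioo 0 T ×ˢ univ

/-- The pair `(u, v)` with `v = ∂_t u` is a (finite energy) weak solution on `[0,T)` of
`∂_t² u - Δ u + F'(u) = 0` with initial data `(φ, ψ)`: `u` and `v` are weakly continuous in time
with values in `L²`, `(u, v)` has the data `(φ, ψ)` at time `0`, `v = ∂_t u` and the equation hold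
in the sense of distributions, and the energy never exceeds its initial, finite, value. -/
structure IsWeakSolution (q T : ℝ) (φ ψ : Plane → ℝ) (u v : ℝ → Plane → ℝ) : Prop where
  finite_energy : HasFiniteEnergy q φ ψ
  measurable_u : AEStronglyMeasurable (fun z : ℝ × Plane => u z.1 z.2)
    (volume.restrict (Ioo 0 T ×ˢ univ))
  measurable_v : AEStronglyMeasurable (fun z : ℝ × Plane => v z.1 z.2)
    (volume.restrict (Ioo 0 T ×ˢ univ))
  memLp_u : ∀ t ∈ Ico 0 T, MemLp (u t) 2 volume
  memLp_v : ∀ t ∈ Ico 0 T, MemLp (v t) 2 volume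
  continuous_u : ∀ g : Plane → ℝ, MemLp g 2 volume →
    ContinuousOn (fun t => ∫ x, u t x * g x) (Ico 0 T)
  continuous_v : ∀ g : Plane → ℝ, MemLp g 2 volume →
    ContinuousOn (fun t => ∫ x, v t x * g x) (Ico 0 T)
  initial_u : u 0 =ᵐ[volume] φ
  initial_v : v 0 =ᵐ[volume] ψ
  time_deriv : ∀ η : ℝ × Plane → ℝ, IsTestFunction T η →
    ∫ z in Ioo 0 T ×ˢ univ, u z.1 z.2 * deriv (fun s => η (s, z.2)) z.1
      = - ∫ z in Ioo 0 T ×ˢ univ, v z.1 z.2 * η z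
  nonlin_integrable : LocallyIntegrableOn (fun z : ℝ × Plane => nonlin q (u z.1 z.2))
    (Ioo 0 T ×ˢ univ)
  equation : ∀ η : ℝ × Plane → ℝ, IsTestFunction T η →
    ∫ z in Ioo 0 T ×ˢ univ,
      (u z.1 z.2 * (iteratedDeriv 2 (fun s => η (s, z.2)) z.1
          - Laplacian.laplacian (fun y => η (z.1, y)) z.2)
        + nonlin q (u z.1 z.2) * η z) = 0
  energy_le : ∀ t ∈ Ico 0 T, energy q (u t) (v t) ≤ energy q φ ψ

/-! ### The two forms of ill-posedness at `0`

`N₀` and `N₁` are the norms of the two components of the space of data. -/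

/-- There are data `(φ_k, 0)` of finite energy with `N₀ (φ_k) → 0` and times `t_k → 0` such that
`N₁ (∂_t u_k (t_k)) → ∞` for all weak solutions `u_k` with data `(φ_k, 0)` that live beyond the
time `t_k` (the solution `u_k` lives on `[0, T_k)`). -/
def NormInflation (q : ℝ) (N₀ N₁ : (Plane → ℝ) → ℝ≥0∞) : Prop :=
  ∃ (φ : ℕ → Plane → ℝ) (t : ℕ → ℝ),
    (∀ k, HasFiniteEnergy q (φ k) 0) ∧ (∀ k, N₀ (φ k) < ⊤) ∧ (∀ k, t k ∈ Ioo (0 : ℝ) 1) ∧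
    Tendsto (fun k => N₀ (φ k)) atTop (𝓝 0) ∧ Tendsto t atTop (𝓝 0) ∧
    ∀ (T : ℕ → ℝ) (u v : ℕ → ℝ → Plane → ℝ),
      (∀ᶠ k in atTop, t k < T k ∧ IsWeakSolution q (T k) (φ k) 0 (u k) (v k)) →
      Tendsto (fun k => N₁ (v k (t k))) atTop (𝓝 ⊤)

/-- No flow `(φ, ψ) ↦ (u, ∂_t u)` that consists of weak solutions on a time interval `[0, T)` and is
defined for all finite energy data near `0` is continuous at `0`, the data being measured
in `N₀ × N₁` and the solutions in the supremum over `[0, T)` of `N₀ × N₁`. -/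
def FlowDiscontinuousAtZero (q : ℝ) (N₀ N₁ : (Plane → ℝ) → ℝ≥0∞) : Prop :=
  ∀ (T : ℝ) (r : ℝ≥0∞) (U V : (Plane → ℝ) → (Plane → ℝ) → ℝ → Plane → ℝ), 0 < T → 0 < r →
    (∀ φ ψ, HasFiniteEnergy q φ ψ → N₀ φ + N₁ ψ < r →
      IsWeakSolution q T φ ψ (U φ ψ) (V φ ψ)) →
    ¬ ∀ ε : ℝ≥0∞, 0 < ε → ∃ δ : ℝ≥0∞, 0 < δ ∧ ∀ φ ψ, HasFiniteEnergy q φ ψ → N₀ φ + N₁ ψ < δ →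
      ∀ t ∈ Ico 0 T, N₀ (U φ ψ t - U 0 0 t) + N₁ (V φ ψ t - V 0 0 t) < ε

end

end ExpWave

namespace ExpWave

open MeasureTheory Set Filter Topology
open scoped ENNReal NNReal SchwartzMap ContDiff

noncomputable section

/-! The data concentrate logarithmically at the origin. `data A M` is `A/√M` times the sum of bumps
at the scales `2^(-n)`, `n < M`. It is constant, equal to `a = A√M`, on the support of the next bump
`bumpAt M`, while its gradient is `O(1/(√M |x|))`; in each of the three norms `X₀` it is `O(1/√M)`
as `M → ∞`, for every fixed amplitude `A`. The energy is not small at all: with `p = exp(2πA²)` it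
is at most `E = B (p²/4)^M`.

On the disc of radius `2^(-M)` the nonlinearity at the initial value `a` has size `a p^(2M)`. Since
`∂_t u` has `L²` norm at most `√E`, the solution deviates from its data by at most `t√E` in `L²`,
and this stays below the `L²` norm of `1/a` over the disc up to times `t ~ 1/(a p^M)`. Over a
distance `1/a` the nonlinearity changes only by a bounded factor. Pairing the equation with `bumpAt
M` therefore gives `-∫ ∂_t u(t) bumpAt M ≳ t a p^(2M) 4^(-M) ~ (p/4)^M`, which is
`exists_velocity_growth`. Each norm `X₁` controls this pairing up to a factor `C Λ^M`
(`ControlsBumps`), and taking `A` so large that `p ≥ 8Λ` forces the `X₁` norm to be at least a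
constant times `2^M`.

The obstacle is that only weak solutions are given and that the nonlinearity may be hugely negative
where `u` is very negative, on a set about which the energy says too little. The equation is
therefore multiplied by `step u`, which vanishes for `u ≤ -1` and equals one for `u ≥ 0`. The
gradient term produced by this has a favourable sign and is dropped, the kinetic term is bounded by
the energy, and the nonlinearity is now bounded from below. This is proved for mollified solutions
and passes to the limit in `IsWeakSolution.integral_nonlin_step_le`. A concave parabola below
`nonlin 2 y * step y` (`nonlin_mul_step_ge`) turns the closeness of `u` to `a` in mean square into
the required lower bound (`IsWeakSolution.le_neg_integral_v`).

Discontinuity of the flow follows from inflation, because a weak solution with zero data has zero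
energy and hence zero velocity. -/

/-! ### Cutoffs in time, and pointwise consequences of distributional inequalities -/

/-- A smooth step in time, rising from `0` to `1` on `[s, s + κ]`. -/
def timeStep (s κ : ℝ) (τ : ℝ) : ℝ := Real.smoothTransition ((τ - s) / κ)

lemma timeStep_contDiff (s κ : ℝ) : ContDiff ℝ ∞ (timeStep s κ) := by
  unfold timeStep
  exact Real.smoothTransition.contDiff.comp ((contDiff_id.sub contDiff_const).div_const κ)

lemma timeStep_of_le {s κ τ : ℝ} (hκ : 0 < κ) (h : τ ≤ s) : timeStep s κ τ = 0 :=
  Real.smoothTransition.zero_of_nonpos (div_nonpos_of_nonpos_of_nonneg (by linarith) hκ.le)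

lemma timeStep_of_ge {s κ τ : ℝ} (hκ : 0 < κ) (h : s + κ ≤ τ) : timeStep s κ τ = 1 :=
  Real.smoothTransition.one_of_one_le ((one_le_div hκ).2 (by linarith))

lemma timeStep_monotone {s κ : ℝ} (hκ : 0 < κ) : Monotone (timeStep s κ) := by
  intro a b h
  apply Real.smoothTransition.monotone
  gcongr

lemma timeStep_deriv_nonneg {s κ : ℝ} (hκ : 0 < κ) (τ : ℝ) : 0 ≤ deriv (timeStep s κ) τ :=
  (timeStep_monotone hκ).deriv_nonneg

lemma timeStep_deriv_of_notMem {s κ τ : ℝ} (hκ : 0 < κ) (h : τ ∉ Icc s (s + κ)) :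
    deriv (timeStep s κ) τ = 0 := by
  rw [mem_Icc, not_and_or, not_le, not_le] at h
  rcases h with h | h
  · have : timeStep s κ =ᶠ[𝓝 τ] fun _ => 0 := by
      filter_upwards [Iio_mem_nhds h] with y hy using timeStep_of_le hκ (le_of_lt hy)
    rw [this.deriv_eq]; simp
  · have : timeStep s κ =ᶠ[𝓝 τ] fun _ => 1 := by
      filter_upwards [Ioi_mem_nhds h] with y hy using timeStep_of_ge hκ (le_of_lt hy)
    rw [this.deriv_eq]; simp

lemma timeStep_deriv_continuous (s κ : ℝ) : Continuous (deriv (timeStep s κ)) :=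
  (timeStep_contDiff s κ).continuous_deriv (by simp)

lemma timeStep_integral_deriv {s κ : ℝ} (hκ : 0 < κ) :
    ∫ τ, deriv (timeStep s κ) τ = 1 := by
  have h1 : ∫ τ, deriv (timeStep s κ) τ = ∫ τ in Ioc s (s + κ), deriv (timeStep s κ) τ := by
    rw [← integral_Icc_eq_integral_Ioc]
    exact (setIntegral_eq_integral_of_forall_compl_eq_zero
      fun τ h => timeStep_deriv_of_notMem hκ h).symm
  rw [h1, ← intervalIntegral.integral_of_le (by linarith),
    intervalIntegral.integral_deriv_eq_sub
      (fun x _ => ((timeStep_contDiff s κ).differentiable (by simp)).differentiableAt)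
      ((timeStep_deriv_continuous s κ).intervalIntegrable _ _),
    timeStep_of_ge hκ le_rfl, timeStep_of_le hκ le_rfl, sub_zero]

lemma integrable_mul_timeStep_deriv {s κ : ℝ} (hκ : 0 < κ) {W : ℝ → ℝ}
    (hW : ContinuousOn W (Icc s (s + κ))) :
    Integrable fun τ => W τ * deriv (timeStep s κ) τ := by
  have h : IntegrableOn (fun τ => W τ * deriv (timeStep s κ) τ) (Icc s (s + κ)) :=
    (hW.mul (timeStep_deriv_continuous s κ).continuousOn).integrableOn_compact isCompact_Icc
  rwa [integrableOn_iff_integrable_of_support_subset] at h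
  intro τ hτ
  by_contra hn
  exact hτ (by simp [timeStep_deriv_of_notMem hκ hn])

lemma timeStep_average {s κ ε : ℝ} (hκ : 0 < κ) {W : ℝ → ℝ}
    (hW : ContinuousOn W (Icc s (s + κ))) (h : ∀ τ ∈ Icc s (s + κ), |W τ - W s| ≤ ε) :
    |(∫ τ, W τ * deriv (timeStep s κ) τ) - W s| ≤ ε := by
  have hi := integrable_mul_timeStep_deriv hκ hW
  have hc := integrable_mul_timeStep_deriv (s := s) (W := fun _ => W s) hκ continuousOn_const
  have he := integrable_mul_timeStep_deriv (s := s) (W := fun _ => ε) hκ continuousOn_const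
  have h1 : ∀ c : ℝ, ∫ τ, c * deriv (timeStep s κ) τ = c := by
    intro c
    rw [integral_const_mul, timeStep_integral_deriv hκ, mul_one]
  have key : ∀ τ, |W τ * deriv (timeStep s κ) τ - W s * deriv (timeStep s κ) τ|
      ≤ ε * deriv (timeStep s κ) τ := by
    intro τ
    rw [← sub_mul, abs_mul, abs_of_nonneg (timeStep_deriv_nonneg hκ τ)]
    by_cases hτ : τ ∈ Icc s (s + κ)
    · exact mul_le_mul_of_nonneg_right (h τ hτ) (timeStep_deriv_nonneg hκ τ)
    · simp [timeStep_deriv_of_notMem hκ hτ]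
  calc |(∫ τ, W τ * deriv (timeStep s κ) τ) - W s|
      = |∫ τ, (W τ * deriv (timeStep s κ) τ - W s * deriv (timeStep s κ) τ)| := by
        rw [integral_sub hi hc, h1]
    _ ≤ ∫ τ, |W τ * deriv (timeStep s κ) τ - W s * deriv (timeStep s κ) τ| :=
        abs_integral_le_integral_abs
    _ ≤ ∫ τ, ε * deriv (timeStep s κ) τ := integral_mono (hi.sub hc).abs he key
    _ = ε := h1 ε

/-- Smooth nonnegative cutoffs in time, with values in `[0,1]`. -/
structure IsTimeCutoff (T : ℝ) (θ : ℝ → ℝ) : Prop where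
  contDiff : ContDiff ℝ ∞ θ
  hasCompactSupport : HasCompactSupport θ
  tsupport_subset : tsupport θ ⊆ Ioo 0 T
  nonneg : ∀ τ, 0 ≤ θ τ
  le_one : ∀ τ, θ τ ≤ 1

lemma timeStep_sub_isTimeCutoff {T s₁ s₂ κ : ℝ} (hκ : 0 < κ) (h1 : 0 < s₁) (h12 : s₁ ≤ s₂)
    (h2 : s₂ + κ < T) : IsTimeCutoff T fun τ => timeStep s₁ κ τ - timeStep s₂ κ τ := by
  have hs : Function.support (fun τ => timeStep s₁ κ τ - timeStep s₂ κ τ)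
      ⊆ Icc s₁ (s₂ + κ) := by
    intro τ hτ
    by_contra hn
    rw [mem_Icc, not_and_or, not_le, not_le] at hn
    apply hτ
    rcases hn with hn | hn
    · simp [timeStep_of_le hκ hn.le, timeStep_of_le hκ (hn.le.trans h12)]
    · simp [timeStep_of_ge hκ hn.le,
        timeStep_of_ge hκ (show s₁ + κ ≤ τ by linarith)]
  have hts := closure_minimal hs isClosed_Icc
  refine ⟨(timeStep_contDiff _ _).sub (timeStep_contDiff _ _),
    HasCompactSupport.of_support_subset_isCompact isCompact_Icc hs,
    hts.trans fun τ hτ => ⟨h1.trans_le hτ.1, hτ.2.trans_lt h2⟩, ?_, ?_⟩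
  · intro τ
    rw [sub_nonneg]
    apply Real.smoothTransition.monotone
    gcongr
  · intro τ
    have := Real.smoothTransition.le_one ((τ - s₁) / κ)
    have := Real.smoothTransition.nonneg ((τ - s₂) / κ)
    simp only [timeStep]
    linarith

/-- An inequality for the distributional derivative of a continuous function, up to an error that
is controlled by the total variation of the cutoff, holds pointwise. -/
theorem le_sub_of_forall_timeCutoff {T F₀ B : ℝ} {V : ℝ → ℝ} (hV : ContinuousOn V (Ico 0 T))
    (hB : 0 ≤ B)
    (h : ∀ θ : ℝ → ℝ, IsTimeCutoff T θ →
      F₀ * ∫ τ, θ τ ≤ (∫ τ, V τ * deriv θ τ) + B * ∫ τ, |deriv θ τ|)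
    {s : ℝ} (hs : s ∈ Ioo 0 T) : F₀ * s - 2 * B ≤ V 0 - V s := by
  -- In terms of `W` the hypothesis reads `∫ W θ' ≥ -B ∫ |θ'|`. Smoothed indicators of `[s₁, s]`
  -- have `∫ |θ'| ≤ 2`, which yields `W s - 2B ≤ W s₁`. Test functions do not reach time zero, so
  -- the value there is recovered by continuity as `s₁ → 0`.
  set W : ℝ → ℝ := fun τ => V τ + F₀ * τ with hWdef
  have hW : ContinuousOn W (Ico 0 T) := hV.add (by fun_prop)
  have main : ∀ s₁ ∈ Ioo 0 s, W s - 2 * B ≤ W s₁ := by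
    intro s₁ hs₁
    apply le_of_forall_pos_le_add
    intro ε hε
    have hcont : ∀ r ∈ Ico 0 T, ∀ᶠ κ in 𝓝[>] (0 : ℝ), r + κ < T ∧
        ∀ τ ∈ Icc r (r + κ), |W τ - W r| ≤ ε / 2 := by
      intro r hr
      have h1 := Metric.continuousWithinAt_iff.1 (hW r hr) (ε / 2) (by positivity)
      obtain ⟨δ, hδ, h1⟩ := h1
      have hm : 0 < min δ (T - r) := lt_min hδ (by linarith [hr.2])
      filter_upwards [Ioo_mem_nhdsGT hm] with κ hκ
      have hκ1 := hκ.2.trans_le (min_le_left _ _)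
      have hκ2 := hκ.2.trans_le (min_le_right _ _)
      refine ⟨by linarith, fun τ hτ => ?_⟩
      have := h1 (x := τ) ⟨hr.1.trans hτ.1, by linarith [hτ.2]⟩ (by
        rw [Real.dist_eq, abs_of_nonneg (by linarith [hτ.1])]; linarith [hτ.2])
      rw [Real.dist_eq] at this
      exact this.le
    obtain ⟨κ, ⟨⟨hκ1, hκ2⟩, hκ3, hκ4⟩, hκ : 0 < κ⟩ :=
      (((hcont s₁ ⟨hs₁.1.le, hs₁.2.trans hs.2⟩).and (hcont s ⟨hs.1.le, hs.2⟩)).and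
        self_mem_nhdsWithin).exists
    have hcut := timeStep_sub_isTimeCutoff hκ hs₁.1 hs₁.2.le hκ3
    set θ := fun τ => timeStep s₁ κ τ - timeStep s κ τ with hθ
    have hsub1 : Icc s₁ (s₁ + κ) ⊆ Ico 0 T := fun τ hτ =>
      ⟨hs₁.1.le.trans hτ.1, hτ.2.trans_lt hκ1⟩
    have hsub2 : Icc s (s + κ) ⊆ Ico 0 T := fun τ hτ =>
      ⟨hs.1.le.trans hτ.1, hτ.2.trans_lt hκ3⟩
    have hd : ∀ τ, deriv θ τ = deriv (timeStep s₁ κ) τ - deriv (timeStep s κ) τ := fun τ =>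
      deriv_sub ((timeStep_contDiff _ _).differentiable (by simp)).differentiableAt
        ((timeStep_contDiff _ _).differentiable (by simp)).differentiableAt
    have hsplit : ∀ Z : ℝ → ℝ, ContinuousOn Z (Ico 0 T) → ∫ τ, Z τ * deriv θ τ =
        (∫ τ, Z τ * deriv (timeStep s₁ κ) τ) - ∫ τ, Z τ * deriv (timeStep s κ) τ := by
      intro Z hZ
      simp_rw [hd, mul_sub]
      exact integral_sub (integrable_mul_timeStep_deriv hκ (hZ.mono hsub1))
        (integrable_mul_timeStep_deriv hκ (hZ.mono hsub2))
    have hVi : Integrable fun τ => V τ * deriv θ τ := by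
      simp_rw [hd, mul_sub]
      exact (integrable_mul_timeStep_deriv hκ (hV.mono hsub1)).sub
        (integrable_mul_timeStep_deriv hκ (hV.mono hsub2))
    have hidi : Integrable fun τ => τ * deriv θ τ := by
      simp_rw [hd, mul_sub]
      exact (integrable_mul_timeStep_deriv (W := fun τ => τ) hκ continuousOn_id).sub
        (integrable_mul_timeStep_deriv (W := fun τ => τ) hκ continuousOn_id)
    have hθ0 : ∫ τ, θ τ = - ∫ τ, τ * deriv θ τ := by
      have hθi : Integrable θ := hcut.contDiff.continuous.integrable_of_hasCompactSupport
        hcut.hasCompactSupport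
      have := integral_mul_deriv_eq_deriv_mul_of_integrable (u := fun τ : ℝ => τ) (v := θ)
        (u' := fun _ => 1) (v' := deriv θ) (fun x _ => hasDerivAt_id x)
        (fun x _ => (hcut.contDiff.differentiable (by simp)).differentiableAt.hasDerivAt)
        (by simpa [Pi.mul_def] using hidi) (by simpa [Pi.mul_def] using hθi)
        ((continuous_id.mul hcut.contDiff.continuous).integrable_of_hasCompactSupport
          hcut.hasCompactSupport.mul_left)
      simp only [one_mul] at this
      rw [this, neg_neg]
    have habs : ∫ τ, |deriv θ τ| ≤ 2 := by
      have h1 := integrable_mul_timeStep_deriv (s := s₁) (W := fun _ => 1) hκ continuousOn_const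
      have h2 := integrable_mul_timeStep_deriv (s := s) (W := fun _ => 1) hκ continuousOn_const
      simp only [one_mul] at h1 h2
      have : ∫ τ, |deriv θ τ| ≤ ∫ τ, (deriv (timeStep s₁ κ) τ + deriv (timeStep s κ) τ) := by
        apply integral_mono_of_nonneg (Eventually.of_forall fun τ => abs_nonneg _) (h1.add h2)
        refine Eventually.of_forall fun τ => ?_
        simp only [hd]
        have := timeStep_deriv_nonneg (s := s₁) hκ τ
        have := timeStep_deriv_nonneg (s := s) hκ τ
        rw [abs_le, Pi.add_apply]
        constructor <;> linarith
      rw [integral_add h1 h2, timeStep_integral_deriv hκ, timeStep_integral_deriv hκ] at this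
      linarith
    have h0 := h θ hcut
    have hWθ : ∫ τ, W τ * deriv θ τ = (∫ τ, V τ * deriv θ τ) - F₀ * ∫ τ, θ τ := by
      rw [hθ0, mul_neg, sub_neg_eq_add, ← integral_const_mul, ← integral_add hVi
        (hidi.const_mul F₀)]
      congr 1; ext τ; simp only [hWdef]; ring
    rw [hsplit W hW] at hWθ
    have e1 := abs_le.1 (timeStep_average hκ (hW.mono hsub1) hκ2)
    have e2 := abs_le.1 (timeStep_average hκ (hW.mono hsub2) hκ4)
    have : B * ∫ τ, |deriv θ τ| ≤ B * 2 := mul_le_mul_of_nonneg_left habs hB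
    linarith [e1.1, e1.2, e2.1, e2.2]
  have hlim : Tendsto W (𝓝[>] 0) (𝓝 (W 0)) := by
    have := hW 0 ⟨le_rfl, hs.1.trans hs.2⟩
    refine this.mono_left ?_
    rw [nhdsWithin_le_iff]
    filter_upwards [Ioo_mem_nhdsGT (hs.1.trans hs.2)] with x hx using ⟨hx.1.le, hx.2⟩
  have := ge_of_tendsto hlim (by
    filter_upwards [Ioo_mem_nhdsGT hs.1] with x hx using main x hx)
  simp only [hWdef, mul_zero, add_zero] at this
  linarith

/-! ### Real valued `L²` norms and duality with test functions -/

section LTwo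

variable {α : Type*} [MeasurableSpace α] {μ : Measure α}

/-- The `L²` norm as a real number. -/
def l2 (μ : Measure α) (f : α → ℝ) : ℝ := (eLpNorm f 2 μ).toReal

lemma l2_nonneg (f : α → ℝ) : 0 ≤ l2 μ f := ENNReal.toReal_nonneg

lemma abs_integral_mul_le_l2 {f g : α → ℝ} (hf : MemLp f 2 μ) (hg : MemLp g 2 μ) :
    |∫ x, f x * g x ∂μ| ≤ l2 μ f * l2 μ g := by
  have h1 : inner ℝ (hg.toLp g) (hf.toLp f) = ∫ x, f x * g x ∂μ := by
    rw [L2.inner_def]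
    apply integral_congr_ae
    filter_upwards [hf.coeFn_toLp, hg.coeFn_toLp] with x h1 h2
    rw [h1, h2]; simp
  have := abs_real_inner_le_norm (hg.toLp g) (hf.toLp f)
  rw [h1, Lp.norm_toLp, Lp.norm_toLp] at this
  unfold l2
  linarith

lemma l2_sq {f : α → ℝ} (hf : MemLp f 2 μ) : l2 μ f ^ 2 = ∫ x, f x ^ 2 ∂μ := by
  have h1 : inner ℝ (hf.toLp f) (hf.toLp f) = ∫ x, f x ^ 2 ∂μ := by
    rw [L2.inner_def]
    apply integral_congr_ae
    filter_upwards [hf.coeFn_toLp] with x h1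
    rw [h1]; simp [sq]
  rw [← h1, real_inner_self_eq_norm_sq, Lp.norm_toLp]
  rfl

lemma l2_le_iff {f : α → ℝ} (hf : MemLp f 2 μ) {K : ℝ} (hK : 0 ≤ K) :
    l2 μ f ≤ K ↔ ∫ x, f x ^ 2 ∂μ ≤ K ^ 2 := by
  rw [← l2_sq hf]
  exact (sq_le_sq₀ (l2_nonneg f) hK).symm

lemma l2_le_of_lintegral_le {f : α → ℝ} (hf : MemLp f 2 μ) {E : ℝ} (hE : 0 ≤ E)
    (h : ∫⁻ x, ‖f x‖ₑ ^ 2 ∂μ ≤ ENNReal.ofReal E) : l2 μ f ≤ √E := by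
  rw [l2_le_iff hf (Real.sqrt_nonneg _), Real.sq_sqrt hE,
    integral_eq_lintegral_of_nonneg_ae (Eventually.of_forall fun x => sq_nonneg _)
      (hf.1.pow 2)]
  apply ENNReal.toReal_le_of_le_ofReal hE
  refine le_trans (le_of_eq ?_) h
  congr 1; ext x
  rw [← enorm_pow, Real.enorm_eq_ofReal (sq_nonneg _)]

lemma l2_sub_le {f g : α → ℝ} (hf : MemLp f 2 μ) (hg : MemLp g 2 μ) :
    l2 μ g ≤ l2 μ f + l2 μ (f - g) := by
  have h : eLpNorm g 2 μ ≤ eLpNorm f 2 μ + eLpNorm (f - g) 2 μ := by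
    have := eLpNorm_sub_le hf.1 (hf.sub hg).1 (p := 2) (by norm_num)
    simpa using this
  unfold l2
  rw [← ENNReal.toReal_add hf.2.ne (hf.sub hg).2.ne]
  exact ENNReal.toReal_mono (ENNReal.add_ne_top.2 ⟨hf.2.ne, (hf.sub hg).2.ne⟩) h

end LTwo

/-- The `L²` norm is determined by testing with smooth compactly supported functions. -/
lemma l2_le_of_forall_test {w : Plane → ℝ} (hw : MemLp w 2 volume) {K : ℝ} (hK : 0 ≤ K)
    (h : ∀ g : Plane → ℝ, ContDiff ℝ ∞ g → HasCompactSupport g →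
      |∫ x, w x * g x| ≤ K * l2 volume g) : l2 volume w ≤ K := by
  -- With a test function `g` within `ε` of `w`, split `‖w‖² = ⟨w, g⟩ + ⟨w, w - g⟩`. As `ε → 0` this
  -- leaves `‖w‖² ≤ K ‖w‖`.
  have key : ∀ ε > 0, l2 volume w ^ 2 ≤ l2 volume w * ε + K * (l2 volume w + ε) := by
    intro ε hε
    obtain ⟨g, hg1, hg2, hg3⟩ := hw.exist_eLpNorm_sub_le (by norm_num) (by norm_num) hε
    have hgm : MemLp g 2 volume := hg2.continuous.memLp_of_hasCompactSupport hg1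
    have h1 := h g hg2 hg1
    have hd : l2 volume (w - g) ≤ ε := ENNReal.toReal_le_of_le_ofReal hε.le hg3
    have h2 := abs_integral_mul_le_l2 hw (hw.sub hgm)
    have h3 : ∫ x, w x ^ 2 = (∫ x, w x * g x) + ∫ x, w x * (w - g) x := by
      have := integral_add (hw.integrable_mul hgm) (hw.integrable_mul (hw.sub hgm))
      simp only [Pi.mul_apply] at this
      rw [← this]
      congr 1; ext x; simp only [Pi.sub_apply]; ring
    have h4 := l2_sub_le hw hgm
    rw [l2_sq hw, h3]
    have h5 := mul_le_mul_of_nonneg_left hd (l2_nonneg (μ := volume) w)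
    have h6 : K * l2 volume g ≤ K * (l2 volume w + ε) :=
      mul_le_mul_of_nonneg_left (by linarith) hK
    linarith [le_abs_self (∫ x, w x * g x), le_abs_self (∫ x, w x * (w - g) x)]
  have lim : l2 volume w ^ 2 ≤ l2 volume w * 0 + K * (l2 volume w + 0) := by
    have ht : Tendsto (fun ε : ℝ => l2 volume w * ε + K * (l2 volume w + ε)) (𝓝[>] 0)
        (𝓝 (l2 volume w * 0 + K * (l2 volume w + 0))) := by
      apply Tendsto.mono_left _ nhdsWithin_le_nhds
      apply Continuous.tendsto
      fun_prop
    exact ge_of_tendsto ht (by filter_upwards [self_mem_nhdsWithin] with ε hε using key ε hε)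
  by_contra hc
  push Not at hc
  nlinarith [l2_nonneg (μ := volume) w]

/-! ### The exponential nonlinearity and what the energy controls -/

lemma nonlin_two (y : ℝ) : nonlin 2 y = y * Real.exp (4 * Real.pi * y ^ 2) := by
  simp [nonlin]

lemma potential_two (y : ℝ) :
    2 * potential 2 y = (Real.exp (4 * Real.pi * y ^ 2) - 1) / (4 * Real.pi) := by
  simp only [potential, div_self (two_ne_zero' ℝ), Real.rpow_one, add_sub_cancel_left]
  field_simp

/-- This is `e^x - 1 ≥ x`. It makes the energy control the `L²` norm of `u` itself and not only of
its derivatives. -/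
lemma sq_le_potential (y : ℝ) : y ^ 2 ≤ 2 * potential 2 y := by
  rw [potential_two, le_div_iff₀ (by positivity)]
  linarith [Real.add_one_le_exp (4 * Real.pi * y ^ 2)]

lemma lintegral_sq_le_energy (φ ψ : Plane → ℝ) : ∫⁻ x, ‖φ x‖ₑ ^ 2 ≤ energy 2 φ ψ := by
  unfold energy
  refine le_trans (lintegral_mono fun x => ?_) le_add_self
  rw [← enorm_pow, Real.enorm_eq_ofReal (sq_nonneg _)]
  exact ENNReal.ofReal_le_ofReal (sq_le_potential _)

lemma lintegral_sq_le_energy' (φ ψ : Plane → ℝ) : ∫⁻ x, ‖ψ x‖ₑ ^ 2 ≤ energy 2 φ ψ := by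
  unfold energy
  exact le_add_right le_add_self

/-! ### The space-time slab and elementary bounds for weak solutions -/

/-- The open slab. -/
abbrev slab (T : ℝ) : Measure (ℝ × Plane) := volume.restrict (Ioo 0 T ×ˢ univ)

lemma slab_eq_prod (T : ℝ) :
    slab T = (volume.restrict (Ioo 0 T)).prod (volume : Measure Plane) := by
  rw [slab, Measure.volume_eq_prod, ← Measure.prod_restrict, Measure.restrict_univ]

lemma memLp_slab {T E : ℝ} {f : ℝ → Plane → ℝ}
    (hf : AEStronglyMeasurable (fun z : ℝ × Plane => f z.1 z.2) (slab T))
    (h : ∀ t ∈ Ioo 0 T, ∫⁻ x, ‖f t x‖ₑ ^ 2 ≤ ENNReal.ofReal E) :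
    MemLp (fun z : ℝ × Plane => f z.1 z.2) 2 (slab T) := by
  refine ⟨hf, ?_⟩
  rw [eLpNorm_lt_top_iff_lintegral_rpow_enorm_lt_top (by norm_num) (by norm_num)]
  rw [slab_eq_prod] at hf ⊢
  rw [lintegral_prod _ (by fun_prop)]
  calc ∫⁻ t in Ioo 0 T, ∫⁻ x, ‖f t x‖ₑ ^ (2 : ℝ≥0∞).toReal
      ≤ ∫⁻ t in Ioo 0 T, ENNReal.ofReal E := by
        apply setLIntegral_mono' measurableSet_Ioo
        intro t ht
        simpa using h t ht
    _ < ⊤ := by simp [ENNReal.mul_lt_top_iff]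

/-- Products of functions of time and of space are test functions. -/
lemma isTestFunction_mul {T : ℝ} {θ : ℝ → ℝ} {g : Plane → ℝ} (h1 : ContDiff ℝ ∞ θ)
    (h2 : HasCompactSupport θ) (h3 : tsupport θ ⊆ Ioo 0 T) (hg : ContDiff ℝ ∞ g)
    (hg' : HasCompactSupport g) : IsTestFunction T fun z => θ z.1 * g z.2 := by
  have hs : Function.support (fun z : ℝ × Plane => θ z.1 * g z.2) ⊆ tsupport θ ×ˢ tsupport g := by
    intro z hz
    simp only [Function.mem_support, ne_eq, mul_eq_zero, not_or] at hz
    exact ⟨subset_tsupport _ hz.1, subset_tsupport _ hz.2⟩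
  have hcl : tsupport (fun z : ℝ × Plane => θ z.1 * g z.2) ⊆ tsupport θ ×ˢ tsupport g :=
    closure_minimal hs ((isClosed_tsupport _).prod (isClosed_tsupport _))
  refine ⟨by fun_prop, HasCompactSupport.of_support_subset_isCompact (h2.isCompact.prod hg'.isCompact) hs,
    fun z hz => ⟨h3 (hcl hz).1, mem_univ _⟩⟩

namespace IsWeakSolution

variable {T E : ℝ} {φ ψ : Plane → ℝ} {u v : ℝ → Plane → ℝ}

/-- Needed because the error terms below are measured by the length of the time interval. Shortening
it to at most `2t` makes them small with the time `t` of observation. -/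
lemma mono {T' : ℝ} (h : IsWeakSolution 2 T φ ψ u v) (hT : T' ≤ T) :
    IsWeakSolution 2 T' φ ψ u v := by
  have hs : Ioo 0 T' ×ˢ (univ : Set Plane) ⊆ Ioo 0 T ×ˢ univ :=
    prod_mono (Ioo_subset_Ioo_right hT) le_rfl
  have hs' : Ico 0 T' ⊆ Ico 0 T := Ico_subset_Ico_right hT
  have hη : ∀ η, IsTestFunction T' η → IsTestFunction T η :=
    fun η h => ⟨h.1, h.2.1, h.2.2.trans hs⟩
  have hi : ∀ f : ℝ × Plane → ℝ, (∀ z ∉ Ioo 0 T' ×ˢ (univ : Set Plane), f z = 0) →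
      ∫ z in Ioo 0 T' ×ˢ univ, f z = ∫ z in Ioo 0 T ×ˢ univ, f z := by
    intro f hf
    rw [setIntegral_eq_integral_of_forall_compl_eq_zero hf,
      setIntegral_eq_integral_of_forall_compl_eq_zero fun z hz => hf z fun h => hz (hs h)]
  -- A test function of the shorter slab vanishes in a neighbourhood of every point outside it, so
  -- all its derivatives vanish there too and integrals over the two slabs agree.
  have hz : ∀ η : ℝ × Plane → ℝ, IsTestFunction T' η → ∀ z ∉ Ioo 0 T' ×ˢ (univ : Set Plane),
      η =ᶠ[𝓝 z] 0 := fun η h z hz =>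
    notMem_tsupport_iff_eventuallyEq.1 fun hn => hz (h.2.2 hn)
  have hz1 : ∀ η : ℝ × Plane → ℝ, IsTestFunction T' η → ∀ z ∉ Ioo 0 T' ×ˢ (univ : Set Plane),
      (fun s => η (s, z.2)) =ᶠ[𝓝 z.1] 0 := fun η h z hn =>
    (Continuous.tendsto (by fun_prop : Continuous fun s : ℝ => (s, z.2)) z.1).eventually (hz η h z hn)
  have hz2 : ∀ η : ℝ × Plane → ℝ, IsTestFunction T' η → ∀ z ∉ Ioo 0 T' ×ˢ (univ : Set Plane),
      (fun y => η (z.1, y)) =ᶠ[𝓝 z.2] 0 := fun η h z hn =>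
    (Continuous.tendsto (by fun_prop : Continuous fun s : Plane => (z.1, s)) z.2).eventually
      (hz η h z hn)
  have hsm : slab T' ≤ slab T := Measure.restrict_mono hs le_rfl
  exact
  { finite_energy := h.finite_energy
    measurable_u := h.measurable_u.mono_measure hsm
    measurable_v := h.measurable_v.mono_measure hsm
    memLp_u := fun t ht => h.memLp_u t (hs' ht)
    memLp_v := fun t ht => h.memLp_v t (hs' ht)
    continuous_u := fun g hg => (h.continuous_u g hg).mono hs'
    continuous_v := fun g hg => (h.continuous_v g hg).mono hs'
    initial_u := h.initial_u
    initial_v := h.initial_v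
    time_deriv := by
      intro η ht
      rw [hi, hi]
      · exact h.time_deriv η (hη η ht)
      · intro z hn
        rw [(hz η ht z hn).eq_of_nhds]; simp
      · intro z hn
        rw [(hz1 η ht z hn).deriv_eq]; simp
    nonlin_integrable := h.nonlin_integrable.mono_set hs
    equation := by
      intro η ht
      rw [hi]
      · exact h.equation η (hη η ht)
      · intro z hn
        rw [(hz η ht z hn).eq_of_nhds, (hz1 η ht z hn).iteratedDeriv_eq,
          (InnerProductSpace.laplacian_congr_nhds (hz2 η ht z hn)).eq_of_nhds]
        have e1 : iteratedDeriv 2 (0 : ℝ → ℝ) z.1 = 0 := by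
          simp [Pi.zero_def]
        have e2 : Laplacian.laplacian (0 : Plane → ℝ) z.2 = 0 := by
          have := InnerProductSpace.laplacian_const (E := Plane) (F := ℝ) (c := 0)
          exact congrFun this z.2
        rw [e1, e2]; simp
    energy_le := fun t ht => h.energy_le t (hs' ht) }

variable (h : IsWeakSolution 2 T φ ψ u v) (hE : energy 2 φ ψ ≤ ENNReal.ofReal E)
include h hE

lemma lintegral_u_le {t : ℝ} (ht : t ∈ Ico 0 T) : ∫⁻ x, ‖u t x‖ₑ ^ 2 ≤ ENNReal.ofReal E :=
  ((lintegral_sq_le_energy _ _).trans (h.energy_le t ht)).trans hE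

lemma lintegral_v_le {t : ℝ} (ht : t ∈ Ico 0 T) : ∫⁻ x, ‖v t x‖ₑ ^ 2 ≤ ENNReal.ofReal E :=
  ((lintegral_sq_le_energy' _ _).trans (h.energy_le t ht)).trans hE

lemma memLp_slab_u : MemLp (fun z : ℝ × Plane => u z.1 z.2) 2 (slab T) :=
  memLp_slab h.measurable_u fun _ ht => h.lintegral_u_le hE (Ioo_subset_Ico_self ht)

lemma memLp_slab_v : MemLp (fun z : ℝ × Plane => v z.1 z.2) 2 (slab T) :=
  memLp_slab h.measurable_v fun _ ht => h.lintegral_v_le hE (Ioo_subset_Ico_self ht)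

lemma l2_u_le {t : ℝ} (hE0 : 0 ≤ E) (ht : t ∈ Ico 0 T) : l2 volume (u t) ≤ √E :=
  l2_le_of_lintegral_le (h.memLp_u t ht) hE0 (h.lintegral_u_le hE ht)

lemma l2_v_le {t : ℝ} (hE0 : 0 ≤ E) (ht : t ∈ Ico 0 T) : l2 volume (v t) ≤ √E :=
  l2_le_of_lintegral_le (h.memLp_v t ht) hE0 (h.lintegral_v_le hE ht)

omit h hE in
/-- Fubini for products of a square integrable function with functions of time and of space. -/
lemma setIntegral_mul_mul {f : ℝ → Plane → ℝ}
    (hf : MemLp (fun z : ℝ × Plane => f z.1 z.2) 2 (slab T))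
    {θ : ℝ → ℝ} {g : Plane → ℝ} (hθ : Continuous θ) (hθ' : HasCompactSupport θ)
    (hθs : tsupport θ ⊆ Ioo 0 T) (hg : Continuous g) (hg' : HasCompactSupport g) :
    ∫ z in Ioo 0 T ×ˢ univ, f z.1 z.2 * (θ z.1 * g z.2)
      = ∫ t, (∫ x, f t x * g x) * θ t := by
  have hm : MemLp (fun z : ℝ × Plane => θ z.1 * g z.2) 2 (slab T) := by
    apply MemLp.restrict
    apply Continuous.memLp_of_hasCompactSupport (by fun_prop)
    apply HasCompactSupport.of_support_subset_isCompact (hθ'.isCompact.prod hg'.isCompact)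
    intro z hz
    simp only [Function.mem_support, ne_eq, mul_eq_zero, not_or] at hz
    exact ⟨subset_tsupport _ hz.1, subset_tsupport _ hz.2⟩
  have hi := hf.integrable_mul hm
  rw [slab_eq_prod] at hi
  have : ∫ z in Ioo 0 T ×ˢ univ, f z.1 z.2 * (θ z.1 * g z.2) =
      ∫ z, f z.1 z.2 * (θ z.1 * g z.2) ∂(slab T) := rfl
  rw [this, slab_eq_prod, integral_prod (fun z => f z.1 z.2 * (θ z.1 * g z.2)) hi]
  rw [← setIntegral_eq_integral_of_forall_compl_eq_zero (s := Ioo 0 T)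
    (f := fun t => (∫ x, f t x * g x) * θ t)]
  · congr 1; ext t
    rw [← integral_mul_const]
    congr 1; ext x; ring
  · intro t ht
    rw [image_eq_zero_of_notMem_tsupport fun hn => ht (hθs hn), mul_zero]

omit hE in
lemma integral_u_mul_deriv (hE : energy 2 φ ψ ≤ ENNReal.ofReal E) {θ : ℝ → ℝ} {g : Plane → ℝ}
    (hθ : IsTimeCutoff T θ) (hg : ContDiff ℝ ∞ g) (hg' : HasCompactSupport g) :
    ∫ t, (∫ x, u t x * g x) * deriv θ t = - ∫ t, (∫ x, v t x * g x) * θ t := by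
  have h1 := h.time_deriv _ (isTestFunction_mul hθ.contDiff hθ.hasCompactSupport
    hθ.tsupport_subset hg hg')
  rw [setIntegral_mul_mul (h.memLp_slab_v hE) hθ.contDiff.continuous hθ.hasCompactSupport
    hθ.tsupport_subset hg.continuous hg'] at h1
  rw [← setIntegral_mul_mul (h.memLp_slab_u hE) (hθ.contDiff.continuous_deriv (by simp))
    hθ.hasCompactSupport.deriv (tsupport_deriv_subset.trans hθ.tsupport_subset)
    hg.continuous hg', ← h1]
  congr 1; ext z
  dsimp only
  rw [deriv_mul_const ((hθ.contDiff.differentiable (by simp)).differentiableAt)]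

/-- Weak solutions are Lipschitz in time with values in `L²`. -/
theorem l2_u_sub_le (hE0 : 0 ≤ E) {s : ℝ} (hs : s ∈ Ioo 0 T) :
    l2 volume (u s - φ) ≤ s * √E := by
  have hs' := Ioo_subset_Ico_self hs
  have hφ := h.finite_energy.1
  apply l2_le_of_forall_test ((h.memLp_u s hs').sub hφ) (mul_nonneg hs.1.le (Real.sqrt_nonneg _))
  intro g hg hg'
  have hgm : MemLp g 2 volume := hg.continuous.memLp_of_hasCompactSupport hg'
  set K := √E * l2 volume g with hK
  have hK0 : 0 ≤ K := mul_nonneg (Real.sqrt_nonneg _) (l2_nonneg _)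
  have hV : ∀ t ∈ Ico 0 T, |∫ x, v t x * g x| ≤ K := fun t ht =>
    (abs_integral_mul_le_l2 (h.memLp_v t ht) hgm).trans
      (mul_le_mul_of_nonneg_right (h.l2_v_le hE hE0 ht) (l2_nonneg _))
  have hVθ : ∀ θ, IsTimeCutoff T θ → |∫ t, (∫ x, v t x * g x) * θ t| ≤ K * ∫ t, θ t := by
    intro θ hθ
    have hθi : Integrable θ :=
      hθ.contDiff.continuous.integrable_of_hasCompactSupport hθ.hasCompactSupport
    rw [← integral_const_mul]
    refine abs_integral_le_integral_abs.trans ?_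
    apply integral_mono_of_nonneg (Eventually.of_forall fun t => abs_nonneg _) (hθi.const_mul K)
    refine Eventually.of_forall fun t => ?_
    simp only [abs_mul, abs_of_nonneg (hθ.nonneg t)]
    by_cases ht : t ∈ Ico 0 T
    · exact mul_le_mul_of_nonneg_right (hV t ht) (hθ.nonneg t)
    · rw [image_eq_zero_of_notMem_tsupport fun hn => ht (Ioo_subset_Ico_self
        (hθ.tsupport_subset hn))]
      simp
  -- The pairing with `g` has distributional derivative bounded by `K` in absolute value. The
  -- criterion, without variation error, is applied to the pairing and to its negative.
  have h1 := le_sub_of_forall_timeCutoff (F₀ := -K) (B := 0) (h.continuous_u g hgm) le_rfl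
    (fun θ hθ => by
      rw [h.integral_u_mul_deriv hE hθ hg hg']
      linarith [(abs_le.1 (hVθ θ hθ)).2]) hs
  have h2 := le_sub_of_forall_timeCutoff (F₀ := -K) (B := 0) (h.continuous_u g hgm).neg le_rfl
    (fun θ hθ => by
      simp only [Pi.neg_apply, neg_mul, integral_neg]
      rw [h.integral_u_mul_deriv hE hθ hg hg']
      linarith [(abs_le.1 (hVθ θ hθ)).1]) hs
  have h0 : ∫ x, u 0 x * g x = ∫ x, φ x * g x := by
    apply integral_congr_ae
    filter_upwards [h.initial_u] with x hx
    rw [hx]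
  have h3 : ∫ x, (u s - φ) x * g x = (∫ x, u s x * g x) - ∫ x, φ x * g x := by
    have := integral_sub ((h.memLp_u s hs').integrable_mul hgm) (hφ.integrable_mul hgm)
    simp only [Pi.mul_apply] at this
    rw [← this]
    congr 1; ext x; simp only [Pi.sub_apply]; ring
  rw [h3, ← h0, abs_le]
  simp only [Pi.neg_apply] at h2
  constructor <;> nlinarith

end IsWeakSolution

/-! ### Mollification: derivatives, `L¹` convergence, Jensen's inequality -/

section Mollify

set_option linter.unusedSectionVars false

variable {G : Type*} [NormedAddCommGroup G] [NormedSpace ℝ G] [FiniteDimensional ℝ G]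
  [MeasurableSpace G] [BorelSpace G] {μ : Measure G} [μ.IsAddHaarMeasure]

/-- The directional derivative. -/
def dirD (e : G) (f : G → ℝ) (z : G) : ℝ := fderiv ℝ f z e

lemma dirD_contDiff (e : G) {f : G → ℝ} (hf : ContDiff ℝ ∞ f) : ContDiff ℝ ∞ (dirD e f) :=
  (hf.fderiv_right (m := ∞) (by simp)).clm_apply contDiff_const

lemma dirD_hasCompactSupport (e : G) {f : G → ℝ} (hf : HasCompactSupport f) :
    HasCompactSupport (dirD e f) := hf.fderiv_apply ℝ e

lemma tsupport_dirD_subset (e : G) (f : G → ℝ) : tsupport (dirD e f) ⊆ tsupport f :=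
  tsupport_fderiv_apply_subset ℝ e

lemma dirD_comp_sub (e : G) {k : G → ℝ} (hk : ContDiff ℝ ∞ k) (z y : G) :
    dirD e (fun y => k (z - y)) y = - dirD e k (z - y) := by
  have h1 : HasFDerivAt (fun y => z - y) (-ContinuousLinearMap.id ℝ G) y :=
    (hasFDerivAt_id y).const_sub z
  have h2 : HasFDerivAt k (fderiv ℝ k (z - y)) (z - y) :=
    (hk.differentiable (by simp)).differentiableAt.hasFDerivAt
  have h3 : HasFDerivAt (fun y => k (z - y)) _ y := h2.comp y h1
  unfold dirD
  rw [h3.fderiv]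
  simp

lemma dirD_mul (e : G) {f g : G → ℝ} (hf : ContDiff ℝ ∞ f) (hg : ContDiff ℝ ∞ g) (z : G) :
    dirD e (fun z => f z * g z) z = f z * dirD e g z + dirD e f z * g z := by
  unfold dirD
  rw [fderiv_fun_mul (hf.differentiable (by simp)).differentiableAt
    (hg.differentiable (by simp)).differentiableAt]
  simp [mul_comm]

lemma dirD_comp (e : G) {c : ℝ → ℝ} {f : G → ℝ} (hc : ContDiff ℝ ∞ c) (hf : ContDiff ℝ ∞ f)
    (z : G) : dirD e (fun z => c (f z)) z = deriv c (f z) * dirD e f z := by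
  unfold dirD
  have h1 := (hc.differentiable (by simp)).differentiableAt.hasDerivAt (x := f z)
  have h2 := (hf.differentiable (by simp)).differentiableAt.hasFDerivAt (x := z)
  have h3 : HasFDerivAt (fun z => c (f z)) _ z := h1.comp_hasFDerivAt z h2
  rw [h3.fderiv]
  simp

lemma integral_dirD_mul (e : G) {f g : G → ℝ} (hf : ContDiff ℝ ∞ f) (hg : ContDiff ℝ ∞ g)
    (hgc : HasCompactSupport g) :
    ∫ z, dirD e f z * g z ∂μ = - ∫ z, f z * dirD e g z ∂μ := by
  have := integral_mul_fderiv_eq_neg_fderiv_mul_of_integrable (μ := μ) (f := f) (g := g) (v := e)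
    (((dirD_contDiff e hf).continuous.mul hg.continuous).integrable_of_hasCompactSupport
      hgc.mul_left)
    ((hf.continuous.mul (dirD_contDiff e hg).continuous).integrable_of_hasCompactSupport
      (dirD_hasCompactSupport e hgc).mul_left)
    ((hf.continuous.mul hg.continuous).integrable_of_hasCompactSupport hgc.mul_left)
    (fun x _ => (hf.differentiable (by simp)).differentiableAt)
    (fun x _ => (hg.differentiable (by simp)).differentiableAt)
  unfold dirD
  rw [this, neg_neg]

variable (μ) in
/-- Convolution with a smooth kernel. -/
def mconv (f k : G → ℝ) (z : G) : ℝ := ∫ y, f y * k (z - y) ∂μ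

lemma mconv_eq (f k : G → ℝ) :
    mconv μ f k = convolution f k (ContinuousLinearMap.mul ℝ ℝ) μ := rfl

variable {f k : G → ℝ}

lemma mconv_integrable_integrand (hf : Integrable f μ) (hk : Continuous k)
    (hkc : HasCompactSupport k) (z : G) : Integrable (fun y => f y * k (z - y)) μ :=
  hkc.convolutionExists_right (ContinuousLinearMap.mul ℝ ℝ) hf.locallyIntegrable hk z

lemma mconv_contDiff (hf : Integrable f μ) (hk : ContDiff ℝ ∞ k) (hkc : HasCompactSupport k) :
    ContDiff ℝ ∞ (mconv μ f k) :=
  hkc.contDiff_convolution_right (n := ⊤) (ContinuousLinearMap.mul ℝ ℝ) hf.locallyIntegrable hk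

lemma dirD_mconv (hf : Integrable f μ) (hk : ContDiff ℝ ∞ k) (hkc : HasCompactSupport k) (e : G) :
    dirD e (mconv μ f k) = mconv μ f (dirD e k) := by
  ext z
  have := hkc.hasFDerivAt_convolution_right (ContinuousLinearMap.mul ℝ ℝ) (μ := μ)
    hf.locallyIntegrable (hk.of_le (by simp)) z
  unfold dirD
  rw [mconv_eq, this.fderiv, convolution_precompR_apply _ hf.locallyIntegrable
    (hkc.fderiv ℝ) (hk.continuous_fderiv (by simp))]
  rfl

lemma mconv_integrable (hf : Integrable f μ) (hk : Integrable k μ) : Integrable (mconv μ f k) μ :=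
  hf.integrable_convolution (ContinuousLinearMap.mul ℝ ℝ) hk

lemma integral_mconv (hf : Integrable f μ) (hk : Integrable k μ) :
    ∫ z, mconv μ f k z ∂μ = (∫ z, f z ∂μ) * ∫ z, k z ∂μ :=
  integral_convolution (ContinuousLinearMap.mul ℝ ℝ) hf hk

variable (G) in
/-- A sequence of bump functions that shrink to the origin. -/
def bumpSeq (n : ℕ) : ContDiffBump (0 : G) where
  rIn := 1 / (n + 1) / 2
  rOut := 1 / (n + 1)
  rIn_pos := by positivity
  rIn_lt_rOut := half_lt_self (by positivity)

variable (μ) in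
/-- The corresponding approximation of the identity. -/
def moll (n : ℕ) : G → ℝ := (bumpSeq G n).normed μ

lemma moll_contDiff (n : ℕ) : ContDiff ℝ ∞ (moll μ n) := (bumpSeq G n).contDiff_normed (n := ⊤)

lemma moll_hasCompactSupport (n : ℕ) : HasCompactSupport (moll μ n) :=
  (bumpSeq G n).hasCompactSupport_normed

lemma moll_nonneg (n : ℕ) (z : G) : 0 ≤ moll μ n z := (bumpSeq G n).nonneg_normed z

lemma integral_moll (n : ℕ) : ∫ z, moll μ n z ∂μ = 1 := (bumpSeq G n).integral_normed

lemma tsupport_moll (n : ℕ) : tsupport (moll μ n) = Metric.closedBall 0 (1 / (n + 1)) :=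
  (bumpSeq G n).tsupport_normed_eq

lemma moll_integrable (n : ℕ) : Integrable (moll μ n) μ :=
  (moll_contDiff n).continuous.integrable_of_hasCompactSupport (moll_hasCompactSupport n)

lemma ae_tendsto_mconv_moll (hf : Integrable f μ) :
    ∀ᵐ z ∂μ, Tendsto (fun n => mconv μ f (moll μ n) z) atTop (𝓝 (f z)) := by
  have h1 : Tendsto (fun n => (bumpSeq G n).rOut) atTop (𝓝 0) :=
    tendsto_one_div_add_atTop_nhds_zero_nat
  -- The ratio of the outer to the inner radius stays bounded, as differentiation along shrinking
  -- bumps requires.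
  have h2 : ∀ᶠ n in atTop, (bumpSeq G n).rOut ≤ 2 * (bumpSeq G n).rIn :=
    Eventually.of_forall fun n => by simp only [bumpSeq]; linarith
  filter_upwards [ContDiffBump.ae_convolution_tendsto_right_of_locallyIntegrable h1 h2
    hf.locallyIntegrable] with z hz
  refine hz.congr fun n => ?_
  rw [convolution_eq_swap]
  simp only [mconv, moll, ContinuousLinearMap.lsmul_apply, smul_eq_mul, mul_comm]

/-- Scheffé's argument: mollification preserves the integral, so the `L¹` distance is twice the
integral of the positive part of `f` minus its mollification. That positive part is dominated by `f`
and tends to zero almost everywhere. -/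
lemma tendsto_integral_abs_mconv_sub_of_nonneg (hf : Integrable f μ) (h0 : ∀ z, 0 ≤ f z) :
    Tendsto (fun n => ∫ z, |mconv μ f (moll μ n) z - f z| ∂μ) atTop (𝓝 0) := by
  have hi : ∀ n, Integrable (mconv μ f (moll μ n)) μ := fun n =>
    mconv_integrable hf (moll_integrable n)
  have h1 : ∀ n, ∫ z, |mconv μ f (moll μ n) z - f z| ∂μ
      = 2 * ∫ z, max (f z - mconv μ f (moll μ n) z) 0 ∂μ := by
    intro n
    have hp : Integrable (fun z => max (f z - mconv μ f (moll μ n) z) 0) μ :=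
      (hf.sub (hi n)).pos_part
    have e : ∀ z, |mconv μ f (moll μ n) z - f z|
        = 2 * max (f z - mconv μ f (moll μ n) z) 0 + (mconv μ f (moll μ n) z - f z) := by
      intro z
      rcases le_total (f z) (mconv μ f (moll μ n) z) with h | h
      · rw [abs_of_nonneg (by linarith), max_eq_right (by linarith)]; ring
      · rw [abs_of_nonpos (by linarith), max_eq_left (by linarith)]; ring
    have hs : Integrable (fun z => mconv μ f (moll μ n) z - f z) μ := (hi n).sub hf
    simp_rw [e]
    rw [integral_add (hp.const_mul 2) hs, integral_sub (hi n) hf,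
      integral_mconv hf (moll_integrable n), integral_moll, integral_const_mul]
    ring
  simp_rw [h1]
  rw [← mul_zero (2 : ℝ)]
  apply Tendsto.const_mul
  have : Tendsto (fun n => ∫ z, max (f z - mconv μ f (moll μ n) z) 0 ∂μ) atTop
      (𝓝 (∫ _, (0 : ℝ) ∂μ)) := by
    apply tendsto_integral_of_dominated_convergence f
    · exact fun n => ((hf.sub (hi n)).pos_part).1
    · exact hf
    · intro n
      refine Eventually.of_forall fun z => ?_
      have : 0 ≤ mconv μ f (moll μ n) z :=
        integral_nonneg fun y => mul_nonneg (h0 y) (moll_nonneg n _)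
      rw [Real.norm_of_nonneg (le_max_right _ _)]
      exact max_le (by linarith) (h0 z)
    · filter_upwards [ae_tendsto_mconv_moll hf] with z hz
      have := (tendsto_const_nhds (x := f z)).sub hz
      rw [sub_self] at this
      simpa using this.max (tendsto_const_nhds (x := (0 : ℝ)))
  simpa using this

/-- Mollification converges in `L¹`. -/
lemma tendsto_integral_abs_mconv_sub (hf : Integrable f μ) :
    Tendsto (fun n => ∫ z, |mconv μ f (moll μ n) z - f z| ∂μ) atTop (𝓝 0) := by
  have hp : Integrable (fun z => max (f z) 0) μ := hf.pos_part
  have hn : Integrable (fun z => max (-f z) 0) μ := hf.neg_part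
  have t := (tendsto_integral_abs_mconv_sub_of_nonneg hp fun z => le_max_right _ _).add
    (tendsto_integral_abs_mconv_sub_of_nonneg hn fun z => le_max_right _ _)
  rw [add_zero] at t
  refine squeeze_zero (fun n => integral_nonneg fun z => abs_nonneg _) (fun n => ?_) t
  have i1 := ((mconv_integrable hp (moll_integrable n)).sub hp).abs
  have i2 := ((mconv_integrable hn (moll_integrable n)).sub hn).abs
  have e := integral_add i1 i2
  simp only [Pi.sub_apply] at e
  rw [← e]
  apply integral_mono ((mconv_integrable hf (moll_integrable n)).sub hf).abs (i1.add i2)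
  intro z
  have hm := moll_hasCompactSupport (μ := μ) n
  have hc := (moll_contDiff (μ := μ) n).continuous
  have e1 : mconv μ f (moll μ n) z = mconv μ (fun z => max (f z) 0) (moll μ n) z
      - mconv μ (fun z => max (-f z) 0) (moll μ n) z := by
    unfold mconv
    rw [← integral_sub (mconv_integrable_integrand hp hc hm z)
      (mconv_integrable_integrand hn hc hm z)]
    congr 1; ext y
    rw [← sub_mul]
    congr 1
    rcases le_total (f y) 0 with h | h
    · rw [max_eq_right h, max_eq_left (by linarith)]; ring
    · rw [max_eq_left h, max_eq_right (by linarith)]; ring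
  have e2 : f z = max (f z) 0 - max (-f z) 0 := by
    rcases le_total (f z) 0 with h | h
    · rw [max_eq_right h, max_eq_left (by linarith)]; ring
    · rw [max_eq_left h, max_eq_right (by linarith)]; ring
  simp only [Pi.sub_apply, Pi.add_apply]
  rw [e1]
  conv_lhs => rw [e2]
  refine le_trans (le_of_eq ?_) (abs_sub _ _)
  congr 1; ring

/-- Jensen's inequality for mollification. -/
lemma mconv_sq_le (hf : Integrable f μ) (hf2 : Integrable (fun z => f z ^ 2) μ) (n : ℕ) (z : G) :
    mconv μ f (moll μ n) z ^ 2 ≤ mconv μ (fun z => f z ^ 2) (moll μ n) z := by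
  have hm := moll_hasCompactSupport (μ := μ) n
  have hc := (moll_contDiff (μ := μ) n).continuous
  set m := mconv μ f (moll μ n) z with hmdef
  have i1 := mconv_integrable_integrand hf hc hm z
  have i2 := mconv_integrable_integrand hf2 hc hm z
  have i3 : Integrable (fun y => moll μ n (z - y)) μ := (moll_integrable n).comp_sub_left z
  -- The variance of `f` about its weighted mean `m` is nonnegative; expanding it gives the claim,
  -- the weight having total mass one.
  have h0 : 0 ≤ ∫ y, (f y - m) ^ 2 * moll μ n (z - y) ∂μ :=
    integral_nonneg fun y => mul_nonneg (sq_nonneg _) (moll_nonneg n _)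
  have e : ∫ y, (f y - m) ^ 2 * moll μ n (z - y) ∂μ
      = (∫ y, f y ^ 2 * moll μ n (z - y) ∂μ) - 2 * m * (∫ y, f y * moll μ n (z - y) ∂μ)
        + m ^ 2 * ∫ y, moll μ n (z - y) ∂μ := by
    have i4 : Integrable (fun y => f y ^ 2 * moll μ n (z - y)
        - 2 * m * (f y * moll μ n (z - y))) μ := i2.sub (i1.const_mul _)
    rw [← integral_const_mul, ← integral_const_mul, ← integral_sub i2 (i1.const_mul _),
      ← integral_add i4 (i3.const_mul _)]
    congr 1; ext y; ring
  rw [e, integral_sub_left_eq_self (moll μ n) μ z, integral_moll] at h0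
  change 0 ≤ mconv μ (fun z => f z ^ 2) (moll μ n) z - 2 * m * m + m ^ 2 * 1 at h0
  nlinarith

end Mollify

/-- Convergence of products of `L¹` convergent and boundedly convergent sequences. -/
lemma tendsto_integral_mul {α : Type*} [MeasurableSpace α] {μ : Measure α} {F : ℕ → α → ℝ}
    {f : α → ℝ} {b : ℕ → α → ℝ} {β : α → ℝ} {B : ℝ} (hF : ∀ n, Integrable (F n) μ)
    (hf : Integrable f μ)
    (hFf : Tendsto (fun n => ∫ z, |F n z - f z| ∂μ) atTop (𝓝 0))
    (hb : ∀ n, AEStronglyMeasurable (b n) μ) (hbB : ∀ n z, |b n z| ≤ B)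
    (hbβ : ∀ᵐ z ∂μ, Tendsto (fun n => b n z) atTop (𝓝 (β z))) :
    Tendsto (fun n => ∫ z, F n z * b n z ∂μ) atTop (𝓝 (∫ z, f z * β z ∂μ)) := by
  have hB : ∀ᵐ z ∂μ, |β z| ≤ B := by
    filter_upwards [hbβ] with z hz
    exact le_of_tendsto hz.abs (Eventually.of_forall fun n => hbB n z)
  have i1 : ∀ n, Integrable (fun z => (F n z - f z) * b n z) μ := fun n =>
    ((hF n).sub hf).mul_bdd (c := B) (hb n) (Eventually.of_forall fun z => hbB n z)
  have i2 : ∀ n, Integrable (fun z => f z * b n z) μ := fun n =>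
    hf.mul_bdd (c := B) (hb n) (Eventually.of_forall fun z => hbB n z)
  have t1 : Tendsto (fun n => ∫ z, (F n z - f z) * b n z ∂μ) atTop (𝓝 0) := by
    have t := hFf.mul_const B
    rw [zero_mul] at t
    refine squeeze_zero_norm (fun n => ?_) t
    rw [← integral_mul_const]
    refine (norm_integral_le_integral_norm _).trans ?_
    apply integral_mono (i1 n).norm (((hF n).sub hf).abs.mul_const B)
    intro z
    simp only [norm_mul, Real.norm_eq_abs]
    exact mul_le_mul_of_nonneg_left (hbB n z) (abs_nonneg _)
  have t2 : Tendsto (fun n => ∫ z, f z * b n z ∂μ) atTop (𝓝 (∫ z, f z * β z ∂μ)) := by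
    apply tendsto_integral_of_dominated_convergence (fun z => |f z| * B)
    · exact fun n => (i2 n).1
    · exact hf.abs.mul_const B
    · intro n
      refine Eventually.of_forall fun z => ?_
      rw [norm_mul]
      exact mul_le_mul_of_nonneg_left (hbB n z) (abs_nonneg _)
    · filter_upwards [hbβ] with z hz using hz.const_mul _
  have := t1.add t2
  rw [zero_add] at this
  refine this.congr fun n => ?_
  rw [← integral_add (i1 n) (i2 n)]
  congr 1; ext z; ring

/-! ### Derivatives in space-time, and the wave equation multiplied by a function of the solution -/

instance isAddHaarMeasure_spaceTime : (volume : Measure (ℝ × Plane)).IsAddHaarMeasure :=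
  inferInstanceAs ((volume : Measure ℝ).prod (volume : Measure Plane)).IsAddHaarMeasure

/-- The unit vector in the time direction. -/
def eT : ℝ × Plane := (1, 0)

/-- The unit vectors in the space directions. -/
def eX (i : Fin 2) : ℝ × Plane := (0, EuclideanSpace.single i 1)

lemma deriv_slice {η : ℝ × Plane → ℝ} (hη : ContDiff ℝ ∞ η) (z : ℝ × Plane) :
    deriv (fun s => η (s, z.2)) z.1 = dirD eT η z := by
  have h1 : HasDerivAt (fun s : ℝ => (s, z.2)) eT z.1 :=
    (hasDerivAt_id z.1).prodMk (hasDerivAt_const _ _)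
  have h2 : HasFDerivAt η (fderiv ℝ η z) (z.1, z.2) :=
    (hη.differentiable (by simp)).differentiableAt.hasFDerivAt
  exact (h2.comp_hasDerivAt z.1 h1).deriv

lemma iteratedDeriv_slice {η : ℝ × Plane → ℝ} (hη : ContDiff ℝ ∞ η) (z : ℝ × Plane) :
    iteratedDeriv 2 (fun s => η (s, z.2)) z.1 = dirD eT (dirD eT η) z := by
  rw [iteratedDeriv_succ, iteratedDeriv_one, ← deriv_slice (dirD_contDiff eT hη)]
  congr 1
  ext s
  exact deriv_slice hη (s, z.2)

lemma fderiv_slice {η : ℝ × Plane → ℝ} (hη : ContDiff ℝ ∞ η) (t : ℝ) (x : Plane) (i : Fin 2) :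
    fderiv ℝ (fun y => η (t, y)) x (EuclideanSpace.single i 1) = dirD (eX i) η (t, x) := by
  have h1 : HasFDerivAt (fun y : Plane => (t, y)) (ContinuousLinearMap.inr ℝ ℝ Plane) x :=
    hasFDerivAt_prodMk_right t x
  have h2 : HasFDerivAt η (fderiv ℝ η (t, x)) (t, x) :=
    (hη.differentiable (by simp)).differentiableAt.hasFDerivAt
  have h3 : HasFDerivAt (fun y => η (t, y)) _ x := h2.comp x h1
  rw [h3.fderiv]
  simp [dirD, eX]

lemma laplacian_eq_sum_fderiv {g : Plane → ℝ} (hg : ContDiff ℝ ∞ g) (x : Plane) :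
    Laplacian.laplacian g x = ∑ i : Fin 2, fderiv ℝ (fun y => fderiv ℝ g y
      (EuclideanSpace.single i 1)) x (EuclideanSpace.single i 1) := by
  rw [InnerProductSpace.laplacian_eq_iteratedFDeriv_orthonormalBasis g
    (EuclideanSpace.basisFun (Fin 2) ℝ)]
  refine Finset.sum_congr rfl fun i _ => ?_
  have hd : DifferentiableAt ℝ (fderiv ℝ g) x :=
    ((hg.fderiv_right (m := ∞) (by simp)).differentiable (by simp)).differentiableAt
  rw [iteratedFDeriv_two_apply, fderiv_clm_apply hd (differentiableAt_const _)]
  simp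

lemma laplacian_slice {η : ℝ × Plane → ℝ} (hη : ContDiff ℝ ∞ η) (z : ℝ × Plane) :
    Laplacian.laplacian (fun y => η (z.1, y)) z.2
      = ∑ i, dirD (eX i) (dirD (eX i) η) z := by
  have hs : ContDiff ℝ ∞ fun y => η (z.1, y) :=
    hη.comp (by fun_prop : ContDiff ℝ ∞ fun y : Plane => (z.1, y))
  rw [laplacian_eq_sum_fderiv hs]
  refine Finset.sum_congr rfl fun i _ => ?_
  simp_rw [fderiv_slice hη]
  rw [fderiv_slice (dirD_contDiff (eX i) hη)]

/-- The inequality that results from multiplying a wave equation by an increasing function of the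
solution. -/
lemma integral_mul_comp_le {U V W w : ℝ × Plane → ℝ} {c C : ℝ → ℝ} (hU : ContDiff ℝ ∞ U)
    (hV : ContDiff ℝ ∞ V) (hw : ContDiff ℝ ∞ w) (hwc : HasCompactSupport w)
    (hw0 : ∀ z, 0 ≤ w z) (hc : ContDiff ℝ ∞ c) (hC : ContDiff ℝ ∞ C) (hCc : deriv C = c)
    (hc0 : ∀ y, 0 ≤ deriv c y) (h1 : ∀ z, w z ≠ 0 → dirD eT U z = V z)
    (h2 : ∀ z, w z ≠ 0 → dirD eT V z - ∑ i, dirD (eX i) (dirD (eX i) U) z + W z = 0) :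
    ∫ z, W z * (c (U z) * w z) ≤ (∫ z, V z ^ 2 * (deriv c (U z) * w z))
      + (∫ z, V z * (c (U z) * dirD eT w z))
      + ∫ z, C (U z) * ∑ i, dirD (eX i) (dirD (eX i) w) z := by
  have hcU : ContDiff ℝ ∞ fun z => c (U z) := hc.comp hU
  have hCU : ContDiff ℝ ∞ fun z => C (U z) := hC.comp hU
  have hc'U : Continuous fun z => deriv c (U z) :=
    (hc.continuous_deriv (by simp)).comp hU.continuous
  have hcw : ContDiff ℝ ∞ fun z => c (U z) * w z := hcU.mul hw
  have hcwc : HasCompactSupport fun z => c (U z) * w z := hwc.mul_left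
  have int : ∀ {F k : ℝ × Plane → ℝ}, Continuous F → Continuous k → HasCompactSupport k →
      Integrable fun z => F z * k z := fun hF hk hkc =>
    (hF.mul hk).integrable_of_hasCompactSupport hkc.mul_left
  have hD : ∀ e z, dirD e (fun z => c (U z) * w z) z
      = c (U z) * dirD e w z + deriv c (U z) * dirD e U z * w z := fun e z => by
    rw [dirD_mul e hcU hw, dirD_comp e hc hU]
  -- The equations hold only where `w` does not vanish, which suffices because each term that uses
  -- them carries the factor `w`.
  have A : ∫ z, dirD eT V z * (c (U z) * w z) = -((∫ z, V z ^ 2 * (deriv c (U z) * w z))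
      + (∫ z, V z * (c (U z) * dirD eT w z))) := by
    rw [integral_dirD_mul eT hV hcw hcwc, ← integral_add]
    · congr 2; ext z
      rw [hD]
      by_cases hz : w z = 0
      · rw [hz]; ring
      · rw [h1 z hz]; ring
    · exact int (hV.continuous.pow 2) (hc'U.mul hw.continuous) hwc.mul_left
    · exact int hV.continuous (hcU.continuous.mul (dirD_contDiff eT hw).continuous)
        (dirD_hasCompactSupport eT hwc).mul_left
  -- One integration by parts gives `-(∂ᵢU)² c'(U) w`, which is dropped by its sign, and `-c(U) ∂ᵢU
  -- ∂ᵢw`. The latter is `-∂ᵢ(C(U)) ∂ᵢw`, so a second integration by parts leaves no derivative on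
  -- `U`, and the gradient of the solution need not be controlled in the limit.
  have B : ∀ i, ∫ z, dirD (eX i) (dirD (eX i) U) z * (c (U z) * w z)
      ≤ ∫ z, C (U z) * dirD (eX i) (dirD (eX i) w) z := by
    intro i
    have hUi := dirD_contDiff (eX i) hU
    have hwi := dirD_contDiff (eX i) hw
    have hwic := dirD_hasCompactSupport (eX i) hwc
    have e1 := integral_dirD_mul (μ := volume) (eX i) hUi hcw hcwc
    have e2 := integral_dirD_mul (μ := volume) (eX i) hCU hwi hwic
    simp_rw [dirD_comp (eX i) hC hU, hCc] at e2
    have e3 : ∫ z, dirD (eX i) U z * dirD (eX i) (fun z => c (U z) * w z) z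
        = (∫ z, c (U z) * dirD (eX i) U z * dirD (eX i) w z)
          + ∫ z, dirD (eX i) U z ^ 2 * (deriv c (U z) * w z) := by
      rw [← integral_add]
      · congr 1; ext z; rw [hD]; ring
      · exact int (hcU.continuous.mul hUi.continuous) hwi.continuous hwic
      · exact int (hUi.continuous.pow 2) (hc'U.mul hw.continuous) hwc.mul_left
    have e4 : 0 ≤ ∫ z, dirD (eX i) U z ^ 2 * (deriv c (U z) * w z) :=
      integral_nonneg fun z => mul_nonneg (sq_nonneg _) (mul_nonneg (hc0 _) (hw0 _))
    rw [e1, e3, e2]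
    linarith
  have hsum : ∀ {F : Fin 2 → ℝ × Plane → ℝ} (k : ℝ × Plane → ℝ),
      (∀ i, Integrable fun z => F i z * k z) →
      ∫ z, (∑ i, F i z) * k z = ∑ i, ∫ z, F i z * k z := fun k hF => by
    simp_rw [Finset.sum_mul]
    exact integral_finsetSum _ fun i _ => hF i
  have hWeq : ∫ z, W z * (c (U z) * w z)
      = (∑ i, ∫ z, dirD (eX i) (dirD (eX i) U) z * (c (U z) * w z))
        - ∫ z, dirD eT V z * (c (U z) * w z) := by
    have hi : ∀ i, Integrable fun z => dirD (eX i) (dirD (eX i) U) z * (c (U z) * w z) := fun i =>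
      int (dirD_contDiff _ (dirD_contDiff _ hU)).continuous hcw.continuous hcwc
    have hs : Integrable fun z => (∑ i, dirD (eX i) (dirD (eX i) U) z) * (c (U z) * w z) :=
      int (continuous_finsetSum _ fun i _ => (dirD_contDiff _ (dirD_contDiff _ hU)).continuous)
        hcw.continuous hcwc
    rw [← hsum _ hi, ← integral_sub hs (int (dirD_contDiff _ hV).continuous hcw.continuous hcwc)]
    congr 1; ext z
    by_cases hz : w z = 0
    · rw [hz]; ring
    · have := h2 z hz
      rw [← sub_mul]
      congr 1
      linarith
  have hR : ∫ z, C (U z) * ∑ i, dirD (eX i) (dirD (eX i) w) z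
      = ∑ i, ∫ z, C (U z) * dirD (eX i) (dirD (eX i) w) z := by
    simp_rw [Finset.mul_sum]
    exact integral_finsetSum _ fun i _ => int hCU.continuous
      (dirD_contDiff _ (dirD_contDiff _ hw)).continuous
      (dirD_hasCompactSupport _ (dirD_hasCompactSupport _ hwc))
  rw [hWeq, A, hR]
  have := Finset.sum_le_sum fun i (_ : i ∈ (Finset.univ : Finset (Fin 2))) => B i
  linarith

/-! ### The truncation applied to the solution -/

/-- The smooth step `c` with `c = 0` on `(-∞,-1]` and `c = 1` on `[0,∞)`. -/
def step (y : ℝ) : ℝ := Real.smoothTransition (y + 1)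

/-- The primitive of the smooth step. -/
def stepPrim (y : ℝ) : ℝ := ∫ s in (0 : ℝ)..y, step s

lemma step_contDiff : ContDiff ℝ ∞ step :=
  Real.smoothTransition.contDiff.comp (contDiff_id.add contDiff_const)

lemma step_nonneg (y : ℝ) : 0 ≤ step y := Real.smoothTransition.nonneg _

lemma step_le_one (y : ℝ) : step y ≤ 1 := Real.smoothTransition.le_one _

lemma abs_step_le (y : ℝ) : |step y| ≤ 1 := by
  rw [abs_of_nonneg (step_nonneg y)]; exact step_le_one y

lemma step_of_le {y : ℝ} (h : y ≤ -1) : step y = 0 :=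
  Real.smoothTransition.zero_of_nonpos (by linarith)

lemma step_of_nonneg {y : ℝ} (h : 0 ≤ y) : step y = 1 :=
  Real.smoothTransition.one_of_one_le (by linarith)

lemma step_deriv_nonneg (y : ℝ) : 0 ≤ deriv step y := by
  have : Monotone step := fun a b h => Real.smoothTransition.monotone (by linarith)
  exact this.deriv_nonneg

lemma exists_step_deriv_le : ∃ L : ℝ, 0 < L ∧ ∀ y, deriv step y ≤ L := by
  have hc : HasCompactSupport (deriv step) := by
    apply HasCompactSupport.of_support_subset_isCompact (isCompact_Icc (a := (-1 : ℝ)) (b := 0))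
    intro y hy
    by_contra hn
    apply hy
    rw [mem_Icc, not_and_or, not_le, not_le] at hn
    rcases hn with h | h
    · have : step =ᶠ[𝓝 y] fun _ => 0 := by
        filter_upwards [Iio_mem_nhds h] with z hz using step_of_le (le_of_lt hz)
      rw [this.deriv_eq]; simp
    · have : step =ᶠ[𝓝 y] fun _ => 1 := by
        filter_upwards [Ioi_mem_nhds h] with z hz using step_of_nonneg (le_of_lt hz)
      rw [this.deriv_eq]; simp
  obtain ⟨L, hL⟩ := (step_contDiff.continuous_deriv (by simp)).bounded_above_of_compact_support hc
  exact ⟨max L 1, by positivity, fun y =>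
    (le_abs_self _).trans ((hL y).trans (le_max_left _ _))⟩

lemma abs_step_sub_le {L : ℝ} (hL : ∀ y, deriv step y ≤ L) (a b : ℝ) :
    |step a - step b| ≤ L * |a - b| := by
  have := Convex.norm_image_sub_le_of_norm_deriv_le (f := step) (C := L) (s := univ) (x := b)
    (y := a) (fun x _ => (step_contDiff.differentiable (by simp)).differentiableAt)
    (fun x _ => by rw [Real.norm_of_nonneg (step_deriv_nonneg x)]; exact hL x)
    convex_univ (mem_univ _) (mem_univ _)
  simpa using this

lemma stepPrim_deriv : deriv stepPrim = step := by
  ext y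
  exact (step_contDiff.continuous.integral_hasStrictDerivAt 0 y).hasDerivAt.deriv

lemma stepPrim_contDiff : ContDiff ℝ ∞ stepPrim := by
  rw [contDiff_infty_iff_deriv, stepPrim_deriv]
  exact ⟨fun y => (step_contDiff.continuous.integral_hasStrictDerivAt 0 y).hasDerivAt.differentiableAt,
    step_contDiff⟩

lemma abs_stepPrim_sub_le (a b : ℝ) : |stepPrim a - stepPrim b| ≤ |a - b| := by
  have := Convex.norm_image_sub_le_of_norm_deriv_le (f := stepPrim) (C := 1) (s := univ) (x := b)
    (y := a) (fun x _ => (stepPrim_contDiff.differentiable (by simp)).differentiableAt)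
    (fun x _ => by rw [stepPrim_deriv]; exact abs_step_le x)
    convex_univ (mem_univ _) (mem_univ _)
  simpa using this

lemma stepPrim_zero : stepPrim 0 = 0 := by simp [stepPrim]

lemma abs_stepPrim_le (a : ℝ) : |stepPrim a| ≤ |a| := by
  simpa [stepPrim_zero] using abs_stepPrim_sub_le a 0

lemma dirD_eT_mul {θ : ℝ → ℝ} {ζ : Plane → ℝ} (hθ : ContDiff ℝ ∞ θ) (hζ : ContDiff ℝ ∞ ζ)
    (z : ℝ × Plane) : dirD eT (fun z => θ z.1 * ζ z.2) z = deriv θ z.1 * ζ z.2 := by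
  rw [← deriv_slice (by fun_prop)]
  dsimp only
  rw [deriv_mul_const ((hθ.differentiable (by simp)).differentiableAt)]

lemma sum_dirD_eX_mul {θ : ℝ → ℝ} {ζ : Plane → ℝ} (hθ : ContDiff ℝ ∞ θ) (hζ : ContDiff ℝ ∞ ζ)
    (z : ℝ × Plane) : ∑ i, dirD (eX i) (dirD (eX i) fun z => θ z.1 * ζ z.2) z
      = θ z.1 * Laplacian.laplacian ζ z.2 := by
  rw [← laplacian_slice (by fun_prop)]
  exact InnerProductSpace.laplacian_smul (θ z.1) (contDiff_infty.1 hζ 2).contDiffAt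

/-! ### The truncated inequality for weak solutions -/

namespace IsWeakSolution

variable {T E : ℝ} {φ ψ : Plane → ℝ} {u v : ℝ → Plane → ℝ}

/-- Mollified weak solutions solve the mollified equation. -/
lemma mconv_equation (h : IsWeakSolution 2 T φ ψ u v) {K : Set (ℝ × Plane)}
    (hK : IsCompact K) (hKO : K ⊆ Ioo 0 T ×ˢ univ)
    (hu : Integrable (K.indicator fun z => u z.1 z.2))
    (hg : Integrable (K.indicator fun z => nonlin 2 (u z.1 z.2)))
    (n : ℕ) {z : ℝ × Plane} (hz : Metric.closedBall z (1 / ((n : ℝ) + 1)) ⊆ K) :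
    mconv volume (K.indicator fun z => u z.1 z.2) (dirD eT (moll volume n)) z
        = mconv volume (K.indicator fun z => v z.1 z.2) (moll volume n) z ∧
      mconv volume (K.indicator fun z => v z.1 z.2) (dirD eT (moll volume n)) z
        - ∑ i, mconv volume (K.indicator fun z => u z.1 z.2)
            (dirD (eX i) (dirD (eX i) (moll volume n))) z
        + mconv volume (K.indicator fun z => nonlin 2 (u z.1 z.2)) (moll volume n) z = 0 := by
  set k : ℝ × Plane → ℝ := moll volume n with hk
  have hks : ContDiff ℝ ∞ k := moll_contDiff n
  have hkc : HasCompactSupport k := moll_hasCompactSupport n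
  have hkt : tsupport k ⊆ Metric.closedBall 0 (1 / ((n : ℝ) + 1)) := (tsupport_moll n).le
  -- Kernels centred at `z` live inside `K`. Hence cutting off by the indicator of `K`, which makes
  -- the functions integrable on all of space-time, does not affect their mollification at `z`.
  have hoff : ∀ {κ : ℝ × Plane → ℝ}, tsupport κ ⊆ Metric.closedBall 0 (1 / ((n : ℝ) + 1)) →
      ∀ y ∉ K, κ (z - y) = 0 := by
    intro κ hκ y hy
    apply image_eq_zero_of_notMem_tsupport
    intro hn
    apply hy
    apply hz
    have := hκ hn
    rwa [mem_closedBall_zero_iff, norm_sub_rev, ← dist_eq_norm] at this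
  have htest : ∀ {κ : ℝ × Plane → ℝ}, ContDiff ℝ ∞ κ →
      tsupport κ ⊆ Metric.closedBall 0 (1 / ((n : ℝ) + 1)) →
      IsTestFunction T fun y => κ (z - y) := by
    intro κ hκ hκt
    have hs : Function.support (fun y => κ (z - y)) ⊆ K := fun y hy => by
      by_contra hn
      exact hy (hoff hκt y hn)
    exact ⟨hκ.comp (contDiff_const.sub contDiff_id),
      HasCompactSupport.of_support_subset_isCompact hK hs,
      (closure_minimal hs hK.isClosed).trans hKO⟩
  have hset : ∀ F : ℝ × Plane → ℝ, (∀ y ∉ K, F y = 0) →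
      ∫ y in Ioo 0 T ×ˢ univ, F y = ∫ y, F y := fun F hF =>
    setIntegral_eq_integral_of_forall_compl_eq_zero fun y hy => hF y fun hn => hy (hKO hn)
  have hconv : ∀ (F κ : ℝ × Plane → ℝ), tsupport κ ⊆ Metric.closedBall 0 (1 / ((n : ℝ) + 1)) →
      ∫ y in Ioo 0 T ×ˢ univ, F y * κ (z - y) = mconv volume (K.indicator F) κ z := by
    intro F κ hκ
    rw [hset _ fun y hy => by rw [hoff hκ y hy, mul_zero]]
    unfold mconv
    congr 1; ext y
    by_cases hy : y ∈ K
    · rw [indicator_of_mem hy]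
    · rw [hoff hκ y hy, mul_zero, mul_zero]
  have hdt : ∀ {κ : ℝ × Plane → ℝ}, ContDiff ℝ ∞ κ →
      tsupport κ ⊆ Metric.closedBall 0 (1 / ((n : ℝ) + 1)) →
      mconv volume (K.indicator fun z => u z.1 z.2) (dirD eT κ) z
        = mconv volume (K.indicator fun z => v z.1 z.2) κ z := by
    intro κ hκ hκt
    have h1 := h.time_deriv _ (htest hκ hκt)
    have h2 : ∀ y : ℝ × Plane, deriv (fun s => κ (z - (s, y.2))) y.1 = - dirD eT κ (z - y) :=
      fun y => (deriv_slice (htest hκ hκt).1 y).trans (dirD_comp_sub eT hκ z y)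
    simp_rw [h2, mul_neg] at h1
    rw [integral_neg, hconv (fun y => v y.1 y.2) κ hκt, hconv (fun y => u y.1 y.2) (dirD eT κ)
      ((tsupport_dirD_subset _ _).trans hκt)] at h1
    exact neg_injective h1
  have hkt1 : ∀ e, tsupport (dirD e k) ⊆ Metric.closedBall 0 (1 / ((n : ℝ) + 1)) := fun e =>
    (tsupport_dirD_subset _ _).trans hkt
  have hkt2 : ∀ e, tsupport (dirD e (dirD e k)) ⊆ Metric.closedBall 0 (1 / ((n : ℝ) + 1)) :=
    fun e => (tsupport_dirD_subset _ _).trans (hkt1 e)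
  refine ⟨hdt hks hkt, ?_⟩
  rw [← hdt (dirD_contDiff eT hks) (hkt1 eT)]
  have h1 := h.equation _ (htest hks hkt)
  have hD2 : ∀ e y, dirD e (dirD e fun y => k (z - y)) y = dirD e (dirD e k) (z - y) := by
    intro e y
    have : (dirD e fun y => k (z - y)) = fun y => -dirD e k (z - y) := by
      ext y; exact dirD_comp_sub e hks z y
    rw [this]
    have := dirD_comp_sub e (dirD_contDiff e hks) z y
    unfold dirD at this ⊢
    rw [fderiv_fun_neg]
    simp only [neg_apply, this, neg_neg]
  have h2 : ∀ y : ℝ × Plane, iteratedDeriv 2 (fun s => k (z - (s, y.2))) y.1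
      = dirD eT (dirD eT k) (z - y) := fun y =>
    (iteratedDeriv_slice (htest hks hkt).1 y).trans (hD2 _ _)
  have h3 : ∀ y : ℝ × Plane,
      Laplacian.laplacian (fun x : Plane => k (z - (y.1, x))) y.2
      = ∑ i, dirD (eX i) (dirD (eX i) k) (z - y) := fun y =>
    (laplacian_slice (htest hks hkt).1 y).trans (Finset.sum_congr rfl fun i _ => hD2 _ _)
  simp_rw [h2, h3] at h1
  rw [hset _ fun y hy => by
    rw [hoff (hkt2 _) y hy, hoff hkt y hy,
      Finset.sum_eq_zero fun i _ => hoff (hkt2 (eX i)) y hy]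
    ring] at h1
  have i1 : ∀ e, Integrable fun y => (K.indicator fun z => u z.1 z.2) y
      * dirD e (dirD e k) (z - y) := fun e =>
    mconv_integrable_integrand hu (dirD_contDiff _ (dirD_contDiff _ hks)).continuous
      (dirD_hasCompactSupport _ (dirD_hasCompactSupport _ hkc)) z
  have i2 := mconv_integrable_integrand hg hks.continuous hkc z
  have i3 := integrable_finsetSum (Finset.univ : Finset (Fin 2)) fun i _ => i1 (eX i)
  have i4 : Integrable fun y => (K.indicator fun z => u z.1 z.2) y * dirD eT (dirD eT k) (z - y)
      - ∑ i, (K.indicator fun z => u z.1 z.2) y * dirD (eX i) (dirD (eX i) k) (z - y) :=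
    (i1 eT).sub i3
  rw [← h1]
  unfold mconv
  rw [← integral_finsetSum _ fun i _ => i1 (eX i), ← integral_sub (i1 eT) i3,
    ← integral_add i4 i2]
  congr 1; ext y
  by_cases hy : y ∈ K
  · simp only [indicator_of_mem hy, mul_sub, Finset.mul_sum]
  · simp only [indicator_of_notMem hy, hoff (hkt2 _) y hy, hoff hkt y hy,
      mul_zero, Finset.sum_const_zero, sub_zero, add_zero]

/-- Testing the equation with an increasing bounded function of the solution. -/
theorem integral_nonlin_step_le (h : IsWeakSolution 2 T φ ψ u v)
    (hE : energy 2 φ ψ ≤ ENNReal.ofReal E) {θ : ℝ → ℝ} (hθ : IsTimeCutoff T θ)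
    {ζ : Plane → ℝ} (hζ : ContDiff ℝ ∞ ζ) (hζc : HasCompactSupport ζ) (hζ0 : ∀ x, 0 ≤ ζ x)
    {L : ℝ} (hL : ∀ y, deriv step y ≤ L) :
    Integrable (fun z : ℝ × Plane => nonlin 2 (u z.1 z.2) * (step (u z.1 z.2) * (θ z.1 * ζ z.2)))
      (slab T) ∧
    ∫ z, nonlin 2 (u z.1 z.2) * (step (u z.1 z.2) * (θ z.1 * ζ z.2)) ∂(slab T)
      ≤ L * (∫ z, v z.1 z.2 ^ 2 * (θ z.1 * ζ z.2) ∂(slab T))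
        + (∫ z, v z.1 z.2 * (step (u z.1 z.2) * (deriv θ z.1 * ζ z.2)) ∂(slab T))
        + ∫ z, stepPrim (u z.1 z.2) * (θ z.1 * Laplacian.laplacian ζ z.2) ∂(slab T) := by
  set w : ℝ × Plane → ℝ := fun z => θ z.1 * ζ z.2 with hwdef
  obtain ⟨hw, hwc, hwO⟩ : IsTestFunction T w :=
    isTestFunction_mul hθ.contDiff hθ.hasCompactSupport hθ.tsupport_subset hζ hζc
  have hw0 : ∀ z, 0 ≤ w z := fun z => mul_nonneg (hθ.nonneg _) (hζ0 _)
  -- The thickening leaves room around the support of `w` for mollification at radii below `δ`,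
  -- while staying inside the open slab.
  obtain ⟨δ, hδ, hδO⟩ := hwc.isCompact.exists_cthickening_subset_open
    (isOpen_Ioo.prod isOpen_univ) hwO
  set K := Metric.cthickening δ (tsupport w) with hKdef
  have hK : IsCompact K := hwc.isCompact.cthickening
  have hSK : tsupport w ⊆ K := Metric.self_subset_cthickening _
  have hKm : MeasurableSet K := hK.measurableSet
  have hKf : IsFiniteMeasure (volume.restrict K) := ⟨by simpa using hK.measure_lt_top⟩
  have hres : volume.restrict K ≤ slab T := Measure.restrict_mono hδO le_rfl
  set fu : ℝ × Plane → ℝ := K.indicator fun z => u z.1 z.2 with hfu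
  set fv : ℝ × Plane → ℝ := K.indicator fun z => v z.1 z.2 with hfv
  set fg : ℝ × Plane → ℝ := K.indicator fun z => nonlin 2 (u z.1 z.2) with hfg
  have hui : Integrable fu := (integrable_indicator_iff hKm).2
    (((h.memLp_slab_u hE).mono_measure hres).integrable (by norm_num))
  have hvi : Integrable fv := (integrable_indicator_iff hKm).2
    (((h.memLp_slab_v hE).mono_measure hres).integrable (by norm_num))
  have hv2i : Integrable fun z => fv z ^ 2 := by
    have : Integrable (K.indicator fun z => v z.1 z.2 ^ 2) := (integrable_indicator_iff hKm).2
      ((h.memLp_slab_v hE).mono_measure hres).integrable_sq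
    refine this.congr (Eventually.of_forall fun z => ?_)
    by_cases hz : z ∈ K <;> simp [hfv, hz]
  have hgi : Integrable fg := (integrable_indicator_iff hKm).2
    (h.nonlin_integrable.integrableOn_compact_subset hδO hK)
  set U : ℕ → ℝ × Plane → ℝ := fun n => mconv volume fu (moll volume n) with hU
  set V : ℕ → ℝ × Plane → ℝ := fun n => mconv volume fv (moll volume n) with hV
  set W : ℕ → ℝ × Plane → ℝ := fun n => mconv volume fg (moll volume n) with hW
  have hUs : ∀ n, ContDiff ℝ ∞ (U n) := fun n =>
    mconv_contDiff hui (moll_contDiff n) (moll_hasCompactSupport n)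
  have hVs : ∀ n, ContDiff ℝ ∞ (V n) := fun n =>
    mconv_contDiff hvi (moll_contDiff n) (moll_hasCompactSupport n)
  have hUi : ∀ n, Integrable (U n) := fun n => mconv_integrable hui (moll_integrable n)
  have hVi : ∀ n, Integrable (V n) := fun n => mconv_integrable hvi (moll_integrable n)
  have hWi : ∀ n, Integrable (W n) := fun n => mconv_integrable hgi (moll_integrable n)
  have hUl := ae_tendsto_mconv_moll hui
  set Dw := dirD eT w with hDw
  set Lw : ℝ × Plane → ℝ := fun z => ∑ i, dirD (eX i) (dirD (eX i) w) z with hLw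
  have hDwc : Continuous Dw := (dirD_contDiff eT hw).continuous
  have hLwc : Continuous Lw := continuous_finsetSum _ fun i _ =>
    (dirD_contDiff (eX i) (dirD_contDiff (eX i) hw)).continuous
  have hDwt : tsupport Dw ⊆ tsupport w := tsupport_dirD_subset _ _
  have hDw0 : ∀ z ∉ tsupport w, Dw z = 0 := fun z hz =>
    image_eq_zero_of_notMem_tsupport fun hn => hz (hDwt hn)
  have hLw0 : ∀ z ∉ tsupport w, Lw z = 0 := fun z hz => Finset.sum_eq_zero fun i _ =>
    image_eq_zero_of_notMem_tsupport fun hn =>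
      hz ((tsupport_dirD_subset _ _).trans (tsupport_dirD_subset _ _) hn)
  have hw00 : ∀ z ∉ tsupport w, w z = 0 := fun z hz => image_eq_zero_of_notMem_tsupport hz
  obtain ⟨B, hB⟩ := hw.continuous.bounded_above_of_compact_support hwc
  obtain ⟨B₁, hB₁⟩ := hDwc.bounded_above_of_compact_support (dirD_hasCompactSupport eT hwc)
  obtain ⟨B₂, hB₂⟩ := hLwc.bounded_above_of_compact_support
    (HasCompactSupport.of_support_subset_isCompact hwc.isCompact fun z hz => by
      by_contra hn
      exact hz (hLw0 z hn))
  have ineq : ∀ᶠ n in atTop, ∫ z, W n z * (step (U n z) * w z)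
      ≤ L * (∫ z, mconv volume (fun z => fv z ^ 2) (moll volume n) z * w z)
        + (∫ z, V n z * (step (U n z) * Dw z)) + ∫ z, stepPrim (U n z) * Lw z := by
    have hev : ∀ᶠ n : ℕ in atTop, 1 / ((n : ℝ) + 1) < δ :=
      (tendsto_one_div_add_atTop_nhds_zero_nat (𝕜 := ℝ)).eventually (Iio_mem_nhds hδ)
    filter_upwards [hev] with n hn
    have hball : ∀ z, w z ≠ 0 → Metric.closedBall z (1 / ((n : ℝ) + 1)) ⊆ K := fun z hz =>
      (Metric.closedBall_subset_closedBall hn.le).trans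
        (Metric.closedBall_subset_cthickening (subset_tsupport _ hz) δ)
    have hks := moll_contDiff (μ := (volume : Measure (ℝ × Plane))) n
    have hkc := moll_hasCompactSupport (μ := (volume : Measure (ℝ × Plane))) n
    have key := integral_mul_comp_le (W := W n) (hUs n) (hVs n) hw hwc hw0 step_contDiff
      stepPrim_contDiff stepPrim_deriv step_deriv_nonneg
      (fun z hz => by
        rw [hU]; simp only
        rw [dirD_mconv hui hks hkc]
        exact (h.mconv_equation hK hδO hui hgi n (hball z hz)).1)
      (fun z hz => by
        have := (h.mconv_equation hK hδO hui hgi n (hball z hz)).2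
        rw [hU, hV]; simp only
        rw [dirD_mconv hvi hks hkc]
        simp_rw [dirD_mconv hui hks hkc]
        simp_rw [dirD_mconv hui (dirD_contDiff _ hks) (dirD_hasCompactSupport _ hkc)]
        exact this)
    -- The limit of `c'(Uₙ) Vₙ²` itself is not needed. By Jensen it is at most `L` times the
    -- mollification of `v²`, which converges in `L¹`.
    refine key.trans ?_
    gcongr
    rw [← integral_const_mul]
    apply integral_mono_of_nonneg
    · exact Eventually.of_forall fun z => mul_nonneg (sq_nonneg _)
        (mul_nonneg (step_deriv_nonneg _) (hw0 z))
    · exact ((mconv_integrable hv2i (moll_integrable n)).mul_bdd (c := B)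
        hw.continuous.aestronglyMeasurable (Eventually.of_forall hB)).const_mul L
    · refine Eventually.of_forall fun z => ?_
      have e1 := mconv_sq_le hvi hv2i n z
      have e2 := mul_le_mul_of_nonneg_right (hL (U n z)) (hw0 z)
      calc V n z ^ 2 * (deriv step (U n z) * w z)
          ≤ mconv volume (fun z => fv z ^ 2) (moll volume n) z * (L * w z) :=
            mul_le_mul e1 e2 (mul_nonneg (step_deriv_nonneg _) (hw0 z))
              ((sq_nonneg _).trans e1)
        _ = L * (mconv volume (fun z => fv z ^ 2) (moll volume n) z * w z) := by ring
  have hstepm : ∀ n, AEStronglyMeasurable (fun z => step (U n z)) := fun n =>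
    (step_contDiff.continuous.comp (hUs n).continuous).aestronglyMeasurable
  have hstepl : ∀ᵐ z, Tendsto (fun n => step (U n z)) atTop (𝓝 (step (fu z))) := by
    filter_upwards [hUl] with z hz
    exact (step_contDiff.continuous.tendsto _).comp hz
  have hbd : ∀ {b : ℝ × Plane → ℝ} {B : ℝ}, (∀ z, ‖b z‖ ≤ B) → ∀ n z,
      |step (U n z) * b z| ≤ B := fun hb n z => by
    rw [abs_mul]
    exact (mul_le_of_le_one_left (abs_nonneg _) (abs_step_le _)).trans (hb z)
  have l1 : Tendsto (fun n => ∫ z, W n z * (step (U n z) * w z)) atTop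
      (𝓝 (∫ z, fg z * (step (fu z) * w z))) :=
    tendsto_integral_mul hWi hgi (tendsto_integral_abs_mconv_sub hgi)
      (fun n => (hstepm n).mul hw.continuous.aestronglyMeasurable) (hbd hB)
      (hstepl.mono fun z hz => hz.mul_const _)
  have l2 : Tendsto (fun n => ∫ z, mconv volume (fun z => fv z ^ 2) (moll volume n) z * w z) atTop
      (𝓝 (∫ z, fv z ^ 2 * w z)) :=
    tendsto_integral_mul (fun n => mconv_integrable hv2i (moll_integrable n)) hv2i
      (tendsto_integral_abs_mconv_sub hv2i)
      (fun n => hw.continuous.aestronglyMeasurable) (fun _ => hB)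
      (Eventually.of_forall fun z => tendsto_const_nhds)
  have l3 : Tendsto (fun n => ∫ z, V n z * (step (U n z) * Dw z)) atTop
      (𝓝 (∫ z, fv z * (step (fu z) * Dw z))) :=
    tendsto_integral_mul hVi hvi (tendsto_integral_abs_mconv_sub hvi)
      (fun n => (hstepm n).mul hDwc.aestronglyMeasurable) (hbd hB₁)
      (hstepl.mono fun z hz => hz.mul_const _)
  have hCm : Continuous stepPrim := stepPrim_contDiff.continuous
  have hCi : ∀ {f : ℝ × Plane → ℝ}, Integrable f → Integrable fun z => stepPrim (f z) :=
    fun hf => hf.mono (hCm.comp_aestronglyMeasurable hf.1)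
      (Eventually.of_forall fun z => abs_stepPrim_le _)
  have l4 : Tendsto (fun n => ∫ z, stepPrim (U n z) * Lw z) atTop
      (𝓝 (∫ z, stepPrim (fu z) * Lw z)) := by
    apply tendsto_integral_mul (fun n => hCi (hUi n)) (hCi hui) _
      (fun n => hLwc.aestronglyMeasurable) (fun _ => hB₂)
      (Eventually.of_forall fun z => tendsto_const_nhds)
    -- The primitive of the step is Lipschitz with constant one, so `L¹` convergence of `Uₙ` carries
    -- over.
    refine squeeze_zero (fun n => integral_nonneg fun z => abs_nonneg _) (fun n => ?_)
      (tendsto_integral_abs_mconv_sub hui)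
    exact integral_mono ((hCi (hUi n)).sub (hCi hui)).abs ((hUi n).sub hui).abs
      fun z => abs_stepPrim_sub_le _ _
  have lim := le_of_tendsto_of_tendsto l1 (((l2.const_mul L).add l3).add l4) ineq
  have htr : ∀ F F' : ℝ × Plane → ℝ, (∀ z ∉ tsupport w, F z = 0) → (∀ z ∉ tsupport w, F' z = 0) →
      (∀ z ∈ K, F z = F' z) → ∫ z, F z = ∫ z, F' z ∂(slab T) := by
    intro F F' hF hF' hFF'
    have : ∫ z, F' z ∂(slab T) = ∫ z, F' z :=
      setIntegral_eq_integral_of_forall_compl_eq_zero fun z hz => hF' z fun hn => hz (hwO hn)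
    rw [this]
    congr 1; ext z
    by_cases hz : z ∈ K
    · exact hFF' z hz
    · rw [hF z fun hn => hz (hSK hn), hF' z fun hn => hz (hSK hn)]
  have hDweq : ∀ z, Dw z = deriv θ z.1 * ζ z.2 := dirD_eT_mul hθ.contDiff hζ
  have hLweq : ∀ z, Lw z = θ z.1 * Laplacian.laplacian ζ z.2 := sum_dirD_eX_mul hθ.contDiff hζ
  constructor
  · have i0 : Integrable fun z => fg z * (step (fu z) * w z) :=
      hgi.mul_bdd (c := B) ((step_contDiff.continuous.comp_aestronglyMeasurable hui.1).mul
        hw.continuous.aestronglyMeasurable) (Eventually.of_forall fun z => by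
          rw [norm_mul]
          exact (mul_le_of_le_one_left (norm_nonneg _) (abs_step_le _)).trans (hB z))
    refine (i0.congr (Eventually.of_forall fun z => ?_)).integrableOn
    by_cases hz : z ∈ K
    · simp only [hfg, hfu, indicator_of_mem hz, hwdef]
    · have : θ z.1 * ζ z.2 = 0 := hw00 z fun hn => hz (hSK hn)
      simp only [hwdef, this, mul_zero]
  · rw [htr _ (fun z => nonlin 2 (u z.1 z.2) * (step (u z.1 z.2) * w z))
        (fun z hz => by rw [hw00 z hz]; ring) (fun z hz => by rw [hw00 z hz]; ring)
        (fun z hz => by simp only [hfg, hfu, indicator_of_mem hz]),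
      htr _ (fun z => v z.1 z.2 ^ 2 * w z)
        (fun z hz => by rw [hw00 z hz]; ring) (fun z hz => by rw [hw00 z hz]; ring)
        (fun z hz => by simp only [hfv, indicator_of_mem hz]),
      htr _ (fun z => v z.1 z.2 * (step (u z.1 z.2) * Dw z))
        (fun z hz => by rw [hDw0 z hz]; ring) (fun z hz => by rw [hDw0 z hz]; ring)
        (fun z hz => by simp only [hfv, hfu, indicator_of_mem hz]),
      htr _ (fun z => stepPrim (u z.1 z.2) * Lw z)
        (fun z hz => by rw [hLw0 z hz]; ring) (fun z hz => by rw [hLw0 z hz]; ring)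
        (fun z hz => by simp only [hfu, indicator_of_mem hz])] at lim
    simp_rw [hDweq, hLweq] at lim
    exact lim

end IsWeakSolution

/-! ### Lower bound for the velocity where the data are constant and large -/

lemma integral_abs_mul_abs_le_l2 {α : Type*} [MeasurableSpace α] {μ : Measure α} {f g : α → ℝ}
    (hf : MemLp f 2 μ) (hg : MemLp g 2 μ) :
    ∫ x, |f x| * |g x| ∂μ ≤ l2 μ f * l2 μ g := by
  have h := abs_integral_mul_le_l2 hf.abs hg.abs
  have e : ∀ f : α → ℝ, l2 μ |f| = l2 μ f := fun f => by
    unfold l2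
    rw [← eLpNorm_norm f]
    rfl
  rw [e, e] at h
  exact (le_abs_self _).trans h

/-- Fubini for an upper bound of an integral over the slab. -/
lemma integral_slab_le {T M : ℝ} {H : ℝ × Plane → ℝ} (hH : Integrable H (slab T)) {θ : ℝ → ℝ}
    (hθ : Integrable θ) (hθ0 : ∀ τ, 0 ≤ θ τ) (hM : 0 ≤ M)
    (h : ∀ τ ∈ Ioo 0 T, ∫ x, H (τ, x) ≤ θ τ * M) : ∫ z, H z ∂(slab T) ≤ M * ∫ τ, θ τ := by
  rw [slab_eq_prod] at hH ⊢
  rw [integral_prod _ hH, ← integral_const_mul]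
  have h1 : ∫ τ in Ioo 0 T, ∫ x, H (τ, x) ≤ ∫ τ in Ioo 0 T, M * θ τ :=
    setIntegral_mono_on hH.integral_prod_left (hθ.const_mul M).integrableOn measurableSet_Ioo
      fun τ hτ => (h τ hτ).trans (mul_comm _ _).le
  exact h1.trans (setIntegral_le_integral (hθ.const_mul M)
    (Eventually.of_forall fun τ => mul_nonneg hM (hθ0 τ)))

/-- The nonlinearity is bounded from below by a concave parabola near a large value. -/
lemma nonlin_mul_step_ge {a : ℝ} (ha : 1 ≤ a) (y : ℝ) :
    nonlin 2 (a - 1 / a) * (1 - a ^ 2 * (y - a) ^ 2) - Real.exp (4 * Real.pi)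
      ≤ nonlin 2 y * step y := by
  have ha0 : 0 < a := by linarith
  have hb : 0 ≤ a - 1 / a := by
    rw [sub_nonneg, div_le_iff₀ ha0]; nlinarith
  have hG : 0 ≤ nonlin 2 (a - 1 / a) := by
    rw [nonlin_two]; positivity
  have hK := Real.exp_pos (4 * Real.pi)
  -- Within `1/a` of `a` the nonlinearity is at least its value at `a - 1/a`, by monotonicity.
  -- Farther away the parabola is nonpositive, and it is enough that the truncated nonlinearity is
  -- at least `-exp (4π)`: it can be negative only for `-1 < y < 0`.
  rcases lt_or_ge (|y - a|) (1 / a) with h | h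
  · have hy : a - 1 / a ≤ y := by linarith [(abs_lt.1 h).1]
    rw [step_of_nonneg (hb.trans hy), mul_one]
    have h1 : nonlin 2 (a - 1 / a) ≤ nonlin 2 y := by
      have hy0 := hb.trans hy
      rw [nonlin_two, nonlin_two]
      gcongr
    have h2 : 0 ≤ a ^ 2 * (y - a) ^ 2 := by positivity
    nlinarith
  · have h1 : 1 ≤ a ^ 2 * (y - a) ^ 2 := by
      have : 1 ≤ a * |y - a| := by
        rw [div_le_iff₀ ha0] at h; linarith
      rw [← sq_abs (y - a), ← mul_pow]
      exact one_le_pow₀ this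
    have h2 : nonlin 2 (a - 1 / a) * (1 - a ^ 2 * (y - a) ^ 2) ≤ 0 :=
      mul_nonpos_of_nonneg_of_nonpos hG (by linarith)
    have h3 : - Real.exp (4 * Real.pi) ≤ nonlin 2 y * step y := by
      rw [nonlin_two]
      rcases le_total 0 y with hy | hy
      · have : 0 ≤ y * Real.exp (4 * Real.pi * y ^ 2) * step y :=
          mul_nonneg (by positivity) (step_nonneg y)
        linarith
      rcases le_total y (-1) with hy1 | hy1
      · rw [step_of_le hy1]; linarith
      · have e1 : Real.exp (4 * Real.pi * y ^ 2) ≤ Real.exp (4 * Real.pi) := by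
          apply Real.exp_le_exp.2
          have : y ^ 2 ≤ 1 := by nlinarith
          nlinarith [Real.pi_pos]
        have e2 : -y * Real.exp (4 * Real.pi * y ^ 2) ≤ 1 * Real.exp (4 * Real.pi) :=
          mul_le_mul (by linarith) e1 (Real.exp_pos _).le zero_le_one
        have e3 : -y * Real.exp (4 * Real.pi * y ^ 2) * step y
            ≤ -y * Real.exp (4 * Real.pi * y ^ 2) :=
          mul_le_of_le_one_right (mul_nonneg (by linarith) (Real.exp_pos _).le) (step_le_one y)
        linarith
    linarith

lemma memLp_two_slab_snd {T : ℝ} {f : Plane → ℝ} (hf : MemLp f 2 volume) :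
    MemLp (fun z : ℝ × Plane => f z.2) 2 (slab T) := by
  apply memLp_slab (E := (∫⁻ x, ‖f x‖ₑ ^ 2).toReal) (f := fun _ => f)
  · rw [slab_eq_prod]
    exact hf.1.comp_snd
  · intro t _
    have := (eLpNorm_lt_top_iff_lintegral_rpow_enorm_lt_top (by norm_num) (by norm_num)).1 hf.2
    rw [ENNReal.ofReal_toReal]
    simpa using this.ne

lemma laplacian_eq_sum_dirD {ζ : Plane → ℝ} (hζ : ContDiff ℝ ∞ ζ) : Laplacian.laplacian ζ =
    fun x => ∑ i : Fin 2, dirD (EuclideanSpace.single i 1) (dirD (EuclideanSpace.single i 1) ζ) x :=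
  funext fun x => laplacian_eq_sum_fderiv hζ x

lemma laplacian_memLp {ζ : Plane → ℝ} (hζ : ContDiff ℝ ∞ ζ) (hζc : HasCompactSupport ζ) :
    MemLp (Laplacian.laplacian ζ) 2 volume := by
  rw [laplacian_eq_sum_dirD hζ]
  apply memLp_finsetSum
  intro i _
  have h1 : Continuous (dirD (EuclideanSpace.single i (1 : ℝ))
      (dirD (EuclideanSpace.single i (1 : ℝ)) ζ)) := (dirD_contDiff _ (dirD_contDiff _ hζ)).continuous
  exact h1.memLp_of_hasCompactSupport (dirD_hasCompactSupport _ (dirD_hasCompactSupport _ hζc))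

namespace IsWeakSolution

variable {T E : ℝ} {φ ψ : Plane → ℝ} {u v : ℝ → Plane → ℝ}

/-- Since `|stepPrim y| ≤ |y|`, the term with the Laplacian on the test function costs only the `L²`
norm of `u`, that is, the energy. -/
lemma stepPrim_term (h : IsWeakSolution 2 T φ ψ u v)
    (hE : energy 2 φ ψ ≤ ENNReal.ofReal E) (hE0 : 0 ≤ E) {θ : ℝ → ℝ} (hθ : IsTimeCutoff T θ)
    {g : Plane → ℝ} (hg : MemLp g 2 volume) :
    Integrable (fun z : ℝ × Plane => stepPrim (u z.1 z.2) * (θ z.1 * g z.2)) (slab T) ∧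
    ∫ z, stepPrim (u z.1 z.2) * (θ z.1 * g z.2) ∂(slab T)
      ≤ √E * l2 volume g * ∫ τ, θ τ := by
  have hu := h.memLp_slab_u hE
  have hθi : Integrable θ :=
    hθ.contDiff.continuous.integrable_of_hasCompactSupport hθ.hasCompactSupport
  have hCu : MemLp (fun z : ℝ × Plane => stepPrim (u z.1 z.2)) 2 (slab T) :=
    hu.mono (stepPrim_contDiff.continuous.comp_aestronglyMeasurable hu.1)
      (Eventually.of_forall fun z => abs_stepPrim_le _)
  have i3 : Integrable (fun z : ℝ × Plane =>
      stepPrim (u z.1 z.2) * (θ z.1 * g z.2)) (slab T) := by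
    have := (hCu.integrable_mul (memLp_two_slab_snd hg)).mul_bdd (c := 1)
      (g := fun z : ℝ × Plane => θ z.1)
      (hθ.contDiff.continuous.comp continuous_fst).aestronglyMeasurable
      (Eventually.of_forall fun z => by
        rw [Real.norm_of_nonneg (hθ.nonneg _)]; exact hθ.le_one _)
    refine this.congr (Eventually.of_forall fun z => ?_)
    simp only [Pi.mul_apply]
    ring
  refine ⟨i3, ?_⟩
  · apply integral_slab_le i3 hθi hθ.nonneg (mul_nonneg (Real.sqrt_nonneg _) (l2_nonneg _))
    intro τ hτ
    have hτ' := Ioo_subset_Ico_self hτ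
    have hm := h.memLp_u τ hτ'
    have e1 := integral_abs_mul_abs_le_l2 hm hg
    have e2 := mul_le_mul_of_nonneg_right (h.l2_u_le hE hE0 hτ')
      (l2_nonneg (μ := volume) (g))
    refine le_trans ?_ (mul_le_mul_of_nonneg_left (e1.trans e2) (hθ.nonneg τ))
    rw [← integral_const_mul]
    have hCm : MemLp (fun x => stepPrim (u τ x)) 2 volume :=
      hm.mono (stepPrim_contDiff.continuous.comp_aestronglyMeasurable hm.1)
        (Eventually.of_forall fun x => abs_stepPrim_le _)
    have j1 : Integrable fun x => stepPrim (u τ x) * (θ τ * g x) :=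
      hCm.integrable_mul (hg.const_mul (θ τ))
    apply integral_mono j1 ((hm.abs.integrable_mul hg.abs).const_mul _)
    intro x
    simp only [Pi.mul_apply, Pi.abs_apply]
    calc stepPrim (u τ x) * (θ τ * g x)
        ≤ |stepPrim (u τ x) * (θ τ * g x)| := le_abs_self _
      _ = θ τ * (|stepPrim (u τ x)| * |g x|) := by
          rw [abs_mul, abs_mul, abs_of_nonneg (hθ.nonneg τ)]; ring
      _ ≤ θ τ * (|u τ x| * |g x|) := by
          exact mul_le_mul_of_nonneg_left (mul_le_mul_of_nonneg_right (abs_stepPrim_le _)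
            (abs_nonneg _)) (hθ.nonneg τ)

-- This has the form required by `le_sub_of_forall_timeCutoff` for the pairing of `v` with `ζ`. On
-- the support of `ζ` the datum is `a ≥ 1`, where the step equals one, so `v step(u) = v + v
-- (step(u) - step(φ))`. The second term is estimated by the Lipschitz bound for the step and `‖u -
-- φ‖ ≤ T√E`, which gives the variation error `L T E`. The same deviation bound, squared, is the
-- price `T² E` of the parabola; the kinetic term costs `L E`.
set_option maxHeartbeats 1000000 in
lemma timeCutoff_inequality (h : IsWeakSolution 2 T φ ψ u v)
    (hE : energy 2 φ ψ ≤ ENNReal.ofReal E) (hE0 : 0 ≤ E) {θ : ℝ → ℝ} (hθ : IsTimeCutoff T θ)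
    {ζ : Plane → ℝ} (hζ : ContDiff ℝ ∞ ζ) (hζc : HasCompactSupport ζ) (hζ0 : ∀ x, 0 ≤ ζ x)
    (hζ1 : ∀ x, ζ x ≤ 1) {L : ℝ} (hL0 : 0 ≤ L) (hL : ∀ y, deriv step y ≤ L) {a : ℝ} (ha : 1 ≤ a)
    (hφ : ∀ x, ζ x ≠ 0 → φ x = a) :
    ((nonlin 2 (a - 1 / a) - Real.exp (4 * Real.pi)) * (∫ x, ζ x)
      - nonlin 2 (a - 1 / a) * a ^ 2 * (T ^ 2 * E) - L * E
      - √E * l2 volume (Laplacian.laplacian ζ)) * ∫ τ, θ τ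
      ≤ (∫ τ, (∫ x, v τ x * ζ x) * deriv θ τ) + L * T * E * ∫ τ, |deriv θ τ| := by
  obtain ⟨hint, hmain⟩ := h.integral_nonlin_step_le hE hθ hζ hζc hζ0 hL
  set G₀ := nonlin 2 (a - 1 / a) with hG₀
  set K := Real.exp (4 * Real.pi) with hK
  have ha0 : 0 < a := by linarith
  have hG₀0 : 0 ≤ G₀ := by
    have hb : 0 ≤ a - 1 / a := by
      rw [sub_nonneg, div_le_iff₀ ha0]; nlinarith
    rw [hG₀, nonlin_two]; positivity
  have hθi : Integrable θ :=
    hθ.contDiff.continuous.integrable_of_hasCompactSupport hθ.hasCompactSupport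
  have hθ'c : Continuous (deriv θ) := hθ.contDiff.continuous_deriv (by simp)
  have hθ'i : Integrable (deriv θ) :=
    hθ'c.integrable_of_hasCompactSupport hθ.hasCompactSupport.deriv
  have hθ't : tsupport (deriv θ) ⊆ Ioo 0 T := tsupport_deriv_subset.trans hθ.tsupport_subset
  have hζm : MemLp ζ 2 volume := hζ.continuous.memLp_of_hasCompactSupport hζc
  have hu := h.memLp_slab_u hE
  have hv := h.memLp_slab_v hE
  have hφs := memLp_two_slab_snd (T := T) h.finite_energy.1
  have hsq : ∀ {f : Plane → ℝ}, MemLp f 2 volume → ∀ {τ : ℝ}, ∫ x, f x ^ 2 * (θ τ * ζ x)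
      ≤ θ τ * (∫ x, f x ^ 2) := by
    intro f hf τ
    rw [← integral_const_mul]
    apply integral_mono_of_nonneg
      (Eventually.of_forall fun x => mul_nonneg (sq_nonneg _) (mul_nonneg (hθ.nonneg _) (hζ0 _)))
      (hf.integrable_sq.const_mul _)
    refine Eventually.of_forall fun x => ?_
    have := mul_le_mul_of_nonneg_left (hζ1 x) (mul_nonneg (hθ.nonneg τ) (sq_nonneg (f x)))
    dsimp only
    linarith
  have hwb : ∀ z : ℝ × Plane, ‖θ z.1 * ζ z.2‖ ≤ 1 := fun z => by
    rw [Real.norm_of_nonneg (mul_nonneg (hθ.nonneg _) (hζ0 _))]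
    exact mul_le_one₀ (hθ.le_one _) (hζ0 _) (hζ1 _)
  have hwm : ∀ {μ : Measure (ℝ × Plane)},
      AEStronglyMeasurable (fun z : ℝ × Plane => θ z.1 * ζ z.2) μ := fun {μ} =>
    ((hθ.contDiff.continuous.comp continuous_fst).mul
      (hζ.continuous.comp continuous_snd)).aestronglyMeasurable
  -- the kinetic term
  have b1 : ∫ z, v z.1 z.2 ^ 2 * (θ z.1 * ζ z.2) ∂(slab T) ≤ E * ∫ τ, θ τ := by
    apply integral_slab_le (hv.integrable_sq.mul_bdd (c := 1) hwm (Eventually.of_forall hwb))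
      hθi hθ.nonneg hE0
    intro τ hτ
    have hτ' := Ioo_subset_Ico_self hτ
    refine (hsq (h.memLp_v τ hτ')).trans (mul_le_mul_of_nonneg_left ?_ (hθ.nonneg τ))
    have := (l2_le_iff (h.memLp_v τ hτ') (Real.sqrt_nonneg E)).1 (h.l2_v_le hE hE0 hτ')
    rwa [Real.sq_sqrt hE0] at this
  -- the deviation from the data
  have hud := hu.sub hφs
  have i2 : Integrable (fun z : ℝ × Plane => (u z.1 z.2 - φ z.2) ^ 2 * (θ z.1 * ζ z.2)) (slab T) :=
    hud.integrable_sq.mul_bdd (c := 1) hwm (Eventually.of_forall hwb)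
  have b2 : ∫ z, (u z.1 z.2 - φ z.2) ^ 2 * (θ z.1 * ζ z.2) ∂(slab T) ≤ T ^ 2 * E * ∫ τ, θ τ := by
    apply integral_slab_le i2 hθi hθ.nonneg (by positivity)
    intro τ hτ
    have hτ' := Ioo_subset_Ico_self hτ
    have hm := (h.memLp_u τ hτ').sub h.finite_energy.1
    refine (hsq hm).trans (mul_le_mul_of_nonneg_left ?_ (hθ.nonneg τ))
    have := (l2_le_iff hm (mul_nonneg hτ.1.le (Real.sqrt_nonneg E))).1 (h.l2_u_sub_le hE hE0 hτ)
    rw [mul_pow, Real.sq_sqrt hE0] at this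
    refine this.trans (mul_le_mul_of_nonneg_right ?_ hE0)
    exact pow_le_pow_left₀ hτ.1.le hτ.2.le 2
  -- the Laplacian term
  have hlapm : MemLp (Laplacian.laplacian ζ) 2 volume :=
    laplacian_memLp hζ hζc
  obtain ⟨i3, b3⟩ := h.stepPrim_term hE hE0 hθ hlapm
  -- the term with the time derivative of the cutoff
  obtain ⟨D, hD⟩ := hθ'c.bounded_above_of_compact_support hθ.hasCompactSupport.deriv
  have hw'm : AEStronglyMeasurable (fun z : ℝ × Plane => deriv θ z.1 * ζ z.2) (slab T) :=
    ((hθ'c.comp continuous_fst).mul (hζ.continuous.comp continuous_snd)).aestronglyMeasurable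
  have hw'b : ∀ z : ℝ × Plane, ‖deriv θ z.1 * ζ z.2‖ ≤ D := fun z => by
    rw [norm_mul, Real.norm_of_nonneg (hζ0 _)]
    exact (mul_le_of_le_one_right (norm_nonneg _) (hζ1 _)).trans (hD _)
  have hdiff : ∀ (τ : ℝ) (x : Plane), |step (u τ x) - step (φ x)| ≤ L * |u τ x - φ x| :=
    fun τ x => abs_step_sub_le hL _ _
  have hsm : AEStronglyMeasurable (fun z : ℝ × Plane => step (u z.1 z.2) - step (φ z.2)) (slab T) :=
    (step_contDiff.continuous.comp_aestronglyMeasurable hu.1).sub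
      (step_contDiff.continuous.comp_aestronglyMeasurable hφs.1)
  have hsd : MemLp (fun z : ℝ × Plane => step (u z.1 z.2) - step (φ z.2)) 2 (slab T) :=
    MemLp.mono (hud.const_mul L) hsm (Eventually.of_forall fun z => by
      rw [Real.norm_eq_abs, Real.norm_eq_abs, abs_mul, abs_of_nonneg hL0]
      exact hdiff _ _)
  have i4 : Integrable (fun z : ℝ × Plane =>
      v z.1 z.2 * (step (u z.1 z.2) - step (φ z.2)) * (deriv θ z.1 * ζ z.2)) (slab T) :=
    (hv.integrable_mul hsd).mul_bdd (c := D) hw'm (Eventually.of_forall hw'b)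
  have i5 : Integrable (fun z : ℝ × Plane => v z.1 z.2 * (deriv θ z.1 * ζ z.2)) (slab T) := by
    have : MemLp (fun z : ℝ × Plane => deriv θ z.1 * ζ z.2) 2 (slab T) :=
      MemLp.mono ((memLp_two_slab_snd (T := T) hζm).const_mul D) hw'm
        (Eventually.of_forall fun z => by
          rw [norm_mul, norm_mul]
          gcongr
          exact (hD _).trans (le_abs_self _))
    exact hv.integrable_mul this
  have b4 : ∫ z, v z.1 z.2 * (step (u z.1 z.2) - step (φ z.2)) * (deriv θ z.1 * ζ z.2) ∂(slab T)
      ≤ L * T * E * ∫ τ, |deriv θ τ| := by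
    -- If `T ≤ 0` there are no times in the slab and `θ'` vanishes; otherwise the claimed bound is
    -- nonnegative.
    by_cases hT : T ≤ 0
    · have h0 : deriv θ = 0 := by
        ext τ
        apply image_eq_zero_of_notMem_tsupport
        intro hn
        have := hθ't hn
        linarith [this.1, this.2]
      simp [h0]
    push Not at hT
    apply integral_slab_le i4 hθ'i.abs (fun τ => abs_nonneg _) (by positivity)
    intro τ hτ
    have hτ' := Ioo_subset_Ico_self hτ
    have hm := (h.memLp_u τ hτ').sub h.finite_energy.1
    have hvm := h.memLp_v τ hτ'
    have e1 := integral_abs_mul_abs_le_l2 hvm hm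
    have e2 : l2 volume (v τ) * l2 volume (u τ - φ) ≤ T * E := by
      calc l2 volume (v τ) * l2 volume (u τ - φ) ≤ √E * (τ * √E) :=
            mul_le_mul (h.l2_v_le hE hE0 hτ') (h.l2_u_sub_le hE hE0 hτ) (l2_nonneg _)
              (Real.sqrt_nonneg _)
        _ = τ * (√E * √E) := by ring
        _ ≤ T * E := by
            rw [Real.mul_self_sqrt hE0]
            exact mul_le_mul_of_nonneg_right hτ.2.le hE0
    have hb : |deriv θ τ| * (L * T * E) = |deriv θ τ| * L * (T * E) := by ring
    rw [hb]
    refine le_trans ?_ (mul_le_mul_of_nonneg_left (e1.trans e2)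
      (mul_nonneg (abs_nonneg (deriv θ τ)) hL0))
    rw [← integral_const_mul]
    -- A slice that is not integrable has integral zero by convention, which is below the
    -- nonnegative bound.
    by_cases hi : Integrable (fun x => v τ x * (step (u τ x) - step (φ x)) * (deriv θ τ * ζ x))
    swap
    · rw [integral_undef hi]
      exact integral_nonneg fun x => by positivity
    apply integral_mono hi ((hvm.abs.integrable_mul hm.abs).const_mul _)
    intro x
    simp only [Pi.mul_apply, Pi.abs_apply, Pi.sub_apply]
    calc v τ x * (step (u τ x) - step (φ x)) * (deriv θ τ * ζ x)
        ≤ |v τ x * (step (u τ x) - step (φ x)) * (deriv θ τ * ζ x)| := le_abs_self _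
      _ = |v τ x| * |step (u τ x) - step (φ x)| * (|deriv θ τ| * ζ x) := by
          rw [abs_mul, abs_mul, abs_mul, abs_of_nonneg (hζ0 x)]
      _ ≤ |v τ x| * (L * |u τ x - φ x|) * (|deriv θ τ| * 1) := by
          have := hζ0 x
          have := hζ1 x
          have := hdiff τ x
          gcongr
      _ = |deriv θ τ| * L * (|v τ x| * |u τ x - φ x|) := by ring
  have e4 : ∫ z, v z.1 z.2 * (step (u z.1 z.2) * (deriv θ z.1 * ζ z.2)) ∂(slab T)
      = (∫ τ, (∫ x, v τ x * ζ x) * deriv θ τ)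
        + ∫ z, v z.1 z.2 * (step (u z.1 z.2) - step (φ z.2)) * (deriv θ z.1 * ζ z.2) ∂(slab T) := by
    rw [← setIntegral_mul_mul hv hθ'c hθ.hasCompactSupport.deriv hθ't hζ.continuous hζc,
      ← integral_add i5 i4]
    congr 1; ext z
    by_cases hz : ζ z.2 = 0
    · rw [hz]; ring
    · rw [hφ _ hz, step_of_nonneg ha0.le]; ring
  -- the lower bound
  have i6 : Integrable (fun z : ℝ × Plane => θ z.1 * ζ z.2) (slab T) :=
    (((hθ.contDiff.continuous.comp continuous_fst).mul
      (hζ.continuous.comp continuous_snd)).integrable_of_hasCompactSupport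
      (isTestFunction_mul hθ.contDiff hθ.hasCompactSupport hθ.tsupport_subset hζ
        hζc).2.1).integrableOn
  have e6 : ∫ z, θ z.1 * ζ z.2 ∂(slab T) = (∫ x, ζ x) * ∫ τ, θ τ := by
    rw [slab_eq_prod, integral_prod_mul (μ := volume.restrict (Ioo 0 T)) θ ζ, mul_comm]
    congr 1
    exact setIntegral_eq_integral_of_forall_compl_eq_zero fun τ hτ =>
      image_eq_zero_of_notMem_tsupport fun hn => hτ (hθ.tsupport_subset hn)
  have low : (G₀ - K) * ((∫ x, ζ x) * ∫ τ, θ τ) - G₀ * a ^ 2 * (T ^ 2 * E * ∫ τ, θ τ)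
      ≤ ∫ z, nonlin 2 (u z.1 z.2) * (step (u z.1 z.2) * (θ z.1 * ζ z.2)) ∂(slab T) := by
    calc (G₀ - K) * ((∫ x, ζ x) * ∫ τ, θ τ) - G₀ * a ^ 2 * (T ^ 2 * E * ∫ τ, θ τ)
        ≤ (G₀ - K) * (∫ z, θ z.1 * ζ z.2 ∂(slab T)) - G₀ * a ^ 2
          * ∫ z, (u z.1 z.2 - φ z.2) ^ 2 * (θ z.1 * ζ z.2) ∂(slab T) := by
          rw [e6]
          have := mul_le_mul_of_nonneg_left b2 (show 0 ≤ G₀ * a ^ 2 by positivity)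
          linarith
      _ = ∫ z, ((G₀ - K) * (θ z.1 * ζ z.2) - G₀ * a ^ 2
          * ((u z.1 z.2 - φ z.2) ^ 2 * (θ z.1 * ζ z.2))) ∂(slab T) := by
          rw [integral_sub (i6.const_mul _) (i2.const_mul _), integral_const_mul,
            integral_const_mul]
      _ ≤ _ := by
          apply integral_mono ((i6.const_mul _).sub (i2.const_mul _)) hint
          intro z
          simp only [Pi.sub_apply]
          by_cases hz : ζ z.2 = 0
          · rw [hz]; simp
          · rw [hφ _ hz]
            have := mul_le_mul_of_nonneg_right (nonlin_mul_step_ge ha (u z.1 z.2))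
              (mul_nonneg (hθ.nonneg z.1) (hζ0 z.2))
            linarith
  rw [e4] at hmain
  have := mul_le_mul_of_nonneg_left b1 hL0
  linarith

/-- The velocity of a weak solution whose data are constant and large on the support of a cutoff
becomes large. -/
theorem le_neg_integral_v (h : IsWeakSolution 2 T φ 0 u v)
    (hE : energy 2 φ 0 ≤ ENNReal.ofReal E) (hE0 : 0 ≤ E) {t : ℝ} (ht : t ∈ Ioo 0 T)
    {ζ : Plane → ℝ} (hζ : ContDiff ℝ ∞ ζ) (hζc : HasCompactSupport ζ) (hζ0 : ∀ x, 0 ≤ ζ x)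
    (hζ1 : ∀ x, ζ x ≤ 1) {L : ℝ} (hL0 : 0 ≤ L) (hL : ∀ y, deriv step y ≤ L) {a : ℝ} (ha : 1 ≤ a)
    (hφ : ∀ x, ζ x ≠ 0 → φ x = a) :
    t * ((nonlin 2 (a - 1 / a) - Real.exp (4 * Real.pi)) * (∫ x, ζ x)
      - nonlin 2 (a - 1 / a) * a ^ 2 * (4 * t ^ 2 * E) - 5 * L * E
      - √E * l2 volume (Laplacian.laplacian ζ)) ≤ - ∫ x, v t x * ζ x := by
  -- On an interval of length at most `2t` the deviation error becomes `4t²E`. The variation error,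
  -- counted twice, is at most `4LtE`; together with the kinetic term it accounts for `5LE`.
  set T' := min T (2 * t) with hT'
  have hT'2 : T' ≤ 2 * t := min_le_right _ _
  have htT' : t ∈ Ioo 0 T' := ⟨ht.1, lt_min ht.2 (by linarith [ht.1])⟩
  have hT'0 : 0 < T' := ht.1.trans htT'.2
  have h' := h.mono (min_le_left T (2 * t))
  have hζm : MemLp ζ 2 volume := hζ.continuous.memLp_of_hasCompactSupport hζc
  have key := le_sub_of_forall_timeCutoff (h'.continuous_v ζ hζm)
    (B := L * T' * E) (by positivity)
    (fun θ hθ => h'.timeCutoff_inequality hE hE0 hθ hζ hζc hζ0 hζ1 hL0 hL ha hφ) htT'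
  have h0 : ∫ x, v 0 x * ζ x = 0 := by
    apply integral_eq_zero_of_ae
    filter_upwards [h.initial_v] with x hx
    rw [hx]; simp
  rw [h0, zero_sub] at key
  refine le_trans ?_ key
  have hG : 0 ≤ nonlin 2 (a - 1 / a) := by
    have ha0 : 0 < a := by linarith
    have hb : 0 ≤ a - 1 / a := by
      rw [sub_nonneg, div_le_iff₀ ha0]; nlinarith
    rw [nonlin_two]; positivity
  have e1 : T' ^ 2 * E ≤ 4 * t ^ 2 * E := by
    have := pow_le_pow_left₀ hT'0.le hT'2 2
    nlinarith
  have e2 : nonlin 2 (a - 1 / a) * a ^ 2 * (T' ^ 2 * E)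
      ≤ nonlin 2 (a - 1 / a) * a ^ 2 * (4 * t ^ 2 * E) :=
    mul_le_mul_of_nonneg_left e1 (by positivity)
  have e3 : t * (nonlin 2 (a - 1 / a) * a ^ 2 * (T' ^ 2 * E))
      ≤ t * (nonlin 2 (a - 1 / a) * a ^ 2 * (4 * t ^ 2 * E)) :=
    mul_le_mul_of_nonneg_left e2 ht.1.le
  have e4 : L * T' * E ≤ L * (2 * t) * E := by gcongr
  nlinarith

end IsWeakSolution

/-! ### The initial data and their energy -/

/-- A radial bump function on the plane, equal to `1` for `‖x‖ ≤ 1/2` and to `0` for `‖x‖ ≥ 1`. -/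
def planeBump : ContDiffBump (0 : Plane) where
  rIn := 1 / 2
  rOut := 1
  rIn_pos := by norm_num
  rIn_lt_rOut := by norm_num

/-- The bump function at the scale `2 ^ (-n)`. -/
def bumpAt (n : ℕ) (x : Plane) : ℝ := planeBump ((2 : ℝ) ^ n • x)

lemma bumpAt_contDiff (n : ℕ) : ContDiff ℝ ∞ (bumpAt n) :=
  (planeBump.contDiff (n := ⊤)).comp (contDiff_const_smul ((2 : ℝ) ^ n))

lemma bumpAt_nonneg (n : ℕ) (x : Plane) : 0 ≤ bumpAt n x := planeBump.nonneg

lemma bumpAt_le_one (n : ℕ) (x : Plane) : bumpAt n x ≤ 1 := planeBump.le_one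

lemma norm_two_pow_smul (n : ℕ) (x : Plane) : ‖(2 : ℝ) ^ n • x‖ = 2 ^ n * ‖x‖ := by
  rw [norm_smul]; simp

lemma bumpAt_eq_one {n : ℕ} {x : Plane} (h : 2 ^ n * ‖x‖ ≤ 1 / 2) : bumpAt n x = 1 := by
  apply planeBump.one_of_mem_closedBall
  rw [mem_closedBall_zero_iff, norm_two_pow_smul]
  exact h

lemma bumpAt_eq_zero {n : ℕ} {x : Plane} (h : 1 ≤ 2 ^ n * ‖x‖) : bumpAt n x = 0 := by
  apply planeBump.zero_of_le_dist
  rw [dist_zero_right, norm_two_pow_smul]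
  exact h

lemma bumpAt_support_subset (n : ℕ) :
    Function.support (bumpAt n) ⊆ Metric.closedBall 0 (1 / 2 ^ n) := by
  intro x hx
  rw [mem_closedBall_zero_iff, le_div_iff₀ (by positivity), mul_comm]
  by_contra hn
  exact hx (bumpAt_eq_zero (le_of_not_ge hn))

lemma bumpAt_hasCompactSupport (n : ℕ) : HasCompactSupport (bumpAt n) :=
  HasCompactSupport.of_support_subset_isCompact (isCompact_closedBall _ _) (bumpAt_support_subset n)

/-- The sum of the first `M` bump functions. -/
def tower (M : ℕ) (x : Plane) : ℝ := ∑ n ∈ Finset.range M, bumpAt n x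

/-- The initial data. -/
def data (A : ℝ) (M : ℕ) (x : Plane) : ℝ := A / √M * tower M x

lemma tower_contDiff (M : ℕ) : ContDiff ℝ ∞ (tower M) :=
  ContDiff.sum fun n _ => bumpAt_contDiff n

lemma data_contDiff (A : ℝ) (M : ℕ) : ContDiff ℝ ∞ (data A M) :=
  contDiff_const.mul (tower_contDiff M)

lemma tower_nonneg (M : ℕ) (x : Plane) : 0 ≤ tower M x :=
  Finset.sum_nonneg fun n _ => bumpAt_nonneg n x

lemma tower_le (M : ℕ) (x : Plane) : tower M x ≤ M := by
  calc tower M x ≤ ∑ n ∈ Finset.range M, (1 : ℝ) := Finset.sum_le_sum fun n _ => bumpAt_le_one n x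
    _ = M := by simp

lemma tower_eq_zero {M : ℕ} {x : Plane} (h : 1 ≤ ‖x‖) : tower M x = 0 :=
  Finset.sum_eq_zero fun n _ => bumpAt_eq_zero <| by
    have : (1 : ℝ) ≤ 2 ^ n := one_le_pow₀ (by norm_num)
    nlinarith

lemma data_hasCompactSupport (A : ℝ) (M : ℕ) : HasCompactSupport (data A M) := by
  apply HasCompactSupport.of_support_subset_isCompact (isCompact_closedBall (0 : Plane) 1)
  intro x hx
  rw [mem_closedBall_zero_iff]
  by_contra hn
  exact hx (by rw [data, tower_eq_zero (le_of_not_ge hn), mul_zero])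

/-- The radii `1/2` and `1` of the plateau and of the support match the dyadic scaling: the support
of each bump lies in the plateau of all larger ones. Thus the data are constant on the support of
the test function `bumpAt M`. -/
lemma data_eq_of_bumpAt_ne_zero (A : ℝ) {M : ℕ} {x : Plane} (h : bumpAt M x ≠ 0) :
    data A M x = A * √M := by
  have hx : 2 ^ M * ‖x‖ < 1 := by
    by_contra hn
    exact h (bumpAt_eq_zero (le_of_not_gt hn))
  have : tower M x = M := by
    have : ∀ n ∈ Finset.range M, bumpAt n x = 1 := by
      intro n hn
      apply bumpAt_eq_one
      have h1 : (2 : ℝ) ^ (n + 1) ≤ 2 ^ M :=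
        pow_le_pow_right₀ (by norm_num) (Finset.mem_range.1 hn)
      have := mul_le_mul_of_nonneg_right h1 (norm_nonneg x)
      rw [pow_succ] at this
      linarith
    rw [tower, Finset.sum_congr rfl this]; simp
  rw [data, this, div_mul_eq_mul_div, mul_div_assoc, Real.div_sqrt]

/-- Inside the smallest disc the last indicator alone dominates, as `tower` is at most the number of
bumps. Outside it the last bump vanishes and induction applies. -/
lemma pow_tower_le {q : ℝ} (hq : 1 ≤ q) (M : ℕ) (x : Plane) :
    q ^ tower M x ≤ 1 + ∑ n ∈ Finset.range M,
      (Metric.ball (0 : Plane) (1 / 2 ^ n)).indicator (fun _ => q ^ (n + 1)) x := by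
  have hpos : ∀ M : ℕ, 0 ≤ ∑ n ∈ Finset.range M,
      (Metric.ball (0 : Plane) (1 / 2 ^ n)).indicator (fun _ => q ^ (n + 1)) x := fun M =>
    Finset.sum_nonneg fun n _ => indicator_nonneg (fun _ _ => by positivity) x
  induction M with
  | zero => simp [tower]
  | succ M ih =>
    rw [Finset.sum_range_succ]
    by_cases hx : x ∈ Metric.ball (0 : Plane) (1 / 2 ^ M)
    · rw [indicator_of_mem hx]
      have h1 : q ^ tower (M + 1) x ≤ q ^ (M + 1) := by
        have := Real.rpow_le_rpow_of_exponent_le hq (tower_le (M + 1) x)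
        rwa [Real.rpow_natCast] at this
      linarith [hpos M]
    · rw [indicator_of_notMem hx, add_zero]
      have : tower (M + 1) x = tower M x := by
        rw [tower, Finset.sum_range_succ, bumpAt_eq_zero, add_zero, tower]
        rw [Metric.mem_ball, dist_zero_right, not_lt, div_le_iff₀ (by positivity)] at hx
        linarith
      rw [this]
      exact ih

/-- The square is made linear by `tower ≤ M`: `A² tower²/M ≤ A² tower`. The exponential is then
geometric along dyadic rings. -/
lemma exp_data_sq_le (A : ℝ) (M : ℕ) (x : Plane) :
    Real.exp (4 * Real.pi * data A M x ^ 2) ≤ Real.exp (4 * Real.pi * A ^ 2) ^ tower M x := by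
  rw [← Real.exp_mul]
  apply Real.exp_le_exp.2
  rw [mul_assoc, mul_assoc (4 : ℝ), mul_assoc (4 : ℝ), mul_assoc Real.pi]
  gcongr
  have h0 := tower_nonneg M x
  rcases Nat.eq_zero_or_pos M with rfl | hM
  · simp [data]; positivity
  have hM' : (0 : ℝ) < M := by exact_mod_cast hM
  rw [data, mul_pow, div_pow, Real.sq_sqrt hM'.le, div_mul_eq_mul_div, div_le_iff₀ hM']
  have := tower_le M x
  nlinarith [mul_nonneg (sq_nonneg A) (mul_nonneg h0 (sub_nonneg.2 this))]

lemma volume_ball_two_pow (n : ℕ) :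
    volume (Metric.ball (0 : Plane) (1 / 2 ^ n)) = ENNReal.ofReal (Real.pi / 4 ^ n) := by
  have := EuclideanSpace.volume_ball_fin_two 0 (1 / 2 ^ n)
  rw [this, ← ENNReal.ofReal_pow (by positivity), ← ENNReal.ofReal_mul (by positivity)]
  congr 1
  rw [div_pow, one_pow, ← pow_mul, mul_comm n 2, pow_mul]
  norm_num
  ring

lemma volume_closedBall_two_pow (n : ℕ) :
    volume (Metric.closedBall (0 : Plane) (1 / 2 ^ n)) = ENNReal.ofReal (Real.pi / 4 ^ n) := by
  rw [Measure.addHaar_closedBall_eq_addHaar_ball, volume_ball_two_pow]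

/-- The disc of radius `2^(-n)` contributes `π q (q/4)^n`. As `q/4 ≥ 2`, the geometric sum is
bounded by `(q/4)^M`. -/
lemma lintegral_potential_data_le {A : ℝ} (M : ℕ)
    (hq : 8 ≤ Real.exp (4 * Real.pi * A ^ 2)) :
    ∫⁻ x, ENNReal.ofReal (2 * potential 2 (data A M x))
      ≤ ENNReal.ofReal (8 * Real.exp (4 * Real.pi * A ^ 2)
        * (Real.exp (4 * Real.pi * A ^ 2) / 4) ^ M) := by
  set q := Real.exp (4 * Real.pi * A ^ 2) with hqdef
  have hq1 : 1 ≤ q := by linarith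
  have hpt : ∀ x, ENNReal.ofReal (2 * potential 2 (data A M x))
      ≤ (Metric.ball (0 : Plane) (1 / 2 ^ 0)).indicator (fun _ => 1) x
        + ∑ n ∈ Finset.range M, (Metric.ball (0 : Plane) (1 / 2 ^ n)).indicator
          (fun _ => ENNReal.ofReal (q ^ (n + 1))) x := by
    intro x
    by_cases hx : 1 ≤ ‖x‖
    · rw [potential_two, data, tower_eq_zero hx]; simp
    have hx' : x ∈ Metric.ball (0 : Plane) (1 / 2 ^ 0) := by simpa using hx
    rw [indicator_of_mem hx']
    have h1 : 2 * potential 2 (data A M x) ≤ 1 + ∑ n ∈ Finset.range M,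
      (Metric.ball (0 : Plane) (1 / 2 ^ n)).indicator (fun _ => q ^ (n + 1)) x := by
      rw [potential_two]
      refine le_trans ?_ ((exp_data_sq_le A M x).trans (pow_tower_le hq1 M x))
      have h3 := Real.pi_gt_three
      have h4 := Real.exp_pos (4 * Real.pi * data A M x ^ 2)
      rw [div_le_iff₀ (by positivity)]
      nlinarith
    refine (ENNReal.ofReal_le_ofReal h1).trans ?_
    rw [ENNReal.ofReal_add zero_le_one (Finset.sum_nonneg fun n _ =>
      indicator_nonneg (fun _ _ => by positivity) x), ENNReal.ofReal_one,
      ENNReal.ofReal_sum_of_nonneg fun n _ => indicator_nonneg (fun _ _ => by positivity) x]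
    gcongr with n hn
    by_cases hxn : x ∈ Metric.ball (0 : Plane) (1 / 2 ^ n)
    · rw [indicator_of_mem hxn, indicator_of_mem hxn]
    · rw [indicator_of_notMem hxn, indicator_of_notMem hxn]; simp
  refine (lintegral_mono hpt).trans ?_
  rw [lintegral_add_left (measurable_const.indicator measurableSet_ball),
    lintegral_finsetSum _ fun n _ => measurable_const.indicator measurableSet_ball]
  simp_rw [lintegral_indicator_const measurableSet_ball, volume_ball_two_pow]
  rw [one_mul]
  simp_rw [← ENNReal.ofReal_mul (pow_nonneg (zero_le_one.trans hq1) _)]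
  rw [← ENNReal.ofReal_sum_of_nonneg fun n _ => by positivity,
    ← ENNReal.ofReal_add (by positivity) (Finset.sum_nonneg fun n _ => by positivity)]
  apply ENNReal.ofReal_le_ofReal
  have hr : 2 ≤ q / 4 := by linarith
  have hs : ∑ n ∈ Finset.range M, q ^ (n + 1) * (Real.pi / 4 ^ n)
      = q * Real.pi * ∑ n ∈ Finset.range M, (q / 4) ^ n := by
    rw [Finset.mul_sum]
    refine Finset.sum_congr rfl fun n _ => ?_
    rw [div_pow, pow_succ]; ring
  have hg : ∑ n ∈ Finset.range M, (q / 4) ^ n ≤ (q / 4) ^ M := by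
    rw [geom_sum_eq (by linarith), div_le_iff₀ (by linarith)]
    have : 0 < (q / 4) ^ M := by positivity
    nlinarith
  have h1 : 1 ≤ (q / 4) ^ M := one_le_pow₀ (by linarith)
  rw [hs]
  have hpi := Real.pi_le_four
  have hpi0 := Real.pi_pos
  have e1 : q * Real.pi * ∑ n ∈ Finset.range M, (q / 4) ^ n ≤ q * 4 * (q / 4) ^ M := by
    gcongr
  have e2 : Real.pi / 4 ^ 0 ≤ 4 * q * (q / 4) ^ M := by
    rw [pow_zero, div_one]
    calc Real.pi ≤ 4 * 1 * 1 := by linarith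
      _ ≤ 4 * q * (q / 4) ^ M := by gcongr
  linarith

/-- A bound for the gradient of the bump function. -/
lemma exists_fderiv_planeBump_le : ∃ C : ℝ, 0 < C ∧ ∀ x, ‖fderiv ℝ planeBump x‖ ≤ C := by
  have h1 : Continuous (fderiv ℝ planeBump) :=
    (planeBump.contDiff (n := ⊤)).continuous_fderiv (by simp)
  obtain ⟨C, hC⟩ := h1.bounded_above_of_compact_support (planeBump.hasCompactSupport.fderiv ℝ)
  exact ⟨max C 1, by positivity, fun x => (hC x).trans (le_max_left _ _)⟩

lemma norm_fderiv_bumpAt_le {C : ℝ} (hC : ∀ x, ‖fderiv ℝ planeBump x‖ ≤ C) (n : ℕ)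
    (x : Plane) : ‖fderiv ℝ (bumpAt n) x‖
      ≤ C * (Metric.closedBall (0 : Plane) (1 / 2 ^ n)).indicator (fun _ => 2 ^ n) x := by
  by_cases hx : x ∈ Metric.closedBall (0 : Plane) (1 / 2 ^ n)
  · rw [indicator_of_mem hx]
    have : fderiv ℝ (bumpAt n) x = (2 : ℝ) ^ n • fderiv ℝ planeBump ((2 : ℝ) ^ n • x) :=
      fderiv_comp_smul _
    rw [this, norm_smul, mul_comm]
    simp only [norm_pow, Real.norm_ofNat]
    gcongr
    exact hC _
  · rw [indicator_of_notMem hx, mul_zero]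
    have : fderiv ℝ (bumpAt n) x = 0 := by
      apply image_eq_zero_of_notMem_tsupport
      intro hn
      exact hx (closure_minimal (bumpAt_support_subset n) Metric.isClosed_closedBall
        (tsupport_fderiv_subset ℝ hn))
    rw [this, norm_zero]

lemma norm_fderiv_data_le {A C : ℝ} (hA : 0 ≤ A)
    (hC : ∀ x, ‖fderiv ℝ planeBump x‖ ≤ C) (M : ℕ) (x : Plane) :
    ‖fderiv ℝ (data A M) x‖ ≤ A / √M * C * ∑ n ∈ Finset.range M,
      (Metric.closedBall (0 : Plane) (1 / 2 ^ n)).indicator (fun _ => (2 : ℝ) ^ n) x := by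
  have hd : ∀ n ∈ Finset.range M, DifferentiableAt ℝ (bumpAt n) x := fun n _ =>
    ((bumpAt_contDiff n).differentiable (by simp)).differentiableAt
  have h1 : fderiv ℝ (data A M) x
      = (A / √M) • ∑ n ∈ Finset.range M, fderiv ℝ (bumpAt n) x := by
    have e : fderiv ℝ (tower M) x = ∑ n ∈ Finset.range M, fderiv ℝ (bumpAt n) x :=
      fderiv_fun_sum hd
    rw [← e]
    exact fderiv_const_mul ((tower_contDiff M).differentiable (by simp)).differentiableAt _
  rw [h1, norm_smul, Real.norm_of_nonneg (by positivity), mul_assoc, Finset.mul_sum]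
  gcongr
  refine (norm_sum_le _ _).trans ?_
  gcongr with n hn
  exact norm_fderiv_bumpAt_le hC n x

/-- If `2^(-N)` is the smallest radius whose disc contains `x`, the sum is at most `2^(N+1)` while
`|x| ≤ 2^(-N)`. The gradient of the data is thus bounded by a multiple of `1/|x|`, the model
function of weak `L²`. -/
lemma sum_indicator_mul_norm_le (M : ℕ) (x : Plane) :
    (∑ n ∈ Finset.range M,
      (Metric.closedBall (0 : Plane) (1 / 2 ^ n)).indicator (fun _ => (2 : ℝ) ^ n) x) * ‖x‖ ≤ 2 := by
  have hle : ∀ M : ℕ, ∑ n ∈ Finset.range M,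
      (Metric.closedBall (0 : Plane) (1 / 2 ^ n)).indicator (fun _ => (2 : ℝ) ^ n) x ≤ 2 ^ M := by
    intro M
    induction M with
    | zero => simp
    | succ M ih =>
      rw [Finset.sum_range_succ, pow_succ]
      have : (Metric.closedBall (0 : Plane) (1 / 2 ^ M)).indicator (fun _ => (2 : ℝ) ^ M) x
          ≤ 2 ^ M := indicator_apply_le' (fun _ => le_rfl) fun _ => by positivity
      linarith
  induction M with
  | zero => simp
  | succ M ih =>
    by_cases hx : x ∈ Metric.closedBall (0 : Plane) (1 / 2 ^ M)
    · have h1 := mul_le_mul_of_nonneg_right (hle (M + 1)) (norm_nonneg x)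
      rw [mem_closedBall_zero_iff, le_div_iff₀ (by positivity)] at hx
      rw [pow_succ] at h1
      linarith
    · rw [Finset.sum_range_succ, indicator_of_notMem hx, add_zero]
      exact ih

/-- The gradient of the data. -/
def dataGradient (A : ℝ) (M : ℕ) : Plane → Plane := gradient (data A M)

lemma norm_dataGradient (A : ℝ) (M : ℕ) (x : Plane) :
    ‖dataGradient A M x‖ = ‖fderiv ℝ (data A M) x‖ := by
  simp [dataGradient, gradient]

lemma dataGradient_continuous (A : ℝ) (M : ℕ) : Continuous (dataGradient A M) := by
  have h1 : Continuous (fderiv ℝ (data A M)) := (data_contDiff A M).continuous_fderiv (by simp)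
  exact (InnerProductSpace.toDual ℝ Plane).symm.continuous.comp h1

lemma isWeakGradient_data (A : ℝ) (M : ℕ) : IsWeakGradient (data A M) (dataGradient A M) := by
  refine ⟨(data_contDiff A M).continuous.locallyIntegrable,
    (dataGradient_continuous A M).locallyIntegrable, fun ζ hζ hζc e => ?_⟩
  have := integral_dirD_mul (μ := volume) e (data_contDiff A M) hζ hζc
  have h2 : ∀ x, inner ℝ (dataGradient A M x) e = dirD e (data A M) x := fun x => by
    simp [dataGradient, gradient, dirD]
  simp_rw [h2, this, neg_neg]
  rfl

/-- Cauchy–Schwarz over the `M` scales loses a factor `M` that cancels the normalization `1/M`. By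
scale invariance in the plane every scale contributes equally, which leaves a factor `M`, harmless
next to `(q/4)^M`. -/
lemma lintegral_dataGradient_sq_le {A C : ℝ} (hA : 0 ≤ A)
    (hC : ∀ x, ‖fderiv ℝ planeBump x‖ ≤ C) (M : ℕ) :
    ∫⁻ x, ‖dataGradient A M x‖ₑ ^ 2 ≤ ENNReal.ofReal (4 * A ^ 2 * C ^ 2 * M) := by
  rcases Nat.eq_zero_or_pos M with rfl | hM
  · have : ∀ x, dataGradient A 0 x = 0 := fun x => by
      have : data A 0 = fun _ => 0 := by ext x; simp [data]
      rw [dataGradient, this]; simp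
    simp [this]
  have hM' : (0 : ℝ) < M := by exact_mod_cast hM
  have hpt : ∀ x, ‖dataGradient A M x‖ₑ ^ 2 ≤ ∑ n ∈ Finset.range M,
      (Metric.closedBall (0 : Plane) (1 / 2 ^ n)).indicator
        (fun _ => ENNReal.ofReal (A ^ 2 * C ^ 2 * 4 ^ n)) x := by
    intro x
    have h1 := norm_fderiv_data_le hA hC M x
    set f : ℕ → ℝ := fun n =>
      (Metric.closedBall (0 : Plane) (1 / 2 ^ n)).indicator (fun _ => (2 : ℝ) ^ n) x with hf
    have h2 : (∑ n ∈ Finset.range M, f n) ^ 2 ≤ M * ∑ n ∈ Finset.range M, f n ^ 2 := by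
      simpa using sq_sum_le_card_mul_sum_sq (s := Finset.range M) (f := f)
    have h3 : ‖dataGradient A M x‖ ^ 2 ≤ ∑ n ∈ Finset.range M, A ^ 2 * C ^ 2 * f n ^ 2 := by
      rw [norm_dataGradient]
      calc ‖fderiv ℝ (data A M) x‖ ^ 2 ≤ (A / √M * C * ∑ n ∈ Finset.range M, f n) ^ 2 :=
            pow_le_pow_left₀ (norm_nonneg _) h1 2
        _ = A ^ 2 * C ^ 2 / M * (∑ n ∈ Finset.range M, f n) ^ 2 := by
            rw [mul_pow, mul_pow, div_pow, Real.sq_sqrt hM'.le]; ring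
        _ ≤ A ^ 2 * C ^ 2 / M * (M * ∑ n ∈ Finset.range M, f n ^ 2) := by gcongr
        _ = ∑ n ∈ Finset.range M, A ^ 2 * C ^ 2 * f n ^ 2 := by
            rw [← Finset.mul_sum]; field_simp
    rw [← ofReal_norm, ← ENNReal.ofReal_pow (norm_nonneg _)]
    refine (ENNReal.ofReal_le_ofReal h3).trans ?_
    rw [ENNReal.ofReal_sum_of_nonneg fun n _ => by positivity]
    gcongr with n hn
    by_cases hx : x ∈ Metric.closedBall (0 : Plane) (1 / 2 ^ n)
    · simp only [hf, indicator_of_mem hx]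
      rw [← pow_mul, mul_comm n 2, pow_mul]
      norm_num
    · simp only [hf, indicator_of_notMem hx]; simp
  refine (lintegral_mono hpt).trans ?_
  rw [lintegral_finsetSum _ fun n _ => measurable_const.indicator measurableSet_closedBall]
  simp_rw [lintegral_indicator_const measurableSet_closedBall, volume_closedBall_two_pow]
  have : ∀ n : ℕ, ENNReal.ofReal (A ^ 2 * C ^ 2 * 4 ^ n) * ENNReal.ofReal (Real.pi / 4 ^ n)
      = ENNReal.ofReal (A ^ 2 * C ^ 2 * Real.pi) := fun n => by
    rw [← ENNReal.ofReal_mul (by positivity)]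
    congr 1
    field_simp
  simp_rw [this]
  rw [← ENNReal.ofReal_sum_of_nonneg fun n _ => by positivity]
  apply ENNReal.ofReal_le_ofReal
  rw [Finset.sum_const, Finset.card_range, nsmul_eq_mul]
  have := Real.pi_le_four
  have : A ^ 2 * C ^ 2 * M * Real.pi ≤ A ^ 2 * C ^ 2 * M * 4 := by gcongr
  linarith

/-- The energy of the data. -/
theorem energy_data_le {A C : ℝ} (hA : 0 ≤ A)
    (hC : ∀ x, ‖fderiv ℝ planeBump x‖ ≤ C) (hq : 8 ≤ Real.exp (4 * Real.pi * A ^ 2)) (M : ℕ) :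
    energy 2 (data A M) 0 ≤ ENNReal.ofReal ((4 * A ^ 2 * C ^ 2
      + 8 * Real.exp (4 * Real.pi * A ^ 2)) * (Real.exp (4 * Real.pi * A ^ 2) / 4) ^ M) := by
  have hM : (M : ℝ) ≤ (Real.exp (4 * Real.pi * A ^ 2) / 4) ^ M := by
    have h1 : (M : ℝ) ≤ 2 ^ M := by exact_mod_cast Nat.lt_two_pow_self.le
    exact h1.trans (pow_le_pow_left₀ (by norm_num) (by linarith) M)
  rw [add_mul, ENNReal.ofReal_add (by positivity) (by positivity)]
  unfold energy
  have h0 : ∫⁻ x : Plane, ‖(0 : Plane → ℝ) x‖ₑ ^ 2 = 0 := by simp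
  rw [h0, add_zero]
  gcongr
  · refine (iInf₂_le _ (isWeakGradient_data A M)).trans ?_
    refine (lintegral_dataGradient_sq_le hA hC M).trans ?_
    apply ENNReal.ofReal_le_ofReal
    gcongr
  · exact lintegral_potential_data_le M hq

/-! ### Scaling of the bumps and growth of the velocity -/

lemma integral_comp_two_pow_smul (f : Plane → ℝ) (n : ℕ) :
    ∫ x, f ((2 : ℝ) ^ n • x) = (∫ x, f x) / 4 ^ n := by
  rw [Measure.integral_comp_smul, finrank_euclideanSpace_fin, smul_eq_mul, abs_of_pos (by positivity),
    ← pow_mul, mul_comm n 2, pow_mul, div_eq_inv_mul]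
  norm_num

lemma integral_bumpAt (n : ℕ) : ∫ x, bumpAt n x = (∫ x, planeBump x) / 4 ^ n :=
  integral_comp_two_pow_smul _ n

lemma laplacian_bumpAt (n : ℕ) (x : Plane) : Laplacian.laplacian (bumpAt n) x
    = 4 ^ n * Laplacian.laplacian (planeBump : Plane → ℝ) ((2 : ℝ) ^ n • x) := by
  have h1 : ∀ (f : Plane → ℝ) (e : Plane), dirD e (fun x => f ((2 : ℝ) ^ n • x))
      = fun x => 2 ^ n * dirD e f ((2 : ℝ) ^ n • x) := by
    intro f e
    ext x
    have : fderiv ℝ (fun x => f ((2 : ℝ) ^ n • x)) x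
      = (2 : ℝ) ^ n • fderiv ℝ f ((2 : ℝ) ^ n • x) := fderiv_comp_smul _
    simp [dirD, this]
  have h2 : ∀ (f : Plane → ℝ) (e : Plane) (c : ℝ), dirD e (fun x => c * f x)
      = fun x => c * dirD e f x := by
    intro f e c
    ext x
    have : fderiv ℝ (fun x => c * f x) x = c • fderiv ℝ f x := 
      congrFun (fderiv_const_smul_field (𝕜 := ℝ) (f := f) c) x
    simp [dirD, this]
  rw [laplacian_eq_sum_dirD (bumpAt_contDiff n),
    laplacian_eq_sum_dirD (planeBump.contDiff (n := ⊤))]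
  have h3 : ∀ e, dirD e (dirD e (bumpAt n)) = fun x => 4 ^ n * dirD e (dirD e planeBump)
      ((2 : ℝ) ^ n • x) := by
    intro e
    have := h1 planeBump e
    rw [show bumpAt n = fun x => planeBump ((2 : ℝ) ^ n • x) from rfl, this, h2, h1]
    ext x
    rw [show (4 : ℝ) = 2 * 2 by norm_num, mul_pow]
    ring
  simp only [h3, Finset.mul_sum]

lemma l2_laplacian_bumpAt (n : ℕ) : l2 volume (Laplacian.laplacian (bumpAt n))
    = 2 ^ n * l2 volume (Laplacian.laplacian (planeBump : Plane → ℝ)) := by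
  have hb := planeBump.contDiff (n := ⊤)
  rw [← pow_left_inj₀ (l2_nonneg _) (mul_nonneg (by positivity) (l2_nonneg _)) two_ne_zero, mul_pow,
    l2_sq (laplacian_memLp (bumpAt_contDiff n) (bumpAt_hasCompactSupport n)),
    l2_sq (laplacian_memLp hb planeBump.hasCompactSupport)]
  simp_rw [laplacian_bumpAt, mul_pow]
  rw [integral_const_mul,
    integral_comp_two_pow_smul (fun x => Laplacian.laplacian (planeBump : Plane → ℝ) x ^ 2)]
  have : ((4 : ℝ) ^ n) ^ 2 = 4 ^ n * (2 ^ n) ^ 2 := by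
    rw [show (4 : ℝ) = 2 * 2 by norm_num, mul_pow]; ring
  rw [this]
  field_simp

/-- Since `(a - 1/a)² ≥ a² - 2`, a shift by `1/a` costs only the factor `exp (-8π)` in the
exponential. This fixes `1/a` as the admissible deviation. -/
lemma le_nonlin_sub_inv {a : ℝ} (ha : 2 ≤ a) :
    a / 2 * (Real.exp (4 * Real.pi * a ^ 2) * Real.exp (-(8 * Real.pi)))
      ≤ nonlin 2 (a - 1 / a) := by
  have h1 : 1 / a ≤ 1 / 2 := one_div_le_one_div_of_le (by norm_num) ha
  have h2 : a ^ 2 - 2 ≤ (a - 1 / a) ^ 2 := by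
    have : a * (1 / a) = 1 := by field_simp
    nlinarith [sq_nonneg (1 / a)]
  rw [nonlin_two, ← Real.exp_add]
  apply mul_le_mul (by linarith) _ (Real.exp_pos _).le (by linarith)
  apply Real.exp_le_exp.2
  nlinarith [Real.pi_pos]

/-- The bookkeeping of sizes, with `Q = (p²/4)^M`. The choice `s² = m/(8B)` makes the deviation term
exactly half of the main term `G m/4^M`, which is at least `2acQ` with `c = b₂m/4`. All other errors
are at most `K Q` with `K` independent of `M`, and `a ≥ 2K/c` absorbs them. Multiplication by the
time `s/(a p^M)` cancels the factor `a` and turns `Q` into `(p/4)^M`. -/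
lemma velocity_lower_bound {p m B D L s a G b₁ b₂ : ℝ} {M : ℕ} (hp : 4 ≤ p) (hm0 : 0 < m)
    (hB0 : 0 < B) (hD0 : 0 ≤ D) (hs0 : 0 < s) (hs2 : s ^ 2 = m / (8 * B))
    (ha0 : 0 < a) (hb₁ : 0 < b₁) (hb₂ : 0 < b₂)
    (haK : 2 * (b₁ * m + 5 * L * B + √B * D) / (b₂ * m / 4) ≤ a)
    (hG : a / 2 * ((p ^ 2) ^ M * b₂) ≤ G) :
    s * (b₂ * m / 4) / 2 * (p / 4) ^ M ≤ s / (a * p ^ M) * ((G - b₁) * (m / 4 ^ M)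
      - G * a ^ 2 * (4 * (s / (a * p ^ M)) ^ 2 * (B * (p ^ 2 / 4) ^ M))
      - 5 * L * (B * (p ^ 2 / 4) ^ M) - √(B * (p ^ 2 / 4) ^ M) * (2 ^ M * D)) := by
  have hc0 : 0 < b₂ * m / 4 := by positivity
  set c := b₂ * m / 4 with hc
  set K := b₁ * m + 5 * L * B + √B * D with hK
  have hp1 : 1 ≤ p ^ M := one_le_pow₀ (by linarith)
  set t := s / (a * p ^ M) with ht
  have ht0 : 0 < t := by positivity
  set Q := (p ^ 2 / 4) ^ M with hQ
  have hQ0 : 0 < Q := by positivity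
  have hQ4 : Q = (p ^ 2) ^ M / 4 ^ M := by rw [hQ, div_pow]
  have hpp : (p ^ 2) ^ M = p ^ M * p ^ M := by rw [sq, mul_pow]
  have e1 : G * a ^ 2 * (4 * t ^ 2 * (B * Q)) = G * (m / 4 ^ M) / 2 := by
    rw [ht, div_pow, hs2, hQ4, hpp]
    field_simp
    ring
  have e2 : m / 4 ^ M ≤ m * Q := by
    rw [hQ4, div_eq_mul_one_div]
    gcongr
    rw [hpp]
    nlinarith
  have e3 : √(B * Q) * (2 ^ M * D) ≤ √B * D * Q := by
    have hsq : √Q = p ^ M / 2 ^ M := by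
      rw [hQ4, hpp, show (4 : ℝ) = 2 * 2 by norm_num, mul_pow, mul_div_mul_comm,
        Real.sqrt_mul_self (by positivity)]
    have hpQ : p ^ M ≤ Q := by
      apply pow_le_pow_left₀ (by linarith)
      nlinarith
    rw [Real.sqrt_mul hB0.le, hsq]
    calc √B * (p ^ M / 2 ^ M) * (2 ^ M * D) = √B * D * p ^ M := by field_simp
      _ ≤ √B * D * Q := by gcongr
  have e4 : 2 * (a * c) * Q ≤ G * (m / 4 ^ M) := by
    calc 2 * (a * c) * Q
        = a / 2 * ((p ^ 2) ^ M * b₂) * (m / 4 ^ M) := by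
          rw [hQ4, hc]; ring
      _ ≤ G * (m / 4 ^ M) := by gcongr
  have e5 : a * c / 2 * Q ≤ (a * c - K) * Q := by
    apply mul_le_mul_of_nonneg_right _ hQ0.le
    rw [div_le_iff₀ hc0] at haK
    linarith
  have e6 : (a * c - K) * Q ≤ (G - b₁) * (m / 4 ^ M)
      - G * a ^ 2 * (4 * t ^ 2 * (B * Q)) - 5 * L * (B * Q) - √(B * Q) * (2 ^ M * D) := by
    rw [e1, hK]
    have := mul_le_mul_of_nonneg_left e2 hb₁.le
    nlinarith
  calc s * c / 2 * (p / 4) ^ M = t * (a * c / 2 * Q) := by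
        rw [ht, hQ4, hpp, div_pow]
        field_simp
    _ ≤ _ := mul_le_mul_of_nonneg_left (e5.trans e6) ht0.le

lemma hasFiniteEnergy_data {A : ℝ} (hA : 0 ≤ A) (hq : 8 ≤ Real.exp (4 * Real.pi * A ^ 2)) (M : ℕ) :
    HasFiniteEnergy 2 (data A M) 0 := by
  obtain ⟨C, -, hC⟩ := exists_fderiv_planeBump_le
  exact ⟨(data_contDiff A M).continuous.memLp_of_hasCompactSupport (data_hasCompactSupport A M),
    MemLp.zero', (energy_data_le hA hC hq M).trans_lt ENNReal.ofReal_lt_top⟩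

/-- At suitable times `t M → 0` the velocity of every weak solution with data `data A M` has
a component in the direction of `bumpAt M` that grows exponentially. -/
theorem exists_velocity_growth {A : ℝ} (hA : 0 < A) (hp : 4 ≤ Real.exp (2 * Real.pi * A ^ 2)) :
    ∃ κ : ℝ, 0 < κ ∧ ∃ (M₀ : ℕ) (t : ℕ → ℝ), Tendsto t atTop (𝓝 0) ∧ ∀ M, M₀ ≤ M →
      t M ∈ Ioo (0 : ℝ) 1 ∧ ∀ (T : ℝ) (u v : ℝ → Plane → ℝ), t M < T →
        IsWeakSolution 2 T (data A M) 0 u v →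
        κ * (Real.exp (2 * Real.pi * A ^ 2) / 4) ^ M ≤ |∫ x, v (t M) x * bumpAt M x| := by
  obtain ⟨C, hC0, hC⟩ := exists_fderiv_planeBump_le
  obtain ⟨L, hL0, hL⟩ := exists_step_deriv_le
  have hqp : Real.exp (4 * Real.pi * A ^ 2) = Real.exp (2 * Real.pi * A ^ 2) ^ 2 := by
    rw [← Real.exp_nat_mul]; congr 1; push_cast; ring
  have hq8 : 8 ≤ Real.exp (4 * Real.pi * A ^ 2) := by rw [hqp]; nlinarith
  have henergy := energy_data_le hA.le hC hq8
  set p := Real.exp (2 * Real.pi * A ^ 2) with hpdef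
  rw [hqp] at henergy
  have hexp : ∀ M : ℕ, Real.exp (4 * Real.pi * (A * √M) ^ 2) = (p ^ 2) ^ M := by
    intro M
    rw [← hqp, ← Real.exp_nat_mul, mul_pow, Real.sq_sqrt (Nat.cast_nonneg M)]
    congr 1; ring
  set m := ∫ x, planeBump x with hm
  have hm0 : 0 < m := planeBump.integral_pos
  set B := 4 * A ^ 2 * C ^ 2 + 8 * p ^ 2 with hB
  have hB0 : 0 < B := by positivity
  set D := l2 volume (Laplacian.laplacian (planeBump : Plane → ℝ)) with hD
  have hD0 : 0 ≤ D := l2_nonneg _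
  set s := √(m / (8 * B)) with hs
  have hs0 : 0 < s := Real.sqrt_pos.2 (by positivity)
  have hs2 : s ^ 2 = m / (8 * B) := Real.sq_sqrt (by positivity)
  set K := Real.exp (4 * Real.pi) * m + 5 * L * B + √B * D with hK
  have hK0 : 0 ≤ K := by positivity
  set c := Real.exp (-(8 * Real.pi)) * m / 4 with hc
  have hc0 : 0 < c := by positivity
  have hlim : Tendsto (fun M : ℕ => A * √(M : ℝ)) atTop atTop :=
    Tendsto.const_mul_atTop hA (Real.tendsto_sqrt_atTop.comp tendsto_natCast_atTop_atTop)
  obtain ⟨M₀, hM₀⟩ := eventually_atTop.1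
    ((hlim.eventually_ge_atTop 2).and
      ((hlim.eventually_ge_atTop (2 * K / c)).and (hlim.eventually_gt_atTop s)))
  -- Up to constants this is the longest time for which the deviation `t√E` is below the `L²` norm
  -- of `1/a` over the disc of radius `2^(-M)`.
  refine ⟨s * c / 2, by positivity, M₀, fun M => s / (A * √M * p ^ M), ?_, fun M hM => ?_⟩
  · apply squeeze_zero (fun M => by positivity) (fun M => ?_) (hlim.const_div_atTop s)
    rw [← div_div]
    exact div_le_self (by positivity) (one_le_pow₀ (by linarith))
  obtain ⟨ha2, haK, has⟩ := hM₀ M hM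
  have hE := henergy M
  have hφ := fun x (hx : bumpAt M x ≠ 0) => data_eq_of_bumpAt_ne_zero A hx
  have hexpM := hexp M
  set a := A * √(M : ℝ) with ha
  have ha0 : 0 < a := by linarith
  have hp1 : 1 ≤ p ^ M := one_le_pow₀ (by linarith)
  set t := s / (a * p ^ M) with ht
  have ht0 : 0 < t := by positivity
  have ht1 : t < 1 := by
    rw [ht, div_lt_one (by positivity)]
    exact has.trans_le (le_mul_of_one_le_right ha0.le hp1)
  refine ⟨⟨ht0, ht1⟩, fun T u v hT h => ?_⟩
  have key := h.le_neg_integral_v hE (by positivity) ⟨ht0, hT⟩ (bumpAt_contDiff M)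
    (bumpAt_hasCompactSupport M) (bumpAt_nonneg M) (bumpAt_le_one M) hL0.le hL (by linarith) hφ
  rw [integral_bumpAt, l2_laplacian_bumpAt, ← hm, ← hD] at key
  refine le_trans (le_trans ?_ key) (neg_le_abs _)
  have hG := le_nonlin_sub_inv ha2
  rw [hexpM] at hG
  set G := nonlin 2 (a - 1 / a) with hGdef
  exact velocity_lower_bound hp hm0 hB0 hD0 hs0 hs2 ha0 (Real.exp_pos _)
    (Real.exp_pos _) haK hG

/-! ### A criterion for norm inflation and for discontinuity of the flow -/

/-- A norm that is at most exponentially weak on the bump functions at scale `2 ^ (-M)`. -/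
def ControlsBumps (N₁ : (Plane → ℝ) → ℝ≥0∞) : Prop :=
  ∃ C Λ : ℝ, 0 < C ∧ 0 < Λ ∧ ∀ (M : ℕ) (w : Plane → ℝ), MemLp w 2 volume →
    ENNReal.ofReal |∫ x, w x * bumpAt M x| ≤ ENNReal.ofReal (C * Λ ^ M) * N₁ w

/-- A norm for which the data are finite and small. -/
def VanishesOnData (N₀ : (Plane → ℝ) → ℝ≥0∞) : Prop :=
  ∀ A : ℝ, 0 ≤ A → (∀ M, N₀ (data A M) < ⊤) ∧ Tendsto (fun M => N₀ (data A M)) atTop (𝓝 0)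

theorem normInflation_of_controlsBumps {N₀ N₁ : (Plane → ℝ) → ℝ≥0∞} (h0 : VanishesOnData N₀)
    (h1 : ControlsBumps N₁) : NormInflation 2 N₀ N₁ := by
  obtain ⟨C, Λ, hC, hΛ, h1⟩ := h1
  -- As `p ≥ A`, this gives `p ≥ 4` and `p/4 ≥ 2Λ`: the growth `(p/4)^M` beats the loss `Λ^M` by
  -- `2^M`.
  set A := max 4 (8 * Λ) with hAdef
  have hA4 : 4 ≤ A := le_max_left _ _
  have hA8 : 8 * Λ ≤ A := le_max_right _ _
  have hA0 : 0 < A := by linarith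
  have hpA : A ≤ Real.exp (2 * Real.pi * A ^ 2) := by
    have e1 := Real.add_one_le_exp (2 * Real.pi * A ^ 2)
    have := Real.pi_gt_three
    nlinarith [mul_nonneg (sub_nonneg.2 this.le) (sq_nonneg A)]
  obtain ⟨κ, hκ, M₀, t, ht, hgrow⟩ := exists_velocity_growth hA0 (hA4.trans hpA)
  set p := Real.exp (2 * Real.pi * A ^ 2) with hp
  have hq8 : 8 ≤ Real.exp (4 * Real.pi * A ^ 2) := by
    have hqp : Real.exp (4 * Real.pi * A ^ 2) = p ^ 2 := by
      rw [hp, ← Real.exp_nat_mul]; congr 1; push_cast; ring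
    rw [hqp]; nlinarith
  -- The sequence starts at `M₀` because the times must lie in `(0,1)` for every index.
  have hshift := tendsto_add_atTop_nat M₀
  refine ⟨fun k => data A (k + M₀), fun k => t (k + M₀),
    fun k => hasFiniteEnergy_data hA0.le hq8 _, fun k => (h0 A hA0.le).1 _,
    fun k => (hgrow _ (Nat.le_add_left _ _)).1, (h0 A hA0.le).2.comp hshift, ht.comp hshift,
    fun T u v huv => ?_⟩
  have hlim : Tendsto (fun k : ℕ => ENNReal.ofReal (κ / C * 2 ^ (k + M₀))) atTop (𝓝 ⊤) := by
    apply ENNReal.tendsto_ofReal_nhds_top.2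
    exact ((tendsto_pow_atTop_atTop_of_one_lt one_lt_two).const_mul_atTop
      (div_pos hκ hC)).comp hshift
  refine tendsto_nhds_top_mono hlim ?_
  filter_upwards [huv] with k hk
  have e1 := (hgrow (k + M₀) (Nat.le_add_left _ _)).2 _ _ _ hk.1 hk.2
  have ht0 := (hgrow (k + M₀) (Nat.le_add_left _ _)).1.1
  have e2 := h1 (k + M₀) _ (hk.2.memLp_v _ ⟨ht0.le, hk.1⟩)
  have e3 := (ENNReal.ofReal_le_ofReal e1).trans e2
  set n := k + M₀
  have hpos : 0 < C * Λ ^ n := by positivity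
  have e4 : (C * Λ ^ n) * (κ / C * 2 ^ n) ≤ κ * (p / 4) ^ n := by
    have : (2 * Λ) ^ n ≤ (p / 4) ^ n := pow_le_pow_left₀ (by positivity) (by linarith) n
    calc (C * Λ ^ n) * (κ / C * 2 ^ n) = κ * (2 * Λ) ^ n := by rw [mul_pow]; field_simp
      _ ≤ _ := by gcongr
  have e5 := (ENNReal.ofReal_le_ofReal e4).trans e3
  rw [ENNReal.ofReal_mul hpos.le] at e5
  exact (ENNReal.mul_le_mul_iff_right (ENNReal.ofReal_pos.2 hpos).ne' ENNReal.ofReal_ne_top).1 e5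

lemma energy_zero : energy 2 0 0 = 0 := by
  have hG : IsWeakGradient 0 0 :=
    ⟨locallyIntegrable_zero, locallyIntegrable_zero, fun ζ _ _ e => by simp⟩
  have e1 : (⨅ (G : Plane → Plane) (_ : IsWeakGradient 0 G), ∫⁻ x, ‖G x‖ₑ ^ 2) = 0 :=
    le_antisymm ((iInf₂_le _ hG).trans (by simp)) zero_le
  unfold energy
  rw [e1]
  simp [potential_two]

lemma hasFiniteEnergy_zero : HasFiniteEnergy 2 0 0 :=
  ⟨MemLp.zero', MemLp.zero', by rw [energy_zero]; exact ENNReal.zero_lt_top⟩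

/-- Zero data have zero energy, and the energy inequality leaves no room. No uniqueness theorem is
needed to identify the reference velocity of the flow. -/
lemma IsWeakSolution.v_ae_eq_zero {T : ℝ} {u v : ℝ → Plane → ℝ} (h : IsWeakSolution 2 T 0 0 u v)
    {t : ℝ} (ht : t ∈ Ico 0 T) : v t =ᵐ[volume] 0 := by
  have h1 : ∫⁻ x, ‖v t x‖ₑ ^ 2 = 0 := by
    apply le_antisymm _ zero_le
    rw [← energy_zero]
    exact (lintegral_sq_le_energy' (u t) (v t)).trans (h.energy_le t ht)
  rw [lintegral_eq_zero_iff' ((h.memLp_v t ht).1.enorm.pow_const 2)] at h1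
  filter_upwards [h1] with x hx
  simpa using hx

/-- Continuity with `ε = 1` would keep `N₁` of the velocity at the times `t k` below one, against
inflation. Invariance under almost everywhere equality is required because the reference velocity
vanishes only almost everywhere. -/
theorem flowDiscontinuousAtZero_of_normInflation {N₀ N₁ : (Plane → ℝ) → ℝ≥0∞} (hN₀ : N₀ 0 = 0)
    (hN₁ : N₁ 0 = 0) (hcongr : ∀ f g : Plane → ℝ, f =ᵐ[volume] g → N₁ f = N₁ g)
    (h : NormInflation 2 N₀ N₁) : FlowDiscontinuousAtZero 2 N₀ N₁ := by
  intro T r U V hT hr hU hcont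
  obtain ⟨φ, t, hfin, -, ht01, hφ, ht, hinfl⟩ := h
  obtain ⟨δ, hδ, hcont⟩ := hcont 1 one_pos
  have hsol : IsWeakSolution 2 T 0 0 (U 0 0) (V 0 0) :=
    hU 0 0 hasFiniteEnergy_zero (by rwa [hN₀, hN₁, add_zero])
  have hev : ∀ᶠ k in atTop, N₀ (φ k) + N₁ 0 < min r δ ∧ t k < T := by
    simp only [hN₁, add_zero]
    exact (hφ.eventually_lt_const (lt_min hr hδ)).and (ht.eventually_lt_const hT)
  have hlim := hinfl (fun _ => T) (fun k => U (φ k) 0) (fun k => V (φ k) 0) (by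
    filter_upwards [hev] with k hk
    exact ⟨hk.2, hU _ _ (hfin k) (hk.1.trans_le (min_le_left _ _))⟩)
  obtain ⟨k, hk, hk'⟩ := (hev.and (hlim.eventually (lt_mem_nhds ENNReal.one_lt_top))).exists
  have htk : t k ∈ Ico 0 T := ⟨(ht01 k).1.le, hk.2⟩
  have h1 := hcont (φ k) 0 (hfin k) (hk.1.trans_le (min_le_right _ _)) (t k) htk
  have h2 : N₁ (V (φ k) 0 (t k) - V 0 0 (t k)) = N₁ (V (φ k) 0 (t k)) := by
    apply hcongr
    filter_upwards [hsol.v_ae_eq_zero htk] with x hx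
    simp [hx]
  rw [h2] at h1
  exact absurd (h1.trans hk') (not_lt.2 le_add_self)

/-- For amplitude `A = 0` all data are zero, so a constant sequence tends to zero. -/
lemma VanishesOnData.map_zero {N₀ : (Plane → ℝ) → ℝ≥0∞} (h : VanishesOnData N₀) : N₀ 0 = 0 := by
  have h1 := (h 0 le_rfl).2
  have h2 : ∀ M, data 0 M = 0 := fun M => by ext x; simp [data]
  simp_rw [h2] at h1
  exact tendsto_nhds_unique tendsto_const_nhds h1

/-- The criterion for both forms of ill-posedness. -/
theorem illposed_of_controlsBumps {N₀ N₁ : (Plane → ℝ) → ℝ≥0∞} (h0 : VanishesOnData N₀)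
    (h1 : ControlsBumps N₁) (hN₁ : N₁ 0 = 0)
    (hcongr : ∀ f g : Plane → ℝ, f =ᵐ[volume] g → N₁ f = N₁ g) :
    NormInflation 2 N₀ N₁ ∧ FlowDiscontinuousAtZero 2 N₀ N₁ :=
  have h := normInflation_of_controlsBumps h0 h1
  ⟨h, flowDiscontinuousAtZero_of_normInflation h0.map_zero hN₁ hcongr h⟩

/-! ### The pair `W` and weak `L²` -/

lemma vanishesOnData_of_le {N₀ : (Plane → ℝ) → ℝ≥0∞}
    (h : ∀ A : ℝ, 0 ≤ A → ∃ K : ℝ, ∀ M : ℕ, N₀ (data A M) ≤ ENNReal.ofReal (K / √M)) :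
    VanishesOnData N₀ := by
  intro A hA
  obtain ⟨K, hK⟩ := h A hA
  refine ⟨fun M => (hK M).trans_lt ENNReal.ofReal_lt_top, ?_⟩
  have h1 : Tendsto (fun M : ℕ => K / √(M : ℝ)) atTop (𝓝 0) :=
    (Real.tendsto_sqrt_atTop.comp tendsto_natCast_atTop_atTop).const_div_atTop K
  have h2 := ENNReal.tendsto_ofReal h1
  rw [ENNReal.ofReal_zero] at h2
  exact tendsto_of_tendsto_of_tendsto_of_le_of_le tendsto_const_nhds h2 (fun _ => zero_le) hK

lemma bumpAt_memLp (n : ℕ) : MemLp (bumpAt n) 2 volume :=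
  (bumpAt_contDiff n).continuous.memLp_of_hasCompactSupport (bumpAt_hasCompactSupport n)

lemma planeBump_memLp : MemLp (planeBump : Plane → ℝ) 2 volume :=
  planeBump.continuous.memLp_of_hasCompactSupport planeBump.hasCompactSupport

lemma l2_bumpAt (n : ℕ) : l2 volume (bumpAt n) = l2 volume (planeBump : Plane → ℝ) / 2 ^ n := by
  rw [← pow_left_inj₀ (l2_nonneg _) (div_nonneg (l2_nonneg _) (by positivity)) two_ne_zero, div_pow,
    l2_sq (bumpAt_memLp n), l2_sq planeBump_memLp, ← pow_mul, mul_comm n 2, pow_mul]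
  norm_num
  exact integral_comp_two_pow_smul (fun x => planeBump x ^ 2) n

lemma sum_one_div_two_pow_le (M : ℕ) : ∑ n ∈ Finset.range M, (1 : ℝ) / 2 ^ n ≤ 2 := by
  simpa using sum_geometric_two_le M

/-- The `L²` norms of the bumps decay like `2^(-n)` and are summable, so only the normalization
`1/√M` remains. -/
lemma eLpNorm_data_le {A : ℝ} (hA : 0 ≤ A) (M : ℕ) : eLpNorm (data A M) 2 volume
    ≤ ENNReal.ofReal (2 * A * l2 volume (planeBump : Plane → ℝ) / √M) := by
  have h0 := l2_nonneg (μ := volume) (planeBump : Plane → ℝ)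
  have e1 : data A M = (A / √M) • ∑ n ∈ Finset.range M, bumpAt n := by
    ext x; simp [data, tower]
  rw [e1, eLpNorm_const_smul]
  refine (mul_le_mul_right (eLpNorm_sum_le (fun n _ => (bumpAt_memLp n).1) (by norm_num)) _).trans ?_
  have e2 : ∀ n, eLpNorm (bumpAt n) 2 volume
      = ENNReal.ofReal (l2 volume (planeBump : Plane → ℝ) / 2 ^ n) := by
    intro n
    rw [← l2_bumpAt, l2, ENNReal.ofReal_toReal (bumpAt_memLp n).2.ne]
  simp_rw [e2]
  rw [← ENNReal.ofReal_sum_of_nonneg fun n _ => div_nonneg h0 (by positivity),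
    Real.enorm_eq_ofReal (by positivity), ← ENNReal.ofReal_mul (by positivity)]
  apply ENNReal.ofReal_le_ofReal
  have := sum_one_div_two_pow_le M
  calc A / √M * ∑ n ∈ Finset.range M, l2 volume (planeBump : Plane → ℝ) / 2 ^ n
      = A / √M * (l2 volume (planeBump : Plane → ℝ) * ∑ n ∈ Finset.range M, 1 / 2 ^ n) := by
        simp [div_eq_mul_inv, Finset.mul_sum]
    _ ≤ A / √M * (l2 volume (planeBump : Plane → ℝ) * 2) := by gcongr
    _ = _ := by ring

/-- The set where `|f|` exceeds `σ` lies in the disc of radius `b/σ`. -/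
lemma weakL2Norm_le_of_norm_mul_le {F : Type*} [NormedAddCommGroup F] {f : Plane → F} {b : ℝ}
    (hb : 0 ≤ b) (h : ∀ x, ‖f x‖ * ‖x‖ ≤ b) : weakL2Norm f ≤ ENNReal.ofReal (√Real.pi * b) := by
  apply iSup_le
  intro σ
  rcases eq_or_ne σ 0 with rfl | hσ
  · simp
  have hσ0 : (0 : ℝ) < σ := by exact_mod_cast pos_iff_ne_zero.2 hσ
  have hsub : {x : Plane | (σ : ℝ≥0∞) < ‖f x‖ₑ} ⊆ Metric.closedBall 0 (b / σ) := by
    intro x hx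
    rw [mem_closedBall_zero_iff, le_div_iff₀ hσ0]
    have hx' : (σ : ℝ) < ‖f x‖ := by
      have : (σ : ℝ≥0∞) < (‖f x‖₊ : ℝ≥0∞) := hx
      exact_mod_cast this
    nlinarith [h x, norm_nonneg x]
  have hvol : volume (Metric.closedBall (0 : Plane) (b / σ))
      = ENNReal.ofReal ((b / σ) ^ 2 * Real.pi) := by
    have := EuclideanSpace.volume_ball_fin_two 0 (b / σ)
    rw [Measure.addHaar_closedBall_eq_addHaar_ball, this, ← ENNReal.ofReal_pow (by positivity),
      ← ENNReal.ofReal_mul (by positivity)]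
  calc (σ : ℝ≥0∞) * volume {x : Plane | (σ : ℝ≥0∞) < ‖f x‖ₑ} ^ (1 / 2 : ℝ)
      ≤ σ * ENNReal.ofReal ((b / σ) ^ 2 * Real.pi) ^ (1 / 2 : ℝ) := by
        rw [← hvol]; gcongr
    _ = ENNReal.ofReal (√Real.pi * b) := by
        rw [ENNReal.ofReal_rpow_of_nonneg (by positivity) (by norm_num), ← Real.sqrt_eq_rpow,
          Real.sqrt_mul (by positivity), Real.sqrt_sq (by positivity),
          ← ENNReal.ofReal_coe_nnreal (p := σ), ← ENNReal.ofReal_mul hσ0.le]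
        congr 1
        field_simp

lemma vanishesOnData_wNorm : VanishesOnData wNorm := by
  obtain ⟨C, hC0, hC⟩ := exists_fderiv_planeBump_le
  apply vanishesOnData_of_le
  intro A hA
  refine ⟨2 * A * l2 volume (planeBump : Plane → ℝ) + 2 * √Real.pi * A * C, fun M => ?_⟩
  have h0 := l2_nonneg (μ := volume) (planeBump : Plane → ℝ)
  rw [add_div, ENNReal.ofReal_add (by positivity) (by positivity)]
  apply add_le_add (eLpNorm_data_le hA M)
  refine (iInf₂_le _ (isWeakGradient_data A M)).trans ?_
  refine (weakL2Norm_le_of_norm_mul_le (b := A / √M * C * 2) (by positivity) fun x => ?_).trans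
    (ENNReal.ofReal_le_ofReal (le_of_eq (by ring)))
  rw [norm_dataGradient]
  calc ‖fderiv ℝ (data A M) x‖ * ‖x‖ ≤ (A / √M * C * ∑ n ∈ Finset.range M,
      (Metric.closedBall (0 : Plane) (1 / 2 ^ n)).indicator (fun _ => (2 : ℝ) ^ n) x) * ‖x‖ :=
        mul_le_mul_of_nonneg_right (norm_fderiv_data_le hA hC M x) (norm_nonneg x)
    _ ≤ A / √M * C * 2 := by
        rw [mul_assoc]
        exact mul_le_mul_of_nonneg_left (sum_indicator_mul_norm_le M x) (by positivity)

lemma weakL2Norm_zero : weakL2Norm (0 : Plane → ℝ) = 0 := by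
  simp [weakL2Norm]

lemma weakL2Norm_congr {f g : Plane → ℝ} (h : f =ᵐ[volume] g) : weakL2Norm f = weakL2Norm g := by
  unfold weakL2Norm
  congr 1
  ext σ
  congr 2
  apply measure_congr
  filter_upwards [h] with x hx
  change ((σ : ℝ≥0∞) < ‖f x‖ₑ) = ((σ : ℝ≥0∞) < ‖g x‖ₑ)
  rw [hx]

lemma volume_lt_le_of_weakL2Norm {w : Plane → ℝ} {K σ : ℝ} (hσ : 0 < σ) (hK : 0 ≤ K)
    (hw : weakL2Norm w ≤ ENNReal.ofReal K) :
    volume {x | σ < |w x|} ≤ ENNReal.ofReal (K ^ 2 / σ ^ 2) := by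
  have h1 : ENNReal.ofReal σ * volume {x : Plane | ENNReal.ofReal σ < ‖w x‖ₑ} ^ (1 / 2 : ℝ)
      ≤ ENNReal.ofReal K := (le_iSup (fun σ : ℝ≥0 => (σ : ℝ≥0∞)
    * volume {x : Plane | (σ : ℝ≥0∞) < ‖w x‖ₑ} ^ (1 / 2 : ℝ)) σ.toNNReal).trans hw
  have h2 : {x : Plane | ENNReal.ofReal σ < ‖w x‖ₑ} = {x | σ < |w x|} := by
    ext x
    simp only [mem_ofPred_eq, Real.enorm_eq_ofReal_abs]
    exact ENNReal.ofReal_lt_ofReal_iff_of_nonneg hσ.le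
  rw [h2] at h1
  set V := volume {x | σ < |w x|}
  have h3 : V ^ (1 / 2 : ℝ) ≤ ENNReal.ofReal (K / σ) := by
    rw [ENNReal.ofReal_div_of_pos hσ, ENNReal.le_div_iff_mul_le
      (Or.inl (ENNReal.ofReal_pos.2 hσ).ne') (Or.inl ENNReal.ofReal_ne_top), mul_comm]
    exact h1
  calc V = (V ^ (1 / 2 : ℝ)) ^ 2 := by
        rw [← ENNReal.rpow_natCast, ← ENNReal.rpow_mul]; norm_num
    _ ≤ ENNReal.ofReal (K / σ) ^ 2 := by gcongr
    _ = ENNReal.ofReal (K ^ 2 / σ ^ 2) := by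
        rw [← ENNReal.ofReal_pow (by positivity), div_pow]

/-- Layer cake: on the unit disc the distribution function is at most both `π` and `K²/t²`. Using
the first bound up to `t = K` and the second beyond gives `πK + K`. -/
lemma setLIntegral_le_of_weakL2Norm {w : Plane → ℝ} (hw : AEStronglyMeasurable w volume) {K : ℝ}
    (hK : 0 ≤ K) (hwK : weakL2Norm w ≤ ENNReal.ofReal K) :
    ∫⁻ x in Metric.closedBall (0 : Plane) 1, ‖w x‖ₑ ≤ ENNReal.ofReal ((Real.pi + 1) * K) := by
  have hball : volume (Metric.closedBall (0 : Plane) 1) = ENNReal.ofReal Real.pi := by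
    simp
  have h1 : ∀ t ∈ Ioi (0 : ℝ), volume.restrict (Metric.closedBall (0 : Plane) 1) {x | t < |w x|}
      ≤ ENNReal.ofReal (K ^ 2 / t ^ 2) := fun t ht =>
    (Measure.restrict_apply_le _ _).trans (volume_lt_le_of_weakL2Norm ht hK hwK)
  simp_rw [Real.enorm_eq_ofReal_abs]
  rw [lintegral_eq_lintegral_meas_lt _ (ae_of_all _ fun x => abs_nonneg (w x))
    (hw.aemeasurable.restrict.norm)]
  rcases hK.eq_or_lt with rfl | hK
  · refine (setLIntegral_mono' measurableSet_Ioi h1).trans ?_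
    simp
  have hunion : Ioi (0 : ℝ) = Ioc 0 K ∪ Ioi K := (Ioc_union_Ioi_eq_Ioi hK.le).symm
  rw [hunion, add_mul, one_mul, ENNReal.ofReal_add (by positivity) hK.le]
  refine (lintegral_union_le _ _ _).trans (add_le_add ?_ ?_)
  · refine (setLIntegral_mono' (g := fun _ => ENNReal.ofReal Real.pi) measurableSet_Ioc
      fun t _ => ?_).trans ?_
    · refine (measure_mono (subset_univ _)).trans ?_
      rw [Measure.restrict_apply_univ, hball]
    · rw [setLIntegral_const, Real.volume_Ioc, sub_zero, ENNReal.ofReal_mul Real.pi_pos.le]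
  · refine (setLIntegral_mono' measurableSet_Ioi fun t ht => h1 t (hK.trans ht)).trans ?_
    have hr : ∀ t ∈ Ioi K, K ^ 2 / t ^ 2 = K ^ 2 * t ^ (-2 : ℝ) := fun t ht => by
      rw [Real.rpow_neg (hK.trans ht).le, Real.rpow_ofNat, div_eq_mul_inv]
    rw [setLIntegral_congr_fun measurableSet_Ioi fun t ht => by rw [hr t ht],
      ← ofReal_integral_eq_lintegral_ofReal
        ((integrableOn_Ioi_rpow_of_lt (by norm_num) hK).const_mul _)
        (ae_restrict_of_forall_mem measurableSet_Ioi fun t ht => by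
          have : 0 < t := hK.trans ht
          positivity),
      integral_const_mul, integral_Ioi_rpow_of_lt (by norm_num) hK]
    apply ENNReal.ofReal_le_ofReal
    norm_num
    rw [Real.rpow_neg_one]
    apply le_of_eq
    field_simp

/-- All bumps are bounded by one and live in the unit disc, on which weak `L²` embeds into `L¹`;
hence there is no loss, `Λ = 1`. -/
lemma controlsBumps_weakL2Norm : ControlsBumps weakL2Norm := by
  refine ⟨Real.pi + 1, 1, by positivity, one_pos, fun M w hw => ?_⟩
  rw [one_pow, mul_one]
  by_cases htop : weakL2Norm w = ⊤
  · rw [htop, ENNReal.mul_top (ENNReal.ofReal_pos.2 (by positivity)).ne']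
    exact le_top
  have hK : weakL2Norm w = ENNReal.ofReal (weakL2Norm w).toReal := (ENNReal.ofReal_toReal htop).symm
  rw [hK, ← ENNReal.ofReal_mul (by positivity)]
  refine le_trans ?_ (setLIntegral_le_of_weakL2Norm hw.1 ENNReal.toReal_nonneg hK.le)
  rw [← lintegral_indicator measurableSet_closedBall, ← Real.enorm_eq_ofReal_abs]
  refine (enorm_integral_le_lintegral_enorm _).trans (lintegral_mono fun x => ?_)
  by_cases hx : x ∈ Metric.closedBall (0 : Plane) 1
  · rw [indicator_of_mem hx, enorm_mul]
    refine mul_le_of_le_one_right' ?_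
    rw [Real.enorm_eq_ofReal (bumpAt_nonneg M x)]
    exact ENNReal.ofReal_le_one.2 (bumpAt_le_one M x)
  · have : bumpAt M x = 0 := by
      apply bumpAt_eq_zero
      rw [mem_closedBall_zero_iff, not_le] at hx
      have : (1 : ℝ) ≤ 2 ^ M := one_le_pow₀ (by norm_num)
      nlinarith
    simp [this]

theorem illposed_wNorm :
    NormInflation 2 wNorm weakL2Norm ∧ FlowDiscontinuousAtZero 2 wNorm weakL2Norm :=
  illposed_of_controlsBumps vanishesOnData_wNorm controlsBumps_weakL2Norm weakL2Norm_zero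
    fun _ _ => weakL2Norm_congr

/-! ### Fourier multipliers on the bumps, and duality for tempered distributions -/

open scoped FourierTransform

/-- The bump functions as complex valued Schwartz functions. -/
def bumpS (n : ℕ) : 𝓢(Plane, ℂ) :=
  HasCompactSupport.toSchwartzMap (f := fun x => (bumpAt n x : ℂ))
    ((bumpAt_hasCompactSupport n).comp_left Complex.ofReal_zero)
    (Complex.ofRealCLM.contDiff.comp (bumpAt_contDiff n))

@[simp]
lemma bumpS_apply (n : ℕ) (x : Plane) : bumpS n x = (bumpAt n x : ℂ) := rfl

lemma integral_comp_inv_two_pow_smul {F : Type*} [NormedAddCommGroup F] [NormedSpace ℝ F]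
    (f : Plane → F) (n : ℕ) :
    ∫ x, f (((2 : ℝ) ^ n)⁻¹ • x) = (4 : ℝ) ^ n • ∫ x, f x := by
  rw [Measure.integral_comp_inv_smul, finrank_euclideanSpace_fin, abs_of_pos (by positivity),
    ← pow_mul, mul_comm n 2, pow_mul]
  norm_num

lemma fourier_bumpS (n : ℕ) (ξ : Plane) :
    𝓕 (bumpS n) ξ = ((4 : ℝ) ^ n)⁻¹ • 𝓕 (bumpS 0) (((2 : ℝ) ^ n)⁻¹ • ξ) := by
  rw [SchwartzMap.fourier_coe, SchwartzMap.fourier_coe, Real.fourier_eq, Real.fourier_eq]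
  have h := Measure.integral_comp_smul (volume : Measure Plane)
    (fun v => Real.fourierChar (-inner ℝ v (((2 : ℝ) ^ n)⁻¹ • ξ)) • bumpS 0 v) ((2 : ℝ) ^ n)
  rw [finrank_euclideanSpace_fin, abs_of_pos (by positivity), ← pow_mul, mul_comm n 2,
    pow_mul] at h
  rw [show ((2 : ℝ) ^ 2) = 4 by norm_num] at h
  refine Eq.trans ?_ h
  congr 1
  ext v
  have h1 : (inner ℝ ((2 : ℝ) ^ n • v) (((2 : ℝ) ^ n)⁻¹ • ξ) : ℝ) = inner ℝ v ξ := by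
    rw [real_inner_smul_left, real_inner_smul_right, ← mul_assoc,
      mul_inv_cancel₀ (by positivity), one_mul]
  have h2 : bumpAt n v = bumpAt 0 ((2 : ℝ) ^ n • v) := by simp [bumpAt]
  simp [h1, h2]

/-- The bumps are even. -/
lemma fourierInv_bumpS (n : ℕ) : 𝓕⁻ (bumpS n) = 𝓕 (bumpS n) := by
  ext ξ
  rw [SchwartzMap.fourier_coe, SchwartzMap.fourierInv_coe, Real.fourierInv_eq_fourier_comp_neg]
  have : (fun x => bumpS n (-x)) = bumpS n := by
    ext x
    simp [bumpAt, smul_neg, planeBump.neg]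
  rw [this]

lemma norm_toLp_sq (f : 𝓢(Plane, ℂ)) : ‖f.toLp 2 volume‖ ^ 2 = ∫ x, ‖f x‖ ^ 2 := by
  rw [SchwartzMap.norm_toLp' (by norm_num) (by norm_num), ENNReal.toReal_ofNat,
    ← Real.rpow_natCast, ← Real.rpow_mul (integral_nonneg fun x => by positivity)]
  norm_num

/-- The Sobolev norm of order `τ` of the bump function at scale `1`. -/
def bumpSobolev (τ : ℝ) : ℝ :=
  ‖(SchwartzMap.smulLeftCLM ℂ (fun ξ : Plane => (((1 + ‖ξ‖ ^ 2) ^ (τ / 2) : ℝ) : ℂ))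
    (𝓕 (bumpS 0))).toLp 2 volume‖

lemma bumpSobolev_sq (τ : ℝ) : bumpSobolev τ ^ 2
    = ∫ ξ : Plane, ((1 + ‖ξ‖ ^ 2) ^ (τ / 2) * ‖𝓕 (bumpS 0) ξ‖) ^ 2 := by
  rw [bumpSobolev, norm_toLp_sq]
  congr 1
  ext ξ
  rw [SchwartzMap.smulLeftCLM_apply_apply (by fun_prop), norm_smul, Complex.norm_real,
    Real.norm_of_nonneg (by positivity)]

/-- Dilation reduces every scale to the first one: the transform carries amplitude `4^(-n)`, the
change of variables in the squared norm a factor `4^n`, which leaves `2^(-n)`. All Sobolev and Besov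
estimates of the bumps come from this one. -/
lemma norm_smulLeft_fourier_bumpS_le {g : Plane → ℂ} (hg : g.HasTemperateGrowth) {n : ℕ} {c τ : ℝ}
    (hc : 0 ≤ c) (h : ∀ η, ‖g ((2 : ℝ) ^ n • η)‖ ≤ c * (1 + ‖η‖ ^ 2) ^ (τ / 2)) :
    ‖(SchwartzMap.smulLeftCLM ℂ g (𝓕 (bumpS n))).toLp 2 volume‖ ≤ c * bumpSobolev τ / 2 ^ n := by
  have h0 : 0 ≤ bumpSobolev τ := norm_nonneg _
  refine le_of_sq_le_sq ?_ (by positivity)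
  have hint : Integrable (fun η : Plane =>
      ((1 + ‖η‖ ^ 2) ^ (τ / 2) * ‖𝓕 (bumpS 0) η‖) ^ 2) volume := by
    have := (SchwartzMap.memLp (SchwartzMap.smulLeftCLM ℂ
      (fun ξ : Plane => (((1 + ‖ξ‖ ^ 2) ^ (τ / 2) : ℝ) : ℂ)) (𝓕 (bumpS 0))) 2
        volume).integrable_norm_pow two_ne_zero
    refine this.congr (ae_of_all _ fun η => ?_)
    simp only
    rw [SchwartzMap.smulLeftCLM_apply_apply (by fun_prop), norm_smul, Complex.norm_real,
      Real.norm_of_nonneg (by positivity)]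
  have hscale : ∀ ξ : Plane, ‖SchwartzMap.smulLeftCLM ℂ g (𝓕 (bumpS n)) ξ‖ ^ 2
      = (fun η : Plane => (‖g ((2 : ℝ) ^ n • η)‖ * (((4 : ℝ) ^ n)⁻¹ * ‖𝓕 (bumpS 0) η‖)) ^ 2)
        (((2 : ℝ) ^ n)⁻¹ • ξ) := by
    intro ξ
    simp only
    rw [SchwartzMap.smulLeftCLM_apply_apply hg, fourier_bumpS, norm_smul, norm_smul,
      smul_inv_smul₀ (by positivity), Real.norm_of_nonneg (by positivity)]
  rw [norm_toLp_sq]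
  rw [(integral_congr_ae (ae_of_all _ hscale)).trans (integral_comp_inv_two_pow_smul
    (fun η : Plane => (‖g ((2 : ℝ) ^ n • η)‖ * (((4 : ℝ) ^ n)⁻¹ * ‖𝓕 (bumpS 0) η‖)) ^ 2) n),
    div_pow, mul_pow, bumpSobolev_sq, ← integral_const_mul,
    smul_eq_mul, ← integral_const_mul, ← integral_div]
  refine integral_mono_of_nonneg (ae_of_all _ fun η => by positivity)
    ((hint.const_mul _).div_const _) (ae_of_all _ fun η => ?_)
  simp only
  calc (4 : ℝ) ^ n * (‖g ((2 : ℝ) ^ n • η)‖ * (((4 : ℝ) ^ n)⁻¹ * ‖𝓕 (bumpS 0) η‖)) ^ 2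
      ≤ (4 : ℝ) ^ n * (c * (1 + ‖η‖ ^ 2) ^ (τ / 2)
        * (((4 : ℝ) ^ n)⁻¹ * ‖𝓕 (bumpS 0) η‖)) ^ 2 := by
        have := h η
        gcongr
    _ = _ := by
        rw [show (4 : ℝ) = 2 ^ 2 by norm_num, ← pow_mul, mul_comm 2 n, pow_mul]
        field_simp

open scoped FourierTransform

lemma enorm_toLp (f : 𝓢(Plane, ℂ)) : ‖f.toLp 2 volume‖ₑ = eLpNorm f 2 volume := by
  rw [Lp.enorm_def, eLpNorm_congr_ae (f.coeFn_toLp 2 volume)]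

/-- Cauchy–Schwarz for each `L²` representative. Positivity of `c` lets the constant pass through
the infimum, including the value infinity when there is no representative. -/
lemma enorm_apply_le_distL2Norm (T : 𝓢'(Plane, ℂ)) {h : 𝓢(Plane, ℂ)} {c : ℝ} (hc : 0 < c)
    (hh : ‖h.toLp 2 volume‖ ≤ c) : ‖T h‖ₑ ≤ ENNReal.ofReal c * distL2Norm T := by
  have hc' := (ENNReal.ofReal_pos.2 hc).ne'
  unfold distL2Norm
  rw [ENNReal.mul_iInf_of_ne hc' ENNReal.ofReal_ne_top]
  refine le_iInf fun g => ?_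
  rw [ENNReal.mul_iInf_of_ne hc' ENNReal.ofReal_ne_top]
  refine le_iInf fun hg => ?_
  rw [← hg, Lp.toTemperedDistribution_apply]
  have h1 : ‖∫ x, h x • g x‖ₑ ≤ eLpNorm (⇑h • ⇑g) 1 volume := by
    rw [eLpNorm_one_eq_lintegral_enorm]
    exact enorm_integral_le_lintegral_enorm _
  have h2 : eLpNorm (⇑h • ⇑g) 1 volume ≤ eLpNorm h 2 volume * eLpNorm g 2 volume :=
    eLpNorm_smul_le_mul_eLpNorm (Lp.aestronglyMeasurable g) h.continuous.aestronglyMeasurable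
  refine h1.trans (h2.trans ?_)
  rw [← enorm_toLp, ← Lp.enorm_def]
  gcongr
  rw [← ofReal_norm]
  exact ENNReal.ofReal_le_ofReal hh

lemma distL2Norm_coe_le (f : 𝓢(Plane, ℂ)) : distL2Norm (f : 𝓢'(Plane, ℂ)) ≤ ‖f.toLp 2 volume‖ₑ :=
  iInf₂_le (f := fun (g : Lp ℂ 2 (volume : Measure Plane)) _ => ‖g‖ₑ) (f.toLp 2 volume)
    (Lp.toTemperedDistribution_toLp_eq f)

lemma distL2Norm_zero : distL2Norm 0 = 0 := by
  have h := distL2Norm_coe_le 0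
  have h1 : (((0 : 𝓢(Plane, ℂ)) : 𝓢'(Plane, ℂ))) = 0 := map_zero _
  have h2 : (0 : 𝓢(Plane, ℂ)).toLp 2 volume = 0 :=
    (SchwartzMap.toLpCLM ℂ ℂ 2 (volume : Measure Plane)).map_zero
  rw [h1, h2, enorm_zero] at h
  exact le_antisymm h zero_le

lemma norm_fourierInv_toLp (f : 𝓢(Plane, ℂ)) :
    ‖(𝓕⁻ f).toLp 2 volume‖ = ‖f.toLp 2 volume‖ := by
  rw [← SchwartzMap.norm_fourier_toL2_eq (𝓕⁻ f), FourierTransform.fourier_fourierInv_eq]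

/-- The data as complex valued Schwartz functions. -/
def dataS (A : ℝ) (M : ℕ) : 𝓢(Plane, ℂ) :=
  ((A / √M : ℝ) : ℂ) • ∑ n ∈ Finset.range M, bumpS n

lemma dataS_apply (A : ℝ) (M : ℕ) (x : Plane) : dataS A M x = (data A M x : ℂ) := by
  have : (∑ n ∈ Finset.range M, bumpS n) x = ∑ n ∈ Finset.range M, bumpS n x := by
    simp
  simp only [dataS, data, tower, smul_apply, this, bumpS_apply, smul_eq_mul]
  push_cast
  rfl

lemma represents_data (A : ℝ) (M : ℕ) :
    Represents (dataS A M : 𝓢'(Plane, ℂ)) (data A M) := by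
  intro g
  simp_rw [← dataS_apply]
  refine ⟨(g.memLp 2 volume).integrable_mul ((dataS A M).memLp 2 volume), ?_⟩
  rw [SchwartzMap.coe_apply]
  rfl

lemma distL2Norm_multiplier_data_le {A : ℝ} (hA : 0 ≤ A) (M : ℕ) {g : Plane → ℂ}
    (hg : g.HasTemperateGrowth) {c : ℕ → ℝ}
    (hc : ∀ n, ‖(SchwartzMap.smulLeftCLM ℂ g (𝓕 (bumpS n))).toLp 2 volume‖ ≤ c n) :
    distL2Norm (TemperedDistribution.fourierMultiplierCLM ℂ g (dataS A M : 𝓢'(Plane, ℂ)))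
      ≤ ENNReal.ofReal (A / √M * ∑ n ∈ Finset.range M, c n) := by
  rw [TemperedDistribution.fourierMultiplierCLM_toTemperedDistributionCLM_eq hg]
  refine (distL2Norm_coe_le _).trans ?_
  rw [← ofReal_norm]
  apply ENNReal.ofReal_le_ofReal
  have h1 : (SchwartzMap.fourierMultiplierCLM ℂ g (dataS A M)).toLp 2 volume
      = ((A / √M : ℝ) : ℂ) • ∑ n ∈ Finset.range M,
        (SchwartzMap.fourierMultiplierCLM ℂ g (bumpS n)).toLp 2 volume := by
    have := congrArg (SchwartzMap.toLpCLM ℂ ℂ 2 (volume : Measure Plane))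
      (show SchwartzMap.fourierMultiplierCLM ℂ g (dataS A M)
        = ((A / √M : ℝ) : ℂ) • ∑ n ∈ Finset.range M, SchwartzMap.fourierMultiplierCLM ℂ g (bumpS n)
        by rw [dataS, map_smul, map_sum])
    rw [map_smul, map_sum] at this
    exact this
  rw [h1, norm_smul, Complex.norm_real, Real.norm_of_nonneg (by positivity)]
  gcongr
  refine (norm_sum_le _ _).trans (Finset.sum_le_sum fun n _ => ?_)
  rw [SchwartzMap.fourierMultiplierCLM_apply, norm_fourierInv_toLp]
  exact hc n

lemma Represents.enorm_apply_bumpS {T : 𝓢'(Plane, ℂ)} {w : Plane → ℝ} (h : Represents T w) (n : ℕ) :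
    ENNReal.ofReal |∫ x, w x * bumpAt n x| = ‖T (bumpS n)‖ₑ := by
  have e : ∫ x, bumpS n x * (w x : ℂ) = ((∫ x, w x * bumpAt n x : ℝ) : ℂ) := by
    rw [← integral_complex_ofReal]
    congr 1
    ext x
    push_cast
    exact mul_comm _ _
  rw [(h _).2, e, ← ofReal_norm, Complex.norm_real, Real.norm_eq_abs]

lemma Represents.congr {T : 𝓢'(Plane, ℂ)} {f g : Plane → ℝ} (h : Represents T f)
    (hfg : f =ᵐ[volume] g) : Represents T g := by
  intro k
  have e : (fun x => k x * (f x : ℂ)) =ᵐ[volume] fun x => k x * (g x : ℂ) := by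
    filter_upwards [hfg] with x hx
    rw [hx]
  exact ⟨(h k).1.congr e, (h k).2.trans (integral_congr_ae e)⟩

lemma represents_congr_iff {f g : Plane → ℝ} (hfg : f =ᵐ[volume] g) (T : 𝓢'(Plane, ℂ)) :
    Represents T f ↔ Represents T g :=
  ⟨fun h => h.congr hfg, fun h => h.congr hfg.symm⟩

lemma represents_zero : Represents 0 0 := fun g => by simp

/-- By duality the multiplier moves onto the bump, where Plancherel and evenness reduce its effect
to a weighted norm of the Fourier transform. -/
lemma enorm_fourierMultiplier_bumpS_le (T : 𝓢'(Plane, ℂ)) (g : Plane → ℂ) {c : ℝ} (hc : 0 < c)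
    {n : ℕ} (h : ‖(SchwartzMap.smulLeftCLM ℂ g (𝓕 (bumpS n))).toLp 2 volume‖ ≤ c) :
    ‖TemperedDistribution.fourierMultiplierCLM ℂ g T (bumpS n)‖ₑ
      ≤ ENNReal.ofReal c * distL2Norm T := by
  rw [TemperedDistribution.fourierMultiplierCLM_apply_apply]
  apply enorm_apply_le_distL2Norm _ hc
  rwa [SchwartzMap.norm_fourier_toL2_eq, fourierInv_bumpS]

/-! ### Sobolev norms -/

lemma sobolevNorm_le {s : ℝ} {T : 𝓢'(Plane, ℂ)} {f : Plane → ℝ} (h : Represents T f) :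
    sobolevNorm s f ≤ distSobolevNorm s T :=
  iInf₂_le (f := fun T _ => distSobolevNorm s T) T h

/-- From `1 + 4^n |η|² ≤ 4^n (1 + |η|²)`, raised to the power `τ/2`. The larger nonnegative exponent
`τ` makes this monotone and covers negative `s`. -/
lemma norm_besselWeight_fourier_bumpS_le {s τ : ℝ} (hsτ : s ≤ τ) (hτ : 0 ≤ τ) (n : ℕ) :
    ‖(SchwartzMap.smulLeftCLM ℂ (fun ξ : Plane => (((1 + ‖ξ‖ ^ 2) ^ (s / 2) : ℝ) : ℂ))
      (𝓕 (bumpS n))).toLp 2 volume‖ ≤ (2 ^ τ / 2) ^ n * bumpSobolev τ := by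
  have h := norm_smulLeft_fourier_bumpS_le
    (g := fun ξ : Plane => (((1 + ‖ξ‖ ^ 2) ^ (s / 2) : ℝ) : ℂ)) (by fun_prop) (n := n)
    (c := (2 ^ τ) ^ n) (τ := τ) (by positivity) ?_
  · refine h.trans (le_of_eq ?_)
    rw [div_pow]; ring
  intro η
  have h4 : (1 : ℝ) ≤ 4 ^ n := one_le_pow₀ (by norm_num)
  have e1 : ((2 : ℝ) ^ τ) ^ n = (4 ^ n) ^ (τ / 2) := by
    rw [show (4 : ℝ) = 2 ^ (2 : ℝ) by norm_num, ← Real.rpow_natCast, ← Real.rpow_natCast,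
      ← Real.rpow_mul (by norm_num), ← Real.rpow_mul (by norm_num),
      ← Real.rpow_mul (by norm_num)]
    congr 1; ring
  have e2 : ‖(2 : ℝ) ^ n • η‖ ^ 2 = 4 ^ n * ‖η‖ ^ 2 := by
    rw [norm_two_pow_smul, mul_pow, ← pow_mul, mul_comm n 2, pow_mul]; norm_num
  rw [Complex.norm_real, Real.norm_of_nonneg (by positivity), e1,
    ← Real.mul_rpow (by positivity) (by positivity), e2]
  calc (1 + 4 ^ n * ‖η‖ ^ 2) ^ (s / 2) ≤ (1 + 4 ^ n * ‖η‖ ^ 2) ^ (τ / 2) :=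
        Real.rpow_le_rpow_of_exponent_le (le_add_of_nonneg_right (by positivity)) (by linarith)
    _ ≤ (4 ^ n * (1 + ‖η‖ ^ 2)) ^ (τ / 2) := by
        apply Real.rpow_le_rpow (by positivity) _ (by linarith)
        linarith

lemma bumpSobolev_nonneg (τ : ℝ) : 0 ≤ bumpSobolev τ := norm_nonneg _

lemma vanishesOnData_sobolevNorm {s : ℝ} (hs : s < 1) : VanishesOnData (sobolevNorm s) := by
  apply vanishesOnData_of_le
  intro A hA
  set τ := max s 0 with hτdef
  have hτ0 : 0 ≤ τ := le_max_right _ _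
  have hτ1 : τ < 1 := max_lt hs one_pos
  set r : ℝ := 2 ^ τ / 2 with hr
  have hr0 : 0 ≤ r := by positivity
  -- Here `s < 1` is used: the contributions of the scales form a convergent geometric series, so
  -- the factor `1/√M` survives.
  have hr1 : r < 1 := by
    rw [hr, div_lt_one two_pos]
    simpa using Real.rpow_lt_rpow_of_exponent_lt one_lt_two hτ1
  refine ⟨A * ((1 - r)⁻¹ * bumpSobolev τ), fun M => ?_⟩
  refine (sobolevNorm_le (represents_data A M)).trans ?_
  refine (distL2Norm_multiplier_data_le hA M (by fun_prop)
    (norm_besselWeight_fourier_bumpS_le (le_max_left s 0) hτ0)).trans (ENNReal.ofReal_le_ofReal ?_)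
  rw [mul_div_right_comm, ← Finset.sum_mul]
  have := bumpSobolev_nonneg τ
  gcongr
  rw [← tsum_geometric_of_lt_one hr0 hr1]
  exact (summable_geometric_of_lt_one hr0 hr1).sum_le_tsum _ fun _ _ => by positivity

/-- The Bessel potential of order `-s` undoes that of order `s` and is moved onto the bump, at an
exponential cost in its scale. This is why `s` may be arbitrarily negative. -/
lemma controlsBumps_sobolevNorm (s : ℝ) : ControlsBumps (sobolevNorm s) := by
  set τ := max (-s) 0 with hτdef
  have h0 := bumpSobolev_nonneg τ
  refine ⟨bumpSobolev τ + 1, 2 ^ τ / 2, by positivity, by positivity, fun M w _ => ?_⟩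
  have hc : 0 < (bumpSobolev τ + 1) * (2 ^ τ / 2) ^ M := by positivity
  have hc' := (ENNReal.ofReal_pos.2 hc).ne'
  unfold sobolevNorm
  rw [ENNReal.mul_iInf_of_ne hc' ENNReal.ofReal_ne_top]
  refine le_iInf fun T => ?_
  rw [ENNReal.mul_iInf_of_ne hc' ENNReal.ofReal_ne_top]
  refine le_iInf fun hT => ?_
  have e : T (bumpS M) = (TemperedDistribution.besselPotential Plane ℂ (-s)
      (TemperedDistribution.besselPotential Plane ℂ s T)) (bumpS M) := by
    rw [TemperedDistribution.besselPotential_besselPotential_apply, add_neg_cancel,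
      TemperedDistribution.besselPotential_zero]
    rfl
  rw [hT.enorm_apply_bumpS, e]
  refine enorm_fourierMultiplier_bumpS_le _ _ hc ?_
  refine (norm_besselWeight_fourier_bumpS_le (le_max_left (-s) 0) (le_max_right _ _) M).trans ?_
  rw [mul_comm]
  gcongr
  linarith

theorem illposed_sobolevNorm {s : ℝ} (hs : s < 1) :
    NormInflation 2 (sobolevNorm s) (sobolevNorm (s - 1)) ∧
      FlowDiscontinuousAtZero 2 (sobolevNorm s) (sobolevNorm (s - 1)) := by
  refine illposed_of_controlsBumps (vanishesOnData_sobolevNorm hs) (controlsBumps_sobolevNorm _)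
    ?_ fun f g hfg => ?_
  · refine le_antisymm ((sobolevNorm_le represents_zero).trans ?_) zero_le
    rw [distSobolevNorm, map_zero, distL2Norm_zero]
  · unfold sobolevNorm
    simp_rw [represents_congr_iff hfg]

open scoped FourierTransform

/-! ### Besov norms -/

lemma norm_smulLeft_fourier_bumpS_le_of_bounded {g : Plane → ℂ} (hg : g.HasTemperateGrowth)
    {b : ℝ} (hb : 0 ≤ b) (h : ∀ ξ, ‖g ξ‖ ≤ b) (n : ℕ) :
    ‖(SchwartzMap.smulLeftCLM ℂ g (𝓕 (bumpS n))).toLp 2 volume‖ ≤ b * bumpSobolev 2 / 2 ^ n := by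
  apply norm_smulLeft_fourier_bumpS_le hg hb
  intro η
  refine (h _).trans (le_mul_of_one_le_right hb ?_)
  norm_num

/-- A bounded symbol that vanishes for `a|ξ| ≤ 1` is at most `b (a|ξ|)²` everywhere, so two
derivatives of the bump buy the gain `a²`. -/
lemma norm_smulLeft_fourier_bumpS_le_of_eq_zero {g : Plane → ℂ} (hg : g.HasTemperateGrowth)
    {a b : ℝ} (hb : 0 ≤ b) (h : ∀ ξ, ‖g ξ‖ ≤ b) (h0 : ∀ ξ, a * ‖ξ‖ ≤ 1 → g ξ = 0)
    (n : ℕ) : ‖(SchwartzMap.smulLeftCLM ℂ g (𝓕 (bumpS n))).toLp 2 volume‖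
      ≤ b * bumpSobolev 2 * a ^ 2 * 2 ^ n := by
  have key := norm_smulLeft_fourier_bumpS_le hg (n := n) (c := b * (a * 2 ^ n) ^ 2) (τ := 2)
    (by positivity) fun η => ?_
  · refine key.trans (le_of_eq ?_)
    field_simp
  norm_num
  by_cases hη : a * ‖(2 : ℝ) ^ n • η‖ ≤ 1
  · rw [h0 _ hη, norm_zero]
    positivity
  · rw [norm_two_pow_smul, not_le, ← mul_assoc] at hη
    have h1 : 1 ≤ (a * 2 ^ n) ^ 2 * ‖η‖ ^ 2 := by
      rw [← mul_pow]
      exact one_le_pow₀ hη.le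
    calc ‖g ((2 : ℝ) ^ n • η)‖ ≤ b * 1 := by rw [mul_one]; exact h _
      _ ≤ b * ((a * 2 ^ n) ^ 2 * (1 + ‖η‖ ^ 2)) := by
        gcongr
        nlinarith [sq_nonneg (a * 2 ^ n)]
      _ = b * (a * 2 ^ n) ^ 2 * (1 + ‖η‖ ^ 2) := by ring

/-- The scaling factor of the cutoffs in the Littlewood–Paley decomposition. -/
def lpScale (j : ℕ) : ℝ := 2 * Real.pi / 2 ^ j

lemma lpScale_pos (j : ℕ) : 0 < lpScale j := by unfold lpScale; positivity

lemma lpScale_succ (j : ℕ) : lpScale j = 2 * lpScale (j + 1) := by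
  unfold lpScale; rw [pow_succ]; field_simp

lemma lpScale_sq_le (j : ℕ) : lpScale j ^ 2 ≤ 64 / 4 ^ j := by
  unfold lpScale
  rw [div_pow, ← pow_mul, mul_comm j 2, pow_mul]
  norm_num
  gcongr
  nlinarith [Real.pi_pos, Real.pi_le_four]

lemma lpLow_eq (χ : 𝓢(Plane, ℂ)) (T : 𝓢'(Plane, ℂ)) : lpLow χ T =
    TemperedDistribution.fourierMultiplierCLM ℂ (fun ξ => χ (lpScale 0 • ξ)) T := by
  simp [lpLow, lpScale]

lemma lpBlock_eq (χ : 𝓢(Plane, ℂ)) (j : ℕ) (T : 𝓢'(Plane, ℂ)) : lpBlock χ j T =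
    TemperedDistribution.fourierMultiplierCLM ℂ
      (fun ξ => χ (lpScale (j + 1) • ξ) - χ (lpScale j • ξ)) T := by
  have e1 : (2 : ℝ) ^ (-(j : ℝ)) * (2 * Real.pi) = lpScale j := by
    rw [lpScale, Real.rpow_neg two_pos.le, Real.rpow_natCast]; field_simp
  have e2 : (2 : ℝ) ^ (-(j : ℝ) - 1) * (2 * Real.pi) = lpScale (j + 1) := by
    rw [show -(j : ℝ) - 1 = -((j + 1 : ℕ) : ℝ) by push_cast; ring, lpScale,
      Real.rpow_neg two_pos.le, Real.rpow_natCast]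
    field_simp
  rw [lpBlock, e1, e2]

lemma hasTemperateGrowth_comp_smul (χ : 𝓢(Plane, ℂ)) (a : ℝ) :
    Function.HasTemperateGrowth (fun ξ => χ (a • ξ)) :=
  χ.hasTemperateGrowth.comp (by fun_prop)

lemma hasTemperateGrowth_one_sub_comp_smul (χ : 𝓢(Plane, ℂ)) (a : ℝ) :
    Function.HasTemperateGrowth (fun ξ => 1 - χ (a • ξ)) :=
  Function.HasTemperateGrowth.sub (by fun_prop) (hasTemperateGrowth_comp_smul χ a)

lemma exists_norm_le_schwartz (χ : 𝓢(Plane, ℂ)) : ∃ B : ℝ, 0 < B ∧ ∀ ξ, ‖χ ξ‖ ≤ B :=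
  ⟨SchwartzMap.seminorm ℝ 0 0 χ + 1, by positivity, fun ξ =>
    (χ.norm_le_seminorm ℝ ξ).trans (by linarith)⟩

lemma IsLPCutoff.eq_one {χ : 𝓢(Plane, ℂ)} (hχ : IsLPCutoff χ) {a : ℝ} (ha : 0 ≤ a) {ξ : Plane}
    (h : a * ‖ξ‖ ≤ 1) : χ (a • ξ) = 1 :=
  hχ.1 _ (by rwa [norm_smul, Real.norm_of_nonneg ha])

lemma IsLPCutoff.eq_zero {χ : 𝓢(Plane, ℂ)} (hχ : IsLPCutoff χ) {a : ℝ} (ha : 0 ≤ a) {ξ : Plane}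
    (h : 2 < a * ‖ξ‖) : χ (a • ξ) = 0 :=
  hχ.2 _ (by rwa [norm_smul, Real.norm_of_nonneg ha])

lemma block_symbol_eq_zero {χ : 𝓢(Plane, ℂ)} (hχ : IsLPCutoff χ) (j : ℕ) {ξ : Plane}
    (h : lpScale j * ‖ξ‖ ≤ 1) : χ (lpScale (j + 1) • ξ) - χ (lpScale j • ξ) = 0 := by
  have h1 : lpScale (j + 1) * ‖ξ‖ ≤ 1 := by
    refine le_trans ?_ h
    rw [lpScale_succ j]
    nlinarith [mul_nonneg (lpScale_pos (j + 1)).le (norm_nonneg ξ)]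
  rw [hχ.eq_one (lpScale_pos _).le h1, hχ.eq_one (lpScale_pos _).le h, sub_self]

/-- Geometric decay on both sides of `n = j`. It expresses that the bump at scale `2^(-n)` is
concentrated at frequencies near `2^n`. -/
lemma sum_min_two_pow_le (j M : ℕ) :
    ∑ n ∈ Finset.range M, min ((2 : ℝ) ^ j / 2 ^ n) (2 ^ n / 2 ^ j) ≤ 3 := by
  have h0 : ∀ n : ℕ, 0 ≤ min ((2 : ℝ) ^ j / 2 ^ n) (2 ^ n / 2 ^ j) := fun n =>
    le_min (by positivity) (by positivity)
  calc ∑ n ∈ Finset.range M, min ((2 : ℝ) ^ j / 2 ^ n) (2 ^ n / 2 ^ j)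
      ≤ ∑ n ∈ Finset.range (j + M), min ((2 : ℝ) ^ j / 2 ^ n) (2 ^ n / 2 ^ j) :=
        Finset.sum_le_sum_of_subset_of_nonneg (Finset.range_subset_range.2 (by omega))
          fun n _ _ => h0 n
    _ = ∑ n ∈ Finset.range j, min ((2 : ℝ) ^ j / 2 ^ n) (2 ^ n / 2 ^ j)
        + ∑ n ∈ Finset.range M, min ((2 : ℝ) ^ j / 2 ^ (j + n)) (2 ^ (j + n) / 2 ^ j) :=
        Finset.sum_range_add _ _ _
    _ ≤ ∑ n ∈ Finset.range j, (2 : ℝ) ^ n / 2 ^ j + ∑ n ∈ Finset.range M, 1 / 2 ^ n := by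
        gcongr with n _ n _
        · exact min_le_right _ _
        · refine (min_le_left _ _).trans (le_of_eq ?_)
          rw [pow_add]; field_simp
    _ ≤ 1 + 2 := by
        refine add_le_add ?_ (sum_one_div_two_pow_le M)
        rw [← Finset.sum_div, geom_sum_eq (by norm_num), div_le_one (by positivity)]
        linarith
    _ = 3 := by norm_num

lemma besovNorm_le {χ : 𝓢(Plane, ℂ)} {s : ℝ} {T : 𝓢'(Plane, ℂ)} {f : Plane → ℝ}
    (h : Represents T f) : besovNorm χ s f ≤ distBesovNorm χ s T :=
  iInf₂_le (f := fun T _ => distBesovNorm χ s T) T h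

/-- Up to constants the bump at scale `n` contributes `2^(-j) min (2^(j-n), 2^(n-j))` to block `j`:
the first bound comes from boundedness of the symbol, the second from its vanishing at low
frequencies. With weight `2^j` the sum over `n` is bounded uniformly in `j`, which is all that a
supremum over blocks asks. -/
lemma vanishesOnData_besovNorm {χ : 𝓢(Plane, ℂ)} (hχ : IsLPCutoff χ) :
    VanishesOnData (besovNorm χ 1) := by
  obtain ⟨B, hB0, hB⟩ := exists_norm_le_schwartz χ
  have hD := bumpSobolev_nonneg 2
  set D := bumpSobolev 2
  apply vanishesOnData_of_le
  intro A hA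
  refine ⟨A * (2 * B * D) + A * (3 * (128 * B * D)),
    fun M => (besovNorm_le (represents_data A M)).trans ?_⟩
  rw [add_div, ENNReal.ofReal_add (by positivity) (by positivity)]
  apply add_le_add
  · rw [lpLow_eq]
    refine (distL2Norm_multiplier_data_le hA M (hasTemperateGrowth_comp_smul χ _)
      (norm_smulLeft_fourier_bumpS_le_of_bounded (hasTemperateGrowth_comp_smul χ _) hB0.le
        fun ξ => hB _)).trans (ENNReal.ofReal_le_ofReal ?_)
    rw [mul_div_right_comm]
    gcongr
    have := sum_one_div_two_pow_le M
    calc ∑ n ∈ Finset.range M, B * D / 2 ^ n = B * D * ∑ n ∈ Finset.range M, 1 / 2 ^ n := by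
          rw [Finset.mul_sum]; simp [div_eq_mul_inv]
      _ ≤ B * D * 2 := by gcongr
      _ = 2 * B * D := by ring
  · refine iSup_le fun j => ?_
    rw [lpBlock_eq, mul_one, Real.rpow_natCast]
    have hg := (hasTemperateGrowth_comp_smul χ (lpScale (j + 1))).sub
      (hasTemperateGrowth_comp_smul χ (lpScale j))
    have hgB : ∀ ξ, ‖χ (lpScale (j + 1) • ξ) - χ (lpScale j • ξ)‖ ≤ 2 * B := fun ξ =>
      (norm_sub_le _ _).trans (by linarith [hB (lpScale (j + 1) • ξ), hB (lpScale j • ξ)])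
    have hc : ∀ n, ‖(SchwartzMap.smulLeftCLM ℂ
        (fun ξ => χ (lpScale (j + 1) • ξ) - χ (lpScale j • ξ)) (𝓕 (bumpS n))).toLp 2 volume‖
        ≤ 128 * B * D / 2 ^ j * min ((2 : ℝ) ^ j / 2 ^ n) (2 ^ n / 2 ^ j) := by
      intro n
      rw [mul_min_of_nonneg _ _ (by positivity)]
      apply le_min
      · refine (norm_smulLeft_fourier_bumpS_le_of_bounded hg (by positivity) hgB n).trans ?_
        calc 2 * B * D / 2 ^ n ≤ 128 * B * D / 2 ^ n := by
              gcongr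
              norm_num
          _ = _ := by field_simp
      · refine (norm_smulLeft_fourier_bumpS_le_of_eq_zero hg (by positivity) hgB
          (fun ξ hξ => block_symbol_eq_zero hχ j hξ) n).trans ?_
        calc 2 * B * D * lpScale j ^ 2 * 2 ^ n ≤ 2 * B * D * (64 / 4 ^ j) * 2 ^ n := by
              gcongr
              exact lpScale_sq_le j
          _ = _ := by
              rw [show (4 : ℝ) = 2 * 2 by norm_num, mul_pow]
              field_simp
              ring
    refine (mul_le_mul_right (distL2Norm_multiplier_data_le hA M hg hc) _).trans ?_
    rw [← ENNReal.ofReal_mul (by positivity)]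
    apply ENNReal.ofReal_le_ofReal
    rw [← Finset.mul_sum]
    calc (2 : ℝ) ^ j * (A / √M * (128 * B * D / 2 ^ j * ∑ n ∈ Finset.range M,
          min ((2 : ℝ) ^ j / 2 ^ n) (2 ^ n / 2 ^ j)))
        ≤ (2 : ℝ) ^ j * (A / √M * (128 * B * D / 2 ^ j * 3)) := by
          gcongr
          exact sum_min_two_pow_le j M
      _ = _ := by field_simp

/-- Only qualitative finiteness: it makes the Littlewood–Paley remainder tend to zero, and its size
does not enter the final constant. -/
lemma Represents.distL2Norm_lt_top {T : 𝓢'(Plane, ℂ)} {w : Plane → ℝ} (h : Represents T w)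
    (hw : MemLp w 2 volume) : distL2Norm T < ⊤ := by
  have hw' : MemLp (fun x => (w x : ℂ)) 2 volume := hw.ofReal
  have hT : ((hw'.toLp : Lp ℂ 2 (volume : Measure Plane)) : 𝓢'(Plane, ℂ)) = T := by
    ext g
    rw [Lp.toTemperedDistribution_apply, (h g).2]
    apply integral_congr_ae
    filter_upwards [hw'.coeFn_toLp] with x hx
    rw [hx, smul_eq_mul]
  exact (iInf₂_le (f := fun (g : Lp ℂ 2 (volume : Measure Plane)) _ => ‖g‖ₑ) _ hT).trans_lt
    enorm_lt_top

lemma fourierMultiplierCLM_sub_apply {g₁ g₂ : Plane → ℂ} (h₁ : g₁.HasTemperateGrowth)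
    (h₂ : g₂.HasTemperateGrowth) (T : 𝓢'(Plane, ℂ)) :
    TemperedDistribution.fourierMultiplierCLM ℂ (fun ξ => g₁ ξ - g₂ ξ) T
      = TemperedDistribution.fourierMultiplierCLM ℂ g₁ T
        - TemperedDistribution.fourierMultiplierCLM ℂ g₂ T := by
  have := TemperedDistribution.smulLeftCLM_sub (F := ℂ) h₁ h₂
  simp only [TemperedDistribution.fourierMultiplierCLM_apply]
  change FourierTransform.fourierInvCLM ℂ 𝓢'(Plane, ℂ)
    (TemperedDistribution.smulLeftCLM ℂ (g₁ - g₂) (𝓕 T)) = _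
  rw [this]
  exact map_sub (FourierTransform.fourierInvCLM ℂ 𝓢'(Plane, ℂ)) _ _

lemma lpLow_add_sum_lpBlock (χ : 𝓢(Plane, ℂ)) (T : 𝓢'(Plane, ℂ)) (J : ℕ) :
    lpLow χ T + ∑ j ∈ Finset.range J, lpBlock χ j T
      = TemperedDistribution.fourierMultiplierCLM ℂ (fun ξ => χ (lpScale J • ξ)) T := by
  induction J with
  | zero => simp [lpLow_eq]
  | succ J ih =>
    rw [Finset.sum_range_succ, ← add_assoc, ih, lpBlock_eq, fourierMultiplierCLM_sub_apply
      (hasTemperateGrowth_comp_smul χ _) (hasTemperateGrowth_comp_smul χ _)]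
    abel

/-- The distribution minus its low frequencies is a Fourier multiplier. -/
lemma fourierMultiplierCLM_one_sub (χ : 𝓢(Plane, ℂ)) (a : ℝ) (T : 𝓢'(Plane, ℂ)) :
    TemperedDistribution.fourierMultiplierCLM ℂ (fun ξ => 1 - χ (a • ξ)) T
      = T - TemperedDistribution.fourierMultiplierCLM ℂ (fun ξ => χ (a • ξ)) T := by
  rw [fourierMultiplierCLM_sub_apply (by fun_prop) (hasTemperateGrowth_comp_smul χ _)]
  simp

/-- Wherever the symbol of the block is nonzero, `lpScale j * |ξ| > 1` and the inserted symbol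
equals one. The insertion can be moved onto the bump, where it gives decay in `j`, while the block
stays with `T`. -/
lemma lpBlock_eq_fourierMultiplier_lpBlock {χ : 𝓢(Plane, ℂ)} (hχ : IsLPCutoff χ) (j : ℕ)
    (T : 𝓢'(Plane, ℂ)) : lpBlock χ j T = TemperedDistribution.fourierMultiplierCLM ℂ
      (fun ξ => 1 - χ ((2 * lpScale j) • ξ)) (lpBlock χ j T) := by
  have h1 := hasTemperateGrowth_comp_smul χ
  have h2 := hasTemperateGrowth_one_sub_comp_smul χ (2 * lpScale j)
  have h3 : Function.HasTemperateGrowth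
      (fun ξ => χ (lpScale (j + 1) • ξ) - χ (lpScale j • ξ)) := (h1 _).sub (h1 _)
  rw [lpBlock_eq, TemperedDistribution.fourierMultiplierCLM_fourierMultiplierCLM_apply
    h3 h2]
  congr 2
  ext ξ
  simp only [Pi.mul_apply]
  by_cases hξ : lpScale j * ‖ξ‖ ≤ 1
  · rw [block_symbol_eq_zero hχ j hξ, zero_mul]
  · rw [hχ.eq_zero (a := 2 * lpScale j) (by linarith [lpScale_pos j]) (by linarith), sub_zero,
      mul_one]

lemma norm_high_frequency_bumpS_le {χ : 𝓢(Plane, ℂ)} (hχ : IsLPCutoff χ) {B : ℝ} (hB0 : 0 < B)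
    (hB : ∀ ξ, ‖χ ξ‖ ≤ B) {a : ℝ} (ha : 0 ≤ a) (n : ℕ) :
    ‖(SchwartzMap.smulLeftCLM ℂ (fun ξ => 1 - χ (a • ξ)) (𝓕 (bumpS n))).toLp 2 volume‖
      ≤ (1 + B) * bumpSobolev 2 * a ^ 2 * 2 ^ n := by
  apply norm_smulLeft_fourier_bumpS_le_of_eq_zero
    (hasTemperateGrowth_one_sub_comp_smul χ a) (by positivity)
  · intro ξ
    refine (norm_sub_le _ _).trans ?_
    rw [norm_one]
    linarith [hB (a • ξ)]
  · intro ξ hξ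
    rw [hχ.eq_one ha hξ, sub_self]

/-- Split `T` into low frequencies, `J` blocks and a remainder. Each block costs at most the Besov
norm, with weight one, and gains `4^(-j)` from the smoothness of the bump, so the sum converges. The
remainder is `O(4^(-J))` times the finite `L²` norm of `T` and disappears as `J → ∞`. -/
lemma enorm_apply_bumpS_le_distBesovNorm {χ : 𝓢(Plane, ℂ)} (hχ : IsLPCutoff χ) {B : ℝ}
    (hB0 : 0 < B) (hB : ∀ ξ, ‖χ ξ‖ ≤ B) {T : 𝓢'(Plane, ℂ)} (hT : distL2Norm T < ⊤) (n : ℕ) :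
    ‖T (bumpS n)‖ₑ ≤ ENNReal.ofReal (1024 * ((1 + B) * (bumpSobolev 2 + 1)) * 2 ^ n)
      * distBesovNorm χ 0 T := by
  have hD := bumpSobolev_nonneg 2
  set D := bumpSobolev 2
  set C := (1 + B) * (D + 1) with hC
  have hC0 : 0 < C := by positivity
  set K := distBesovNorm χ 0 T with hK
  have hlow : ‖lpLow χ T (bumpS n)‖ₑ ≤ ENNReal.ofReal (C * 2 ^ n) * K := by
    refine (enorm_apply_le_distL2Norm _ (by positivity) (?_ : _ ≤ C * 2 ^ n)).trans ?_
    · have h1 := norm_smulLeft_fourier_bumpS_le_of_bounded (g := fun _ => 1) (by fun_prop)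
        zero_le_one (fun ξ => by simp) n
      rw [SchwartzMap.smulLeftCLM_const, one_smul] at h1
      have h2 : ‖(𝓕 (bumpS n)).toLp 2 volume‖ = ‖(bumpS n).toLp 2 volume‖ :=
        SchwartzMap.norm_fourier_toL2_eq _
      rw [← h2]
      refine h1.trans ?_
      have h3 : (1 : ℝ) ≤ 2 ^ n := one_le_pow₀ (by norm_num)
      calc 1 * D / 2 ^ n ≤ 1 * D := div_le_self (by positivity) h3
        _ ≤ C * 1 := by rw [hC]; nlinarith
        _ ≤ C * 2 ^ n := by gcongr
    · gcongr
      exact le_self_add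
  have hblock : ∀ j, ‖lpBlock χ j T (bumpS n)‖ₑ
      ≤ ENNReal.ofReal (C * 2 ^ n * (256 / 4 ^ j)) * K := by
    intro j
    rw [lpBlock_eq_fourierMultiplier_lpBlock hχ]
    refine (enorm_fourierMultiplier_bumpS_le _ _ (by positivity)
      (?_ : _ ≤ C * 2 ^ n * (256 / 4 ^ j))).trans ?_
    · refine (norm_high_frequency_bumpS_le hχ hB0 hB (by linarith [lpScale_pos j]) n).trans ?_
      have h1 := lpScale_sq_le j
      calc (1 + B) * D * (2 * lpScale j) ^ 2 * 2 ^ n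
          = (1 + B) * D * (4 * lpScale j ^ 2) * 2 ^ n := by ring
        _ ≤ (1 + B) * (D + 1) * (4 * (64 / 4 ^ j)) * 2 ^ n := by
            gcongr
            linarith
        _ = C * 2 ^ n * (256 / 4 ^ j) := by rw [hC]; ring
    · gcongr
      refine le_trans ?_ le_add_self
      refine le_trans ?_ (le_iSup _ j)
      simp
  have hJ : ∀ J : ℕ, ‖T (bumpS n)‖ₑ
      ≤ ENNReal.ofReal (C * 2 ^ n * (64 / 4 ^ J)) * distL2Norm T
        + ENNReal.ofReal (1024 * C * 2 ^ n) * K := by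
    intro J
    have e1 := fourierMultiplierCLM_one_sub χ (lpScale J) T
    rw [← lpLow_add_sum_lpBlock] at e1
    have e2 : T (bumpS n) = TemperedDistribution.fourierMultiplierCLM ℂ
        (fun ξ => 1 - χ (lpScale J • ξ)) T (bumpS n)
        + (lpLow χ T (bumpS n) + ∑ j ∈ Finset.range J, lpBlock χ j T (bumpS n)) := by
      rw [e1]
      simp
    rw [e2]
    refine (enorm_add_le _ _).trans (add_le_add ?_ ?_)
    · refine enorm_fourierMultiplier_bumpS_le _ _ (by positivity) ?_
      refine (norm_high_frequency_bumpS_le hχ hB0 hB (lpScale_pos J).le n).trans ?_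
      have h1 := lpScale_sq_le J
      calc (1 + B) * D * lpScale J ^ 2 * 2 ^ n
          ≤ (1 + B) * (D + 1) * (64 / 4 ^ J) * 2 ^ n := by
            gcongr
            linarith
        _ = C * 2 ^ n * (64 / 4 ^ J) := by rw [hC]; ring
    · refine (enorm_add_le _ _).trans ?_
      refine (add_le_add hlow ((enorm_sum_le _ _).trans
        (Finset.sum_le_sum fun j _ => hblock j))).trans ?_
      rw [← Finset.sum_mul, ← add_mul, ← ENNReal.ofReal_sum_of_nonneg fun j _ => by positivity,
        ← ENNReal.ofReal_add (by positivity) (Finset.sum_nonneg fun j _ => by positivity)]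
      gcongr
      have h4 : ∑ j ∈ Finset.range J, (256 : ℝ) / 4 ^ j ≤ 512 := by
        calc ∑ j ∈ Finset.range J, (256 : ℝ) / 4 ^ j
            ≤ ∑ j ∈ Finset.range J, 256 * (1 / 2 ^ j : ℝ) := by
              gcongr with j hj
              rw [mul_one_div]
              gcongr
              norm_num
          _ ≤ 512 := by
              rw [← Finset.mul_sum]
              linarith [sum_one_div_two_pow_le J]
      rw [← Finset.mul_sum]
      have h5 : 0 < C * 2 ^ n := by positivity
      nlinarith
  have hlim : Tendsto (fun J : ℕ => ENNReal.ofReal (C * 2 ^ n * (64 / 4 ^ J)) * distL2Norm T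
      + ENNReal.ofReal (1024 * C * 2 ^ n) * K) atTop
      (𝓝 (0 + ENNReal.ofReal (1024 * C * 2 ^ n) * K)) := by
    refine Tendsto.add ?_ tendsto_const_nhds
    have h1 : Tendsto (fun J : ℕ => C * 2 ^ n * (64 / (4 : ℝ) ^ J)) atTop (𝓝 (C * 2 ^ n * 0)) :=
      ((tendsto_pow_atTop_atTop_of_one_lt (by norm_num)).const_div_atTop 64).const_mul _
    have h2 := ENNReal.Tendsto.mul_const (ENNReal.tendsto_ofReal h1) (Or.inr hT.ne)
    simpa using h2
  rw [zero_add] at hlim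
  exact ge_of_tendsto' hlim hJ

lemma controlsBumps_besovNorm {χ : 𝓢(Plane, ℂ)} (hχ : IsLPCutoff χ) :
    ControlsBumps (besovNorm χ 0) := by
  obtain ⟨B, hB0, hB⟩ := exists_norm_le_schwartz χ
  have h0 := bumpSobolev_nonneg 2
  refine ⟨1024 * ((1 + B) * (bumpSobolev 2 + 1)), 2, by positivity, two_pos, fun M w hw => ?_⟩
  have hc' := (ENNReal.ofReal_pos.2 (show 0 < 1024 * ((1 + B) * (bumpSobolev 2 + 1)) * 2 ^ M by
    positivity)).ne'
  unfold besovNorm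
  rw [ENNReal.mul_iInf_of_ne hc' ENNReal.ofReal_ne_top]
  refine le_iInf fun T => ?_
  rw [ENNReal.mul_iInf_of_ne hc' ENNReal.ofReal_ne_top]
  refine le_iInf fun hT => ?_
  rw [hT.enorm_apply_bumpS]
  exact enorm_apply_bumpS_le_distBesovNorm hχ hB0 hB (hT.distL2Norm_lt_top hw) M

theorem illposed_besovNorm {χ : 𝓢(Plane, ℂ)} (hχ : IsLPCutoff χ) :
    NormInflation 2 (besovNorm χ 1) (besovNorm χ 0) ∧
      FlowDiscontinuousAtZero 2 (besovNorm χ 1) (besovNorm χ 0) := by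
  refine illposed_of_controlsBumps (vanishesOnData_besovNorm hχ) (controlsBumps_besovNorm hχ)
    ?_ fun f g hfg => ?_
  · refine le_antisymm ((besovNorm_le represents_zero).trans ?_) zero_le
    simp [distBesovNorm, lpLow, lpBlock, distL2Norm_zero]
  · unfold besovNorm
    simp_rw [represents_congr_iff hfg]

end

end ExpWave

theorem theorem2p4 :
    (ExpWave.NormInflation 2 ExpWave.wNorm ExpWave.weakL2Norm ∧
      ExpWave.FlowDiscontinuousAtZero 2 ExpWave.wNorm ExpWave.weakL2Norm) ∧
    (∀ χ : SchwartzMap ExpWave.Plane ℂ, ExpWave.IsLPCutoff χ →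
      ExpWave.NormInflation 2 (ExpWave.besovNorm χ 1) (ExpWave.besovNorm χ 0) ∧
      ExpWave.FlowDiscontinuousAtZero 2 (ExpWave.besovNorm χ 1) (ExpWave.besovNorm χ 0)) ∧
    (∀ s : ℝ, s < 1 →
      ExpWave.NormInflation 2 (ExpWave.sobolevNorm s) (ExpWave.sobolevNorm (s - 1)) ∧
      ExpWave.FlowDiscontinuousAtZero 2 (ExpWave.sobolevNorm s) (ExpWave.sobolevNorm (s - 1))) :=
  ⟨ExpWave.illposed_wNorm, fun _ hχ => ExpWave.illposed_besovNorm hχ,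
    fun _ hs => ExpWave.illposed_sobolevNorm hs⟩
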